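/- Let $K,g:(0,\infty)\to\mathbb{R}$ be smooth with $K>0$, and consider the Euler–Korteweg system on $\mathbb{R}$ $$\partial_t\rho+\partial_x(\rho v)=0,\qquad \partial_t v+v\partial_xv+g'(\rho)\partial_x\rho=\partial_x\Big(K(\rho)\partial_x^2\rho+\tfrac12K'(\rho)(\partial_x\rho)^2\Big).$$ Let $\rho_+>0$, $v_+\in\mathbb{R}$. A soliton of speed $s$ with endstate $(\rho_+,v_+)$ is a solution of the form $V^s(x-st)$, where $V^s=(\rho^s,v^s)$ is smooth, $\rho^s>0$, $V^s\to(\rho_+,v_+)$ at $\pm\infty$, every derivative of $V^s$ of order $\geq 1$ decays exponentially at $\pm\infty$, and $\rho^s$ is strictly monotone on each side of a unique extremum, with opposite monotonicity on the two sides. Let $(V^s)_{s\in I}$, $I\subset\mathbb{R}$ open, be a branch of solitons of speed $s$ with the same endstate $(\rho_+,v_+)$, smoothly parametrized by the speed: $V^s(x)$ is smooth in $(s,x)$, and $V^s-(\rho_+,v_+)$ and all its derivatives in $(s,x)$ decay exponentially as $|x|\to\infty$, locally uniformly in $s$. Set $$P(V^s)=\int_{\mathbb{R}}(\rho^s-\rho_+)(v^s-v_+)\,dx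 ,$$ and let $c\in I$ satisfy the stability condition $\frac{d}{ds}P(V^s)\big|_{s=c}<0$. For $V=(\rho,v)$ let $$\delta^2H[V]\begin{pmatrix}r\\u\end{pmatrix}=\begin{pmatrix}\big(-K'(\rho)\partial_x^2\rho-\tfrac12K''(\rho)(\partial_x\rho)^2+g'(\rho)\big)r-\partial_x(K(\rho)\partial_xr)+vu\\ \rho u+vr\end{pmatrix},\qquad J=\begin{pmatrix}0&-1\\-1&0\end{pmatrix},$$ and let $\mathcal{H}^0=H^1(\mathbb{R})\times L^2(\mathbb{R})$ with $\|(r,u)\|_{\mathcal{H}^0}^2=\|r\|_{H^1}^2+\|u\|_{L^2}^2$ (real-valued functions). Theorem. There is a constant $C>0$ such that for every $U_0\in\mathcal{H}^0$ and every solution $U\in C(\mathbb{R};\mathcal{H}^0)$ (in the sense of distributions in $x$, i.e. for all test functions $\Phi\in C_c^\infty(\mathbb{R})^2$ the function $t\mapsto\langle U(t),\Phi\rangle_{L^2}$ is differentiable and satisfies the equation tested against $\Phi$) of $$\partial_tU(x,t)=J\partial_x\,\delta^2H[V^c(x-ct)]\,U(x,t),\qquad U|_{t=0}=U_0,$$ one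 has $$\|U(t)\|_{\mathcal{H}^0}\leq C(1+|t|)\,\|U_0\|_{\mathcal{H}^0}\qquad\text{for all }t\in\mathbb{R}.$$ (In particular, such a solution is unique.) -/

import Mathlib

open Set Filter Topology MeasureTheory
open scoped ContDiff

noncomputable section

namespace EulerKorteweg

/-! ### The function space `𝓗⁰ = H¹ × L²` on the real line -/

/-- Real valued `L²(ℝ)`. -/
abbrev L2R : Type := Lp ℝ 2 (volume : Measure ℝ)

/-- Test functions `φ ∈ C_c^∞(ℝ)`. -/
def IsTest (φ : ℝ → ℝ) : Prop := ContDiff ℝ ∞ φ ∧ HasCompactSupport φ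

/-- An `L²` function times a continuous compactly supported function is integrable. -/
theorem integrable_mul_of_compactSupport (f : L2R) {φ : ℝ → ℝ} (hφ : Continuous φ)
    (hc : HasCompactSupport φ) : Integrable (fun x => f x * φ x) := by
  have h : MemLp φ 2 (volume : Measure ℝ) := hφ.memLp_of_hasCompactSupport hc
  exact (Lp.memLp f).integrable_mul h

theorem IsTest.integrable_mul {φ : ℝ → ℝ} (h : IsTest φ) (f : L2R) :
    Integrable (fun x => f x * φ x) :=
  integrable_mul_of_compactSupport f h.1.continuous h.2

theorem IsTest.integrable_mul_deriv {φ : ℝ → ℝ} (h : IsTest φ) (f : L2R) :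
    Integrable (fun x => f x * deriv φ x) :=
  integrable_mul_of_compactSupport f (h.1.continuous_deriv (by simp)) h.2.deriv

/-- `f'` is the weak derivative of `f`. -/
def IsWeakDeriv (f f' : L2R) : Prop :=
  ∀ φ : ℝ → ℝ, IsTest φ → ∫ x, f x * deriv φ x = -∫ x, f' x * φ x

theorem integral_add_mul (f g : L2R) {φ : ℝ → ℝ} (hf : Integrable (fun x => f x * φ x))
    (hg : Integrable (fun x => g x * φ x)) :
    ∫ x, (f + g : L2R) x * φ x = (∫ x, f x * φ x) + ∫ x, g x * φ x := by
  rw [← integral_add hf hg]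
  refine integral_congr_ae ?_
  filter_upwards [Lp.coeFn_add f g] with x hx
  rw [hx, Pi.add_apply, add_mul]

theorem integral_smul_mul (a : ℝ) (f : L2R) (φ : ℝ → ℝ) :
    ∫ x, (a • f : L2R) x * φ x = a * ∫ x, f x * φ x := by
  rw [← integral_const_mul]
  refine integral_congr_ae ?_
  filter_upwards [Lp.coeFn_smul a f] with x hx
  rw [hx, Pi.smul_apply, smul_eq_mul, mul_assoc]

theorem integral_zero_mul (φ : ℝ → ℝ) : ∫ x, (0 : L2R) x * φ x = 0 := by
  simpa only [zero_smul, zero_mul] using integral_smul_mul 0 0 φ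

/-- The Sobolev space `H¹(ℝ)`: pairs `(f, f')` of `L²` functions such that `f'` is the weak
derivative of `f`, with the norm `‖f‖² + ‖f'‖²` (squared). -/
def H1 : Submodule ℝ (WithLp 2 (L2R × L2R)) where
  carrier := {p | IsWeakDeriv p.fst p.snd}
  zero_mem' := by
    intro φ _
    simp only [WithLp.zero_fst, WithLp.zero_snd, integral_zero_mul, neg_zero]
  add_mem' := by
    intro p q hp hq φ hφ
    rw [WithLp.add_fst, WithLp.add_snd,
      integral_add_mul _ _ (hφ.integrable_mul_deriv _) (hφ.integrable_mul_deriv _),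
      integral_add_mul _ _ (hφ.integrable_mul _) (hφ.integrable_mul _), hp φ hφ, hq φ hφ]
    ring
  smul_mem' := by
    intro a p hp φ hφ
    rw [WithLp.smul_fst, WithLp.smul_snd, integral_smul_mul, integral_smul_mul, hp φ hφ]
    ring

/-- `𝓗⁰ = H¹ × L²`, with `‖(r, u)‖² = ‖r‖²_{H¹} + ‖u‖²_{L²}`. -/
abbrev HZero : Type := WithLp 2 (H1 × L2R)

/-- The first component `r` of `U = (r, u)`. -/
def HZero.r (U : HZero) : L2R := (U.fst : WithLp 2 (L2R × L2R)).fst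

/-- The weak derivative `∂ₓr` of the first component of `U = (r, u)`. -/
def HZero.dr (U : HZero) : L2R := (U.fst : WithLp 2 (L2R × L2R)).snd

/-- The second component `u` of `U = (r, u)`. -/
def HZero.u (U : HZero) : L2R := U.snd

/-- The norm of `𝓗⁰` is the one of `H¹ × L²`. -/
theorem HZero.norm_sq (U : HZero) : ‖U‖ ^ 2 = ‖U.r‖ ^ 2 + ‖U.dr‖ ^ 2 + ‖U.u‖ ^ 2 := by
  have h := WithLp.prod_norm_sq_eq_of_L2 (U.fst : WithLp 2 (L2R × L2R))
  have h' := WithLp.prod_norm_sq_eq_of_L2 U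
  rw [show ‖U.fst‖ = ‖(U.fst : WithLp 2 (L2R × L2R))‖ from rfl, h] at h'
  exact h'

/-! ### The Euler-Korteweg system and its solitons -/

/-- `(ρ, v)`, functions of `t` and `x`, satisfy the Euler-Korteweg system pointwise. -/
def IsEKSolution (K g : ℝ → ℝ) (ρ v : ℝ → ℝ → ℝ) : Prop :=
  ∀ t x : ℝ,
    deriv (fun s => ρ s x) t + deriv (fun y => ρ t y * v t y) x = 0 ∧
    deriv (fun s => v s x) t + v t x * deriv (v t) x + deriv g (ρ t x) * deriv (ρ t) x =
      deriv (fun y => K (ρ t y) * iteratedDeriv 2 (ρ t) y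
        + 1 / 2 * deriv K (ρ t y) * deriv (ρ t) y ^ 2) x

/-- `(ρ, v)` is the profile of a soliton of speed `c` and endstate `(ρp, vp)`. -/
structure IsSoliton (K g : ℝ → ℝ) (ρp vp c : ℝ) (ρ v : ℝ → ℝ) : Prop where
  smooth_ρ : ContDiff ℝ ∞ ρ
  smooth_v : ContDiff ℝ ∞ v
  /-- there is no vacuum -/
  pos : ∀ x, 0 < ρ x
  /-- `(ρ, v)(x - c t)` solves the Euler-Korteweg system -/
  travelingWave : IsEKSolution K g (fun t x => ρ (x - c * t)) (fun t x => v (x - c * t))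
  tendsto_ρ_top : Tendsto ρ atTop (𝓝 ρp)
  tendsto_ρ_bot : Tendsto ρ atBot (𝓝 ρp)
  tendsto_v_top : Tendsto v atTop (𝓝 vp)
  tendsto_v_bot : Tendsto v atBot (𝓝 vp)
  /-- all the derivatives decay exponentially -/
  decay : ∀ k : ℕ, 1 ≤ k → ∃ C α : ℝ, 0 < α ∧ ∀ x,
    |iteratedDeriv k ρ x| ≤ C * Real.exp (-α * |x|) ∧
    |iteratedDeriv k v x| ≤ C * Real.exp (-α * |x|)
  /-- `ρ` changes monotony only once, at its unique extremum -/
  monotony : ∃ x₀ : ℝ,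
    (StrictAntiOn ρ (Iic x₀) ∧ StrictMonoOn ρ (Ici x₀)) ∨
    (StrictMonoOn ρ (Iic x₀) ∧ StrictAntiOn ρ (Ici x₀))

/-- A branch of solitons with the same endstate `(ρp, vp)`, smoothly parametrized by their speed
`s`, which ranges over the open set `I`: the profile is a smooth function of `(s, x)`, and all
the derivatives in `(s, x)` of `U^s = (ρ^s - ρp, v^s - vp)` decay exponentially in `x`, locally
uniformly in `s`. -/
structure IsSolitonBranch (K g : ℝ → ℝ) (ρp vp : ℝ) (I : Set ℝ) (ρ v : ℝ → ℝ → ℝ) : Prop where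
  isOpen : IsOpen I
  soliton : ∀ s ∈ I, IsSoliton K g ρp vp s (ρ s) (v s)
  smooth : ContDiffOn ℝ ∞ (fun p : ℝ × ℝ => (ρ p.1 p.2, v p.1 p.2)) (I ×ˢ univ)
  decay : ∀ s₀ ∈ I, ∀ n : ℕ, ∃ C α δ : ℝ, 0 < α ∧ 0 < δ ∧ ∀ s ∈ I, |s - s₀| < δ → ∀ x : ℝ,
    ‖iteratedFDeriv ℝ n (fun p : ℝ × ℝ => (ρ p.1 p.2 - ρp, v p.1 p.2 - vp)) (s, x)‖
      ≤ C * Real.exp (-α * |x|)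

/-- The rescaled momentum `P(V) = ∫ (ρ - ρp) (v - vp) dx`. -/
def momentum (ρp vp : ℝ) (ρ v : ℝ → ℝ) : ℝ := ∫ x, (ρ x - ρp) * (v x - vp)

/-! ### The linearized equation -/

/-- The zero order coefficient `-K'(ρ) ρ'' - K''(ρ) ρ'² / 2 + g'(ρ)` in `δ²H[V]`. -/
def potential (K g ρ : ℝ → ℝ) (x : ℝ) : ℝ :=
  -deriv K (ρ x) * iteratedDeriv 2 ρ x - 1 / 2 * iteratedDeriv 2 K (ρ x) * deriv ρ x ^ 2
    + deriv g (ρ x)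

/-- The pairing `⟨U, Φ⟩ = ∫ r φ + u ψ dx` of `U = (r, u) ∈ 𝓗⁰` with `Φ = (φ, ψ)`. -/
def pairing (U : HZero) (φ ψ : ℝ → ℝ) : ℝ := ∫ x, (U.r x * φ x + U.u x * ψ x)

/-- `⟨δ²H[V] U, Φ⟩` for `V = (ρ, v)`, `U = (r, u) ∈ 𝓗⁰` and `Φ = (φ, ψ)`, where
`δ²H[V] U = (q r - ∂ₓ(K(ρ) ∂ₓr) + v u, v r + ρ u)`, `q` being the above potential. -/
def hessianH (K g ρ v : ℝ → ℝ) (U : HZero) (φ ψ : ℝ → ℝ) : ℝ :=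
  ∫ x, (potential K g ρ x * U.r x * φ x + K (ρ x) * U.dr x * deriv φ x
    + v x * U.u x * φ x + v x * U.r x * ψ x + ρ x * U.u x * ψ x)

/-- `U ∈ C(ℝ; 𝓗⁰)` solves `∂ₜU = J ∂ₓ δ²H[V(x - c t)] U` in the sense of distributions in `x`
with `J = [[0, -1], [-1, 0]]` : for all `Φ = (φ, ψ) ∈ C_c^∞`,
`d/dt ⟨U, Φ⟩ = - ⟨δ²H[V(x - c t)] U, J ∂ₓ Φ⟩`, where `J ∂ₓ Φ = (-ψ', -φ')`. -/
def IsLinearizedSolution (K g : ℝ → ℝ) (c : ℝ) (ρ v : ℝ → ℝ) (U : ℝ → HZero) : Prop :=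
  Continuous U ∧
  ∀ φ ψ : ℝ → ℝ, IsTest φ → IsTest ψ → ∀ t : ℝ,
    HasDerivAt (fun s => pairing (U s) φ ψ)
      (-hessianH K g (fun x => ρ (x - c * t)) (fun x => v (x - c * t)) (U t)
        (fun x => -deriv ψ x) (fun x => -deriv φ x)) t

end EulerKorteweg

end

open scoped RealInnerProductSpace BoundedContinuousFunction

noncomputable section

namespace EulerKorteweg

/-! ### Test functions -/

/-! In the frame of the soliton, `W(t) = U(t, · + ct)` solves `W' = J ∂ₓ L W`, where `L` is
`δ²H[V^c]` with `v` replaced by `v - c`. Let `B` be its bilinear form. Translation invariance gives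
`L ∂ₓV = 0`. Differentiating the integrated profile equations in the speed gives `L ∂ₛV = (v - v₊, ρ
- ρ₊)`, the gradient of the momentum `P`. If `Q` is the pairing with this gradient, then `B(∂ₛV,
∂ₛV) = Q(∂ₛV) = dP/ds < 0`.

Spectral part. Completing the square in `u` reduces `B` to a Sturm-Liouville form with potential `m
= q - a²/ρ`. Its equation is solved by `ρ'`, which vanishes only at the extremum `x₀`, so Jacobi's
identity yields `B ≥ 0` on `r(x₀) = 0` (`SturmData.form_nonneg`): there is at most one negative
direction. The stability condition says that `∂ₛV` is such a direction, hence `B ≥ 0` on `ker Q`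
(`nonneg_of_negative_direction`). The kernel of `B` is spanned by `∂ₓV`
(`SturmData.exists_eq_smul`). Exponential decay forces the endstate to be hyperbolic
(`IsSoliton.hyperbolic`), so `m` is positive at infinity and `B` is coercive up to finitely many
point values (`SturmData.exists_garding`). Together these give `‖U‖² ≤ C₁ B(U, U) + C₂ Q(U)²`
whenever `T(U) = ⟨ρ', r⟩ = 0` (`exists_norm_sq_le`).

Dynamical part. `B(W, W)` and `Q(W)` are conserved. Subtracting the multiple of `∂ₓV` that achieves
`T = 0` changes neither, so what remains of `W` is bounded for all times. The rate of change of
`T(W)` is a functional `S` that vanishes on `∂ₓV`; it sees only the bounded remainder, so the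
coefficient of `∂ₓV` grows at most linearly (`exists_linear_growth`).

A solution is merely continuous in time with values in `𝓗⁰`, so `B(W, W)` cannot be differentiated
directly. Integrating in time, `Y = ∫ W` and the increment `Z` of `W` satisfy `Z = J ∂ₓ L Y` weakly
(`Coeff.IsOf.isGen`). Since `Z` lies in `𝓗⁰`, the second component of `L Y` is in `H²` and may serve
as a test function; this gives `B(Y, Z) = 0` (`Coeff.IsGen.form_eq_zero`), and conservation follows
through short time averages (`bilinear_conserved`). -/

theorem IsTest.memLp {φ : ℝ → ℝ} (h : IsTest φ) : MemLp φ 2 (volume : Measure ℝ) :=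
  h.1.continuous.memLp_of_hasCompactSupport h.2

theorem IsTest.integrable {φ : ℝ → ℝ} (h : IsTest φ) : Integrable φ :=
  h.1.continuous.integrable_of_hasCompactSupport h.2

theorem IsTest.deriv {φ : ℝ → ℝ} (h : IsTest φ) : IsTest (deriv φ) :=
  ⟨(contDiff_infty_iff_deriv.1 h.1).2, h.2.deriv⟩

theorem IsTest.hasDerivAt {φ : ℝ → ℝ} (h : IsTest φ) (x : ℝ) :
    HasDerivAt φ (_root_.deriv φ x) x :=
  ((h.1.differentiable (by simp)) x).hasDerivAt

theorem IsTest.add {φ ψ : ℝ → ℝ} (h : IsTest φ) (h' : IsTest ψ) :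
    IsTest (fun x => φ x + ψ x) :=
  ⟨h.1.add h'.1, h.2.add h'.2⟩

theorem IsTest.smooth_mul {a φ : ℝ → ℝ} (ha : ContDiff ℝ ∞ a) (h : IsTest φ) :
    IsTest (fun x => a x * φ x) :=
  ⟨ha.mul h.1, h.2.mul_left⟩

theorem IsTest.const_mul {φ : ℝ → ℝ} (c : ℝ) (h : IsTest φ) : IsTest (fun x => c * φ x) :=
  h.smooth_mul contDiff_const

theorem isTest_zero : IsTest (fun _ => 0) :=
  ⟨contDiff_const, HasCompactSupport.zero⟩

theorem IsTest.deriv_add {φ ψ : ℝ → ℝ} (h : IsTest φ) (h' : IsTest ψ) :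
    _root_.deriv (fun x => φ x + ψ x) = fun x => _root_.deriv φ x + _root_.deriv ψ x :=
  funext fun x => ((h.hasDerivAt x).add (h'.hasDerivAt x)).deriv

theorem IsTest.deriv_const_mul {φ : ℝ → ℝ} (c : ℝ) (h : IsTest φ) :
    _root_.deriv (fun x => c * φ x) = fun x => c * _root_.deriv φ x :=
  funext fun x => ((h.hasDerivAt x).const_mul c).deriv

theorem IsTest.exists_support_subset {φ : ℝ → ℝ} (h : IsTest φ) :
    ∃ R : ℝ, 0 < R ∧ ∀ x, R ≤ |x| → φ x = 0 := by
  obtain ⟨R, hR⟩ := h.2.isCompact.isBounded.subset_closedBall 0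
  refine ⟨|R| + 1, by positivity, fun x hx => image_eq_zero_of_notMem_tsupport fun hx' => ?_⟩
  have := hR hx'
  rw [mem_closedBall_zero_iff, Real.norm_eq_abs] at this
  linarith [le_abs_self R]

theorem isTest_of_eq_zero {φ : ℝ → ℝ} (h : ContDiff ℝ ∞ φ) {R : ℝ}
    (hR : ∀ x, R ≤ |x| → φ x = 0) : IsTest φ := by
  refine ⟨h, HasCompactSupport.intro (isCompact_Icc (a := -R) (b := R)) fun x hx => hR x ?_⟩
  by_contra! hx'
  exact hx ⟨(abs_lt.1 hx').1.le, (abs_lt.1 hx').2.le⟩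

/-- The primitive based at `-R` vanishes to the left of the support; to its right it equals the full
integral, which is zero. -/
theorem IsTest.exists_primitive {θ : ℝ → ℝ} (h : IsTest θ) (h0 : ∫ x, θ x = 0) :
    ∃ ψ, IsTest ψ ∧ _root_.deriv ψ = θ := by
  obtain ⟨R, hR, hθ⟩ := h.exists_support_subset
  have hd : ∀ x, HasDerivAt (fun x => ∫ t in (-R)..x, θ t) (θ x) x := fun x =>
    intervalIntegral.integral_hasDerivAt_right (h.1.continuous.intervalIntegrable _ _)
      (h.1.continuous.stronglyMeasurableAtFilter _ _) h.1.continuous.continuousAt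
  have hderiv : _root_.deriv (fun x => ∫ t in (-R)..x, θ t) = θ := funext fun x => (hd x).deriv
  refine ⟨fun x => ∫ t in (-R)..x, θ t, isTest_of_eq_zero (R := R) ?_ ?_, hderiv⟩
  · rw [contDiff_infty_iff_deriv, hderiv]
    exact ⟨fun x => (hd x).differentiableAt, h.1⟩
  · intro x hx
    rcases le_total 0 x with h0x | h0x
    · rw [abs_of_nonneg h0x] at hx
      rw [intervalIntegral.integral_of_le (by linarith),
        setIntegral_eq_integral_of_forall_compl_eq_zero, h0]
      intro y hy
      rw [mem_Ioc, not_and_or, not_lt, not_le] at hy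
      refine hθ y ?_
      rcases hy with hy | hy
      · exact le_abs.2 (Or.inr (by linarith))
      · exact le_abs.2 (Or.inl (by linarith))
    · rw [abs_of_nonpos h0x] at hx
      refine (intervalIntegral.integral_congr (g := fun _ => 0) fun y hy => hθ y ?_).trans (by simp)
      rw [uIcc_of_ge (by linarith)] at hy
      exact le_abs.2 (Or.inr (by linarith [hy.2]))

theorem exists_isTest_integral_eq_one : ∃ χ, IsTest χ ∧ ∫ x, χ x = 1 := by
  let b : ContDiffBump (0 : ℝ) := ⟨1, 2, by norm_num, by norm_num⟩
  exact ⟨b.normed volume, ⟨b.contDiff_normed, b.hasCompactSupport_normed⟩, b.integral_normed⟩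

theorem IsTest.integral_mul_deriv {a a' φ : ℝ → ℝ} (h : IsTest φ) (ha : ∀ x, HasDerivAt a (a' x) x)
    (ha' : Continuous a') :
    ∫ x, a x * _root_.deriv φ x = -∫ x, a' x * φ x := by
  have hac : Continuous a := continuous_iff_continuousAt.2 fun x => (ha x).continuousAt
  exact integral_mul_deriv_eq_deriv_mul_of_integrable (fun x _ => ha x) (fun x _ => h.hasDerivAt x)
    ((hac.mul h.deriv.1.continuous).integrable_of_hasCompactSupport h.deriv.2.mul_left)
    ((ha'.mul h.1.continuous).integrable_of_hasCompactSupport h.2.mul_left)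
    ((hac.mul h.1.continuous).integrable_of_hasCompactSupport h.2.mul_left)

theorem IsTest.integrable_locallyIntegrable_mul {k φ : ℝ → ℝ} (hφ : IsTest φ)
    (hk : LocallyIntegrable k) : Integrable (fun x => k x * φ x) := by
  simpa only [smul_eq_mul, mul_comm] using
    hk.integrable_smul_left_of_hasCompactSupport hφ.1.continuous hφ.2

/-- The lemma of du Bois-Reymond. -/
theorem ae_eq_const_of_integral_mul_deriv_eq_zero {k : ℝ → ℝ} (hk : LocallyIntegrable k)
    (h : ∀ φ, IsTest φ → ∫ x, k x * deriv φ x = 0) : ∃ c : ℝ, ∀ᵐ x, k x = c := by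
  obtain ⟨χ, hχ, hχ1⟩ := exists_isTest_integral_eq_one
  refine ⟨∫ x, k x * χ x, ?_⟩
  refine ae_eq_of_integral_contDiff_smul_eq hk (locallyIntegrable_const _) fun φ hφ hφc => ?_
  have hφt : IsTest φ := ⟨hφ, hφc⟩
  -- Subtracting `(∫ φ) χ` leaves a function of zero mean, hence the derivative of a test function.
  obtain ⟨ψ, hψ, hψ'⟩ := (hφt.add (hχ.const_mul (-∫ x, φ x))).exists_primitive (by
    rw [integral_add hφt.integrable (hχ.const_mul _).integrable, integral_const_mul, hχ1]
    ring)
  have := h ψ hψ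
  rw [hψ'] at this
  simp only [smul_eq_mul]
  rw [integral_mul_const]
  have e : ∀ x, k x * (φ x + (-∫ x, φ x) * χ x) = φ x * k x + (-∫ x, φ x) * (k x * χ x) :=
    fun x => by ring
  simp only [e] at this
  rw [integral_add (by simpa only [mul_comm] using hφt.integrable_locallyIntegrable_mul hk)
    ((hχ.integrable_locallyIntegrable_mul hk).const_mul _), integral_const_mul] at this
  linarith

/-- The lemma of du Bois-Reymond for second derivatives. -/
theorem ae_eq_affine_of_integral_mul_deriv_deriv_eq_zero {k : ℝ → ℝ} (hk : LocallyIntegrable k)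
    (h : ∀ φ, IsTest φ → ∫ x, k x * deriv (deriv φ) x = 0) :
    ∃ a b : ℝ, ∀ᵐ x, k x = a + b * x := by
  obtain ⟨χ, hχ, hχ1⟩ := exists_isTest_integral_eq_one
  set b : ℝ := ∫ x, k x * deriv χ x with hb
  have hid : LocallyIntegrable (fun x : ℝ => b * x) :=
    (continuous_const.mul continuous_id).locallyIntegrable
  -- The hypothesis applied to a primitive of `φ - (∫ φ) χ` shows that the weak derivative of `k` is
  -- the constant `-b`, so `k + b x` has zero weak derivative.
  obtain ⟨c, hc⟩ := ae_eq_const_of_integral_mul_deriv_eq_zero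
    (k := fun x => k x + b * x) (hk.add hid) fun φ hφ => by
    obtain ⟨ψ, hψ, hψ'⟩ := (hφ.add (hχ.const_mul (-∫ x, φ x))).exists_primitive (by
      rw [integral_add hφ.integrable (hχ.const_mul _).integrable, integral_const_mul, hχ1]
      ring)
    have h1 := h ψ hψ
    rw [hψ', hφ.deriv_add (hχ.const_mul _), hχ.deriv_const_mul] at h1
    have e : ∀ x, k x * (deriv φ x + (-∫ x, φ x) * deriv χ x)
        = k x * deriv φ x + (-∫ x, φ x) * (k x * deriv χ x) := fun x => by ring
    simp only [e] at h1
    rw [integral_add (hφ.deriv.integrable_locallyIntegrable_mul hk)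
      ((hχ.deriv.integrable_locallyIntegrable_mul hk).const_mul _), integral_const_mul] at h1
    simp only [add_mul]
    rw [integral_add (hφ.deriv.integrable_locallyIntegrable_mul hk)
      (hφ.deriv.integrable_locallyIntegrable_mul hid),
      hφ.integral_mul_deriv (a := fun x => b * x) (a' := fun _ => b)
        (fun x => by simpa using (hasDerivAt_id x).const_mul b) continuous_const,
      integral_const_mul]
    linarith
  exact ⟨c, -b, hc.mono fun x hx => by linarith⟩

/-! ### Multiplication operators -/

theorem inner_eq_integral (f g : L2R) : ⟪f, g⟫ = ∫ x, f x * g x := by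
  rw [L2.inner_def]
  exact integral_congr_ae (.of_forall fun x => by simp [mul_comm])

theorem integrable_mul_L2 (f g : L2R) : Integrable (fun x => f x * g x) :=
  (Lp.memLp f).integrable_mul (Lp.memLp g)

theorem inner_toLp (f : L2R) {φ : ℝ → ℝ} (h : MemLp φ 2 (volume : Measure ℝ)) :
    ⟪f, h.toLp φ⟫ = ∫ x, f x * φ x := by
  rw [inner_eq_integral]
  refine integral_congr_ae ?_
  filter_upwards [h.coeFn_toLp] with x hx
  rw [hx]

theorem inner_toLp_toLp {f φ : ℝ → ℝ} (hf : MemLp f 2 (volume : Measure ℝ))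
    (h : MemLp φ 2 (volume : Measure ℝ)) : ⟪hf.toLp f, h.toLp φ⟫ = ∫ x, f x * φ x := by
  rw [inner_toLp]
  refine integral_congr_ae ?_
  filter_upwards [hf.coeFn_toLp] with x hx
  rw [hx]

theorem norm_toLp_sq {φ : ℝ → ℝ} (h : MemLp φ 2 (volume : Measure ℝ)) :
    ‖h.toLp φ‖ ^ 2 = ∫ x, φ x ^ 2 := by
  rw [← real_inner_self_eq_norm_sq, inner_toLp]
  refine integral_congr_ae ?_
  filter_upwards [h.coeFn_toLp] with x hx
  rw [hx, sq]

theorem memLp_bcf_mul (a : ℝ →ᵇ ℝ) {f : ℝ → ℝ} (hf : MemLp f 2 (volume : Measure ℝ)) :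
    MemLp (fun x => a x * f x) 2 (volume : Measure ℝ) := by
  refine hf.of_le_mul (c := ‖a‖)
    (a.continuous.aestronglyMeasurable.mul hf.aestronglyMeasurable) (.of_forall fun x => ?_)
  rw [norm_mul]
  exact mul_le_mul_of_nonneg_right (a.norm_coe_le_norm x) (norm_nonneg _)

/-- Multiplication by a bounded continuous function, as an operator on `L²`. -/
def mulOp (a : ℝ →ᵇ ℝ) : L2R →L[ℝ] L2R :=
  LinearMap.mkContinuous
    { toFun := fun f => (memLp_bcf_mul a (Lp.memLp f)).toLp _
      map_add' := fun f g => by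
        refine Lp.ext ?_
        filter_upwards [(memLp_bcf_mul a (Lp.memLp (f + g))).coeFn_toLp, Lp.coeFn_add f g,
          Lp.coeFn_add ((memLp_bcf_mul a (Lp.memLp f)).toLp _)
            ((memLp_bcf_mul a (Lp.memLp g)).toLp _),
          (memLp_bcf_mul a (Lp.memLp f)).coeFn_toLp,
          (memLp_bcf_mul a (Lp.memLp g)).coeFn_toLp] with x h1 h2 h3 h4 h5
        rw [h1, h3, h2, Pi.add_apply, Pi.add_apply, h4, h5, mul_add]
      map_smul' := fun c f => by
        refine Lp.ext ?_
        filter_upwards [(memLp_bcf_mul a (Lp.memLp (c • f))).coeFn_toLp, Lp.coeFn_smul c f,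
          Lp.coeFn_smul c ((memLp_bcf_mul a (Lp.memLp f)).toLp _),
          (memLp_bcf_mul a (Lp.memLp f)).coeFn_toLp] with x h1 h2 h3 h4
        simp only [RingHom.id_apply]
        rw [h1, h3, h2, Pi.smul_apply, Pi.smul_apply, h4, smul_eq_mul, smul_eq_mul]
        ring }
    ‖a‖ fun f => by
      refine Lp.norm_le_mul_norm_of_ae_le_mul ?_
      filter_upwards [(memLp_bcf_mul a (Lp.memLp f)).coeFn_toLp] with x hx
      simp only [LinearMap.coe_mk, AddHom.coe_mk]
      rw [hx, norm_mul]
      exact mul_le_mul_of_nonneg_right (a.norm_coe_le_norm x) (norm_nonneg _)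

theorem coeFn_mulOp (a : ℝ →ᵇ ℝ) (f : L2R) : mulOp a f =ᵐ[volume] fun x => a x * f x :=
  (memLp_bcf_mul a (Lp.memLp f)).coeFn_toLp

theorem inner_mulOp (a : ℝ →ᵇ ℝ) (f g : L2R) : ⟪mulOp a f, g⟫ = ∫ x, a x * f x * g x := by
  rw [inner_eq_integral]
  refine integral_congr_ae ?_
  filter_upwards [coeFn_mulOp a f] with x hx
  rw [hx]

theorem integrable_bcf_mul_mul (a : ℝ →ᵇ ℝ) (f g : L2R) :
    Integrable (fun x => a x * f x * g x) := by
  refine (integrable_mul_L2 (mulOp a f) g).congr ?_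
  filter_upwards [coeFn_mulOp a f] with x hx
  rw [hx]

theorem inner_mulOp_comm (a : ℝ →ᵇ ℝ) (f g : L2R) : ⟪mulOp a f, g⟫ = ⟪mulOp a g, f⟫ := by
  rw [inner_mulOp, inner_mulOp]
  exact integral_congr_ae (.of_forall fun x => by ring)

theorem mulOp_toLp (a : ℝ →ᵇ ℝ) {f : ℝ → ℝ} (hf : MemLp f 2 (volume : Measure ℝ)) :
    mulOp a (hf.toLp f) = (memLp_bcf_mul a hf).toLp _ := by
  refine Lp.ext ?_
  filter_upwards [coeFn_mulOp a (hf.toLp f), hf.coeFn_toLp, (memLp_bcf_mul a hf).coeFn_toLp]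
    with x h1 h2 h3
  rw [h1, h2, h3]

/-! ### Weak derivatives -/

theorem isWeakDeriv_iff {f f' : L2R} : IsWeakDeriv f f' ↔
    ∀ φ (h : IsTest φ), ⟪f, h.deriv.memLp.toLp _⟫ = -⟪f', h.memLp.toLp _⟫ := by
  simp only [inner_toLp]
  rfl

theorem isClosed_isWeakDeriv : IsClosed {p : L2R × L2R | IsWeakDeriv p.1 p.2} := by
  simp only [isWeakDeriv_iff, ofPred_forall]
  refine isClosed_iInter fun φ => isClosed_iInter fun h => isClosed_eq ?_ ?_ <;> fun_prop

/-- The pair of a function and its weak derivative as an element of `H¹`. -/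
def H1.mk (f f' : L2R) (h : IsWeakDeriv f f') : H1 := ⟨WithLp.toLp 2 (f, f'), h⟩

theorem isClosed_H1 : IsClosed (H1 : Set (WithLp 2 (L2R × L2R))) :=
  isClosed_isWeakDeriv.preimage (WithLp.prod_continuous_ofLp 2 L2R L2R)

instance : CompleteSpace H1 := isClosed_H1.completeSpace_coe

theorem isWeakDeriv_toLp {f f' : ℝ → ℝ} (hf : MemLp f 2 (volume : Measure ℝ))
    (hf' : MemLp f' 2 (volume : Measure ℝ)) (hd : ∀ x, HasDerivAt f (f' x) x)
    (hc : Continuous f') : IsWeakDeriv (hf.toLp f) (hf'.toLp f') := by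
  rw [isWeakDeriv_iff]
  intro φ h
  rw [inner_toLp_toLp, inner_toLp_toLp, h.integral_mul_deriv hd hc]

theorem IsTest.isWeakDeriv {φ : ℝ → ℝ} (h : IsTest φ) :
    IsWeakDeriv (h.memLp.toLp φ) (h.deriv.memLp.toLp _) :=
  isWeakDeriv_toLp _ _ h.hasDerivAt h.deriv.1.continuous

/-- By Chebyshev, an `L²` function satisfies `|g| ≥ 1` only on a set of finite measure, while `|h| →
∞` puts a half-line into that set. -/
theorem false_of_memLp_of_tendsto {g h : ℝ → ℝ} (hg : MemLp g 2 (volume : Measure ℝ))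
    (hgh : ∀ᵐ x, g x = h x)
    (ht : Tendsto (fun x => |h x|) atTop atTop ∨ Tendsto (fun x => |h x|) atBot atTop) : False := by
  have hm : MemLp h 2 (volume : Measure ℝ) := (memLp_congr_ae hgh).1 hg
  have hlt := hm.meas_ge_lt_top (by simp) (by simp) one_ne_zero
  rcases ht with ht | ht
  · obtain ⟨R, hR⟩ := eventually_atTop.1 (ht.eventually_ge_atTop 1)
    refine (measure_mono (s := Ici R) (fun x hx => ?_)).trans_lt hlt |>.ne (by simp)
    exact NNReal.coe_le_coe.1 (by simpa using hR x hx)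
  · obtain ⟨R, hR⟩ := eventually_atBot.1 (ht.eventually_ge_atTop 1)
    refine (measure_mono (s := Iic R) (fun x hx => ?_)).trans_lt hlt |>.ne (by simp)
    exact NNReal.coe_le_coe.1 (by simpa using hR x hx)

theorem hasDerivAt_exp_const_mul (s x : ℝ) :
    HasDerivAt (fun x => Real.exp (s * x)) (Real.exp (s * x) * s) x := by
  simpa using ((hasDerivAt_id x).const_mul s).exp

theorem IsTest.exp_mul {ζ : ℝ → ℝ} (s : ℝ) (h : IsTest ζ) :
    IsTest (fun x => Real.exp (s * x) * ζ x) :=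
  h.smooth_mul (Real.contDiff_exp.comp (contDiff_const.mul contDiff_id))

theorem IsTest.deriv_exp_mul {ζ : ℝ → ℝ} (s : ℝ) (h : IsTest ζ) :
    _root_.deriv (fun x => Real.exp (s * x) * ζ x)
      = fun x => Real.exp (s * x) * (s * ζ x + _root_.deriv ζ x) :=
  funext fun x => by
    rw [((hasDerivAt_exp_const_mul s x).fun_mul (h.hasDerivAt x)).deriv]
    ring

theorem locallyIntegrable_mul_L2 {a : ℝ → ℝ} (ha : Continuous a) (g : L2R) :
    LocallyIntegrable (fun x => a x * g x) := by
  have := (((Lp.memLp g).locallyIntegrable (by norm_num)).locallyIntegrableOn univ).continuousOn_mul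
    ha.continuousOn isOpen_univ.isLocallyClosed
  simpa [locallyIntegrableOn_univ] using this

/-- An `L²` function with `g' = -s g`, `s ≠ 0`, vanishes. -/
theorem eq_zero_of_isWeakDeriv_const_mul {g : L2R} {s : ℝ} (hs : s ≠ 0)
    (h : ∀ φ, IsTest φ → ∫ x, g x * deriv φ x = s * ∫ x, g x * φ x) : g = 0 := by
  -- Integrating factor: `e^{s x} g` has zero weak derivative, so `g` is a multiple of `e^{-s x}`,
  -- which is not in `L²` unless it vanishes.
  obtain ⟨c, hc⟩ := ae_eq_const_of_integral_mul_deriv_eq_zero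
    (locallyIntegrable_mul_L2 (a := fun x => Real.exp (s * x)) (by fun_prop) g) fun ζ hζ => by
    have := h _ (hζ.exp_mul s)
    rw [hζ.deriv_exp_mul s, ← integral_const_mul, ← sub_eq_zero, ← integral_sub] at this
    · rw [← this]
      exact integral_congr_ae (.of_forall fun x => by ring)
    · have := (hζ.exp_mul s).deriv
      rw [hζ.deriv_exp_mul s] at this
      exact this.integrable_mul g
    · exact ((hζ.exp_mul s).integrable_mul g).const_mul s
  have hc' : ∀ᵐ x, g x = Real.exp (-s * x) * c := hc.mono fun x hx => by
    rw [← hx, ← mul_assoc, ← Real.exp_add]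
    simp
  by_cases hc0 : c = 0
  · refine Lp.ext ?_
    filter_upwards [hc', Lp.coeFn_zero ℝ 2 (volume : Measure ℝ)] with x h1 h2
    rw [h1, h2, hc0]
    simp
  · refine (false_of_memLp_of_tendsto (Lp.memLp g) hc' ?_).elim
    simp only [abs_mul, Real.abs_exp]
    rcases lt_or_gt_of_ne hs with hs | hs
    · exact Or.inl ((Real.tendsto_exp_atTop.comp
        (tendsto_id.const_mul_atTop (by linarith : 0 < -s))).atTop_mul_const (abs_pos.2 hc0))
    · exact Or.inr ((Real.tendsto_exp_atTop.comp
        (tendsto_id.const_mul_atBot_of_neg (by linarith : -s < 0))).atTop_mul_const (abs_pos.2 hc0))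

/-- The pairs `(φ, φ')`, for test functions `φ`. -/
def testPairs : Submodule ℝ (WithLp 2 (L2R × L2R)) where
  carrier := {p | ∃ φ, ∃ h : IsTest φ, p = WithLp.toLp 2 (h.memLp.toLp φ, h.deriv.memLp.toLp _)}
  zero_mem' := by
    refine ⟨_, isTest_zero, ?_⟩
    have e : deriv (fun _ : ℝ => (0 : ℝ)) = fun _ => 0 := by
      funext x
      simp
    simp only [e]
    rfl
  add_mem' := by
    rintro _ _ ⟨φ, hφ, rfl⟩ ⟨ψ, hψ, rfl⟩
    refine ⟨_, hφ.add hψ, ?_⟩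
    simp only [hφ.deriv_add hψ]
    rfl
  smul_mem' := by
    rintro c _ ⟨φ, hφ, rfl⟩
    refine ⟨_, hφ.const_mul c, ?_⟩
    simp only [hφ.deriv_const_mul c]
    rfl

theorem testPairs_le_H1 : testPairs ≤ H1 := by
  rintro _ ⟨φ, hφ, rfl⟩
  exact hφ.isWeakDeriv

/-- An element `z` of `H¹` orthogonal to the test functions solves `z - z'' = 0` weakly. Factor the
operator: `z + z'` equals its own derivative, so it vanishes; then `z' = -z`, so `z` vanishes too.
-/
theorem closure_testPairs : testPairs.topologicalClosure = H1 := by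
  refine le_antisymm (testPairs.topologicalClosure_minimal testPairs_le_H1 isClosed_H1) ?_
  have hcl : testPairs.topologicalClosure ≤ H1 :=
    testPairs.topologicalClosure_minimal testPairs_le_H1 isClosed_H1
  intro p hp
  set S := testPairs.topologicalClosure
  have : CompleteSpace S := testPairs.isClosed_topologicalClosure.completeSpace_coe
  set z := p - S.starProjection p with hz
  have hzH : z ∈ H1 := H1.sub_mem hp (hcl (Submodule.starProjection_apply_mem S p))
  have hzo : ∀ φ (h : IsTest φ), ⟪z.fst, h.memLp.toLp φ⟫ + ⟪z.snd, h.deriv.memLp.toLp _⟫ = 0 := by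
    intro φ h
    have h1 : z ∈ Sᗮ := Submodule.sub_starProjection_mem_orthogonal p
    have := (Submodule.mem_orthogonal' S z).1 h1 _
      (testPairs.le_topologicalClosure ⟨φ, h, rfl⟩)
    rwa [WithLp.prod_inner_apply] at this
  have hz1 : IsWeakDeriv z.fst z.snd := hzH
  rw [isWeakDeriv_iff] at hz1
  have hsum : z.fst + z.snd = 0 := by
    refine eq_zero_of_isWeakDeriv_const_mul (s := -1) (by norm_num) fun φ h => ?_
    rw [← inner_toLp _ h.memLp, ← inner_toLp _ h.deriv.memLp, inner_add_left, inner_add_left]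
    linarith [hz1 φ h, hzo φ h]
  have hz2 : z.snd = -z.fst := eq_neg_of_add_eq_zero_right hsum
  have hz3 : z.fst = 0 := by
    refine eq_zero_of_isWeakDeriv_const_mul (s := 1) (by norm_num) fun φ h => ?_
    rw [← inner_toLp _ h.memLp, ← inner_toLp _ h.deriv.memLp]
    have := hz1 φ h
    rw [hz2, inner_neg_left] at this
    linarith
  have hz0 : z = 0 := by
    refine WithLp.ofLp_injective 2 (Prod.ext hz3 ?_)
    change z.snd = 0
    rw [hz2, hz3, neg_zero]
  rw [sub_eq_zero.1 (hz.symm.trans hz0)]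
  exact Submodule.starProjection_apply_mem S p

/-- A closed property of `(f, f')` that holds for test functions holds in `H¹`. -/
theorem IsWeakDeriv.induction {P : L2R → L2R → Prop} (hP : IsClosed {p : L2R × L2R | P p.1 p.2})
    (htest : ∀ φ (h : IsTest φ), P (h.memLp.toLp φ) (h.deriv.memLp.toLp _))
    {f f' : L2R} (h : IsWeakDeriv f f') : P f f' := by
  have h1 : WithLp.toLp 2 (f, f') ∈ testPairs.topologicalClosure := by
    rw [closure_testPairs]
    exact h
  refine closure_minimal ?_ (hP.preimage (WithLp.prod_continuous_ofLp 2 L2R L2R)) h1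
  rintro _ ⟨φ, hφ, rfl⟩
  exact htest φ hφ

/-- Integration by parts in `H¹`. -/
theorem IsWeakDeriv.inner_eq_neg {f f' g g' : L2R} (hf : IsWeakDeriv f f') (hg : IsWeakDeriv g g') :
    ⟪f, g'⟫ = -⟪f', g⟫ := by
  refine IsWeakDeriv.induction (P := fun g g' => ⟪f, g'⟫ = -⟪f', g⟫) ?_ ?_ hg
  · exact isClosed_eq (by fun_prop) (by fun_prop)
  · exact isWeakDeriv_iff.1 hf

theorem IsWeakDeriv.add {f f' g g' : L2R} (hf : IsWeakDeriv f f') (hg : IsWeakDeriv g g') :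
    IsWeakDeriv (f + g) (f' + g') :=
  H1.add_mem (x := WithLp.toLp 2 (f, f')) (y := WithLp.toLp 2 (g, g')) hf hg

theorem IsWeakDeriv.sub {f f' g g' : L2R} (hf : IsWeakDeriv f f') (hg : IsWeakDeriv g g') :
    IsWeakDeriv (f - g) (f' - g') :=
  H1.sub_mem (x := WithLp.toLp 2 (f, f')) (y := WithLp.toLp 2 (g, g')) hf hg

theorem IsWeakDeriv.neg {f f' : L2R} (hf : IsWeakDeriv f f') : IsWeakDeriv (-f) (-f') :=
  H1.neg_mem (x := WithLp.toLp 2 (f, f')) hf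

/-- Integration by parts makes `f` and `f'` orthogonal. -/
theorem IsWeakDeriv.norm_add_sq {f f' : L2R} (hf : IsWeakDeriv f f') :
    ‖f + f'‖ ^ 2 = ‖f‖ ^ 2 + ‖f'‖ ^ 2 := by
  have h := hf.inner_eq_neg hf
  rw [real_inner_comm] at h
  rw [norm_add_sq_real, real_inner_comm]
  linarith

/-- The functions `φ + 2 φ' + φ''`, for test functions `φ`. -/
def testSecond : Submodule ℝ L2R where
  carrier := {p | ∃ φ, ∃ h : IsTest φ,
    p = h.memLp.toLp φ + (2 : ℝ) • h.deriv.memLp.toLp _ + h.deriv.deriv.memLp.toLp _}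
  zero_mem' := by
    refine ⟨_, isTest_zero, ?_⟩
    have e : deriv (fun _ : ℝ => (0 : ℝ)) = fun _ => 0 := by
      funext x
      simp
    simp only [e]
    rw [show (isTest_zero.memLp.toLp fun _ => 0) = 0 from rfl]
    simp
  add_mem' := by
    rintro _ _ ⟨φ, hφ, rfl⟩ ⟨ψ, hψ, rfl⟩
    refine ⟨_, hφ.add hψ, ?_⟩
    simp only [hφ.deriv_add hψ, hφ.deriv.deriv_add hψ.deriv]
    rw [show (hφ.add hψ).memLp.toLp _ = hφ.memLp.toLp _ + hψ.memLp.toLp _ from rfl,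
      show (hφ.deriv.add hψ.deriv).memLp.toLp _ = hφ.deriv.memLp.toLp _ + hψ.deriv.memLp.toLp _
        from rfl,
      show (hφ.deriv.deriv.add hψ.deriv.deriv).memLp.toLp _
        = hφ.deriv.deriv.memLp.toLp _ + hψ.deriv.deriv.memLp.toLp _ from rfl]
    module
  smul_mem' := by
    rintro c _ ⟨φ, hφ, rfl⟩
    refine ⟨_, hφ.const_mul c, ?_⟩
    simp only [hφ.deriv_const_mul c, hφ.deriv.deriv_const_mul c]
    rw [show (hφ.const_mul c).memLp.toLp _ = c • hφ.memLp.toLp _ from rfl,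
      show (hφ.deriv.const_mul c).memLp.toLp _ = c • hφ.deriv.memLp.toLp _ from rfl,
      show (hφ.deriv.deriv.const_mul c).memLp.toLp _ = c • hφ.deriv.deriv.memLp.toLp _ from rfl]
    module

theorem tendsto_abs_exp_mul_affine {a b : ℝ} (h : ¬(a = 0 ∧ b = 0)) :
    Tendsto (fun x : ℝ => |Real.exp x * (a + b * x)|) atTop atTop := by
  simp only [abs_mul, Real.abs_exp]
  by_cases hb : b = 0
  · have ha : a ≠ 0 := fun ha => h ⟨ha, hb⟩
    simpa [hb] using Real.tendsto_exp_atTop.atTop_mul_const (abs_pos.2 ha)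
  · refine Real.tendsto_exp_atTop.atTop_mul_atTop₀ ?_
    rcases lt_or_gt_of_ne hb with hb | hb
    · exact tendsto_abs_atBot_atTop.comp
        (tendsto_atBot_add_const_left _ _ (tendsto_id.const_mul_atTop_of_neg hb))
    · exact tendsto_abs_atTop_atTop.comp
        (tendsto_atTop_add_const_left _ _ (tendsto_id.const_mul_atTop hb))

/-- For `φ = e^{-x} ζ` one has `φ + 2 φ' + φ'' = e^{-x} ζ''`. If `g` is orthogonal to all of these,
`e^{-x} g` is affine, and `e^x (a + b x)` is in `L²` only if it is zero. -/
theorem closure_testSecond : testSecond.topologicalClosure = ⊤ := by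
  rw [Submodule.topologicalClosure_eq_top_iff, Submodule.eq_bot_iff]
  intro g hg
  rw [Submodule.mem_orthogonal'] at hg
  obtain ⟨a, b, hab⟩ := ae_eq_affine_of_integral_mul_deriv_deriv_eq_zero
    (locallyIntegrable_mul_L2 (a := fun x => Real.exp (-1 * x)) (by fun_prop) g) fun ζ hζ => by
    have h1 := hg _ ⟨_, hζ.exp_mul (-1), rfl⟩
    have h2 : IsTest (fun x => -1 * ζ x + deriv ζ x) := (hζ.const_mul (-1)).add hζ.deriv
    have e1 := hζ.deriv_exp_mul (-1)
    have e2 := h2.deriv_exp_mul (-1)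
    rw [(hζ.const_mul (-1)).deriv_add hζ.deriv, hζ.deriv_const_mul] at e2
    have t1 := (hζ.exp_mul (-1))
    have t2 := t1.deriv
    have t3 := t2.deriv
    rw [inner_add_right, inner_add_right, inner_smul_right, inner_toLp, inner_toLp, inner_toLp,
      ← integral_const_mul, ← integral_add (t1.integrable_mul g) ((t2.integrable_mul g).const_mul 2),
      ← integral_add _ (t3.integrable_mul g)] at h1
    · rw [← h1, e1, e2]
      exact integral_congr_ae (.of_forall fun x => by ring)
    · exact (t1.integrable_mul g).add ((t2.integrable_mul g).const_mul 2)
  have hab' : ∀ᵐ x, g x = Real.exp x * (a + b * x) := hab.mono fun x hx => by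
    rw [← hx, ← mul_assoc, ← Real.exp_add]
    simp
  by_cases h0 : a = 0 ∧ b = 0
  · refine Lp.ext ?_
    filter_upwards [hab', Lp.coeFn_zero ℝ 2 (volume : Measure ℝ)] with x h1 h2
    rw [h1, h2, h0.1, h0.2]
    simp
  · exact (false_of_memLp_of_tendsto (Lp.memLp g) hab' (Or.inl (tendsto_abs_exp_mul_affine h0))).elim

/-- A closed property of `(f, f', f'')` that holds for test functions holds in `H²`. -/
theorem IsWeakDeriv.induction_second {P : L2R → L2R → L2R → Prop}
    (hP : IsClosed {p : L2R × L2R × L2R | P p.1 p.2.1 p.2.2})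
    (htest : ∀ φ (h : IsTest φ),
      P (h.memLp.toLp φ) (h.deriv.memLp.toLp _) (h.deriv.deriv.memLp.toLp _))
    {f f' f'' : L2R} (h : IsWeakDeriv f f') (h' : IsWeakDeriv f' f'') : P f f' f'' := by
  suffices hmem : (f, f', f'') ∈ closure {p : L2R × L2R × L2R | P p.1 p.2.1 p.2.2} by
    rwa [hP.closure_eq] at hmem
  rw [Metric.mem_closure_iff]
  intro ε hε
  -- Approximating this single combination suffices: two uses of `norm_add_sq` give `‖f + 2f' +
  -- f''‖² = ‖f‖² + 2‖f'‖² + ‖f''‖²`, also for differences.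
  have h1 : f + (2 : ℝ) • f' + f'' ∈ testSecond.topologicalClosure := by
    rw [closure_testSecond]
    trivial
  obtain ⟨_, ⟨φ, hφ, rfl⟩, hlt⟩ := Metric.mem_closure_iff.1 h1 ε hε
  refine ⟨(hφ.memLp.toLp φ, hφ.deriv.memLp.toLp _, hφ.deriv.deriv.memLp.toLp _), htest φ hφ, ?_⟩
  have d1 := h.sub hφ.isWeakDeriv
  have d2 := h'.sub hφ.deriv.isWeakDeriv
  have n1 := d1.norm_add_sq
  have n2 := d2.norm_add_sq
  have n3 := (d1.add d2).norm_add_sq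
  rw [dist_eq_norm, show f + (2 : ℝ) • f' + f'' - (hφ.memLp.toLp φ + (2 : ℝ) • hφ.deriv.memLp.toLp _
    + hφ.deriv.deriv.memLp.toLp _) = f - hφ.memLp.toLp φ + (f' - hφ.deriv.memLp.toLp _)
    + (f' - hφ.deriv.memLp.toLp _ + (f'' - hφ.deriv.deriv.memLp.toLp _)) by module] at hlt
  rw [n1, n2] at n3
  refine max_lt ?_ (max_lt ?_ ?_) <;> rw [dist_eq_norm] <;>
    refine lt_of_le_of_lt (abs_le_of_sq_le_sq' ?_ (norm_nonneg _)).2 hlt <;> rw [n3] <;> dsimp only <;>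
    nlinarith [sq_nonneg ‖f - hφ.memLp.toLp φ‖, sq_nonneg ‖f' - hφ.deriv.memLp.toLp _‖,
      sq_nonneg ‖f'' - hφ.deriv.deriv.memLp.toLp _‖]

/-! ### Pointwise evaluation in `H¹` -/

/-- The kernel `1_{t ≤ x} e^{t - x}`, which represents the evaluation at `x`. -/
def evalKernelFun (x : ℝ) : ℝ → ℝ := (Iic x).indicator fun t => Real.exp (1 * t) * Real.exp (-x)

theorem evalKernelFun_sq (x : ℝ) : (fun t => evalKernelFun x t ^ 2)
    = (Iic x).indicator fun t => Real.exp (2 * t) * Real.exp (-(2 * x)) := by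
  funext t
  by_cases ht : t ∈ Iic x
  · rw [evalKernelFun, indicator_of_mem ht, indicator_of_mem ht, ← Real.exp_add, ← Real.exp_add,
      ← Real.exp_nat_mul]
    congr 1
    push_cast
    ring
  · rw [evalKernelFun, indicator_of_notMem ht, indicator_of_notMem ht]
    norm_num

theorem memLp_evalKernelFun (x : ℝ) : MemLp (evalKernelFun x) 2 (volume : Measure ℝ) := by
  rw [memLp_two_iff_integrable_sq]
  · rw [evalKernelFun_sq, integrable_indicator_iff measurableSet_Iic]
    exact (integrableOn_exp_mul_Iic (by norm_num) x).mul_const _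
  · exact (Measurable.indicator (by fun_prop) measurableSet_Iic).aestronglyMeasurable

/-- The value at `x` of an `H¹` function. -/
def evalAt (x : ℝ) (f f' : L2R) : ℝ := ⟪f + f', (memLp_evalKernelFun x).toLp _⟫

theorem norm_evalKernel_le (x : ℝ) : ‖(memLp_evalKernelFun x).toLp _‖ ≤ 1 := by
  have h : ‖(memLp_evalKernelFun x).toLp _‖ ^ 2 = 1 / 2 := by
    rw [norm_toLp_sq, evalKernelFun_sq, integral_indicator measurableSet_Iic, integral_mul_const,
      integral_exp_mul_Iic (by norm_num), div_mul_eq_mul_div, ← Real.exp_add]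
    simp
  nlinarith [norm_nonneg ((memLp_evalKernelFun x).toLp _)]

theorem abs_evalAt_le (x : ℝ) (f f' : L2R) : |evalAt x f f'| ≤ ‖f‖ + ‖f'‖ := by
  refine (abs_real_inner_le_norm _ _).trans ?_
  calc _ ≤ ‖f + f'‖ * 1 := by gcongr; exact norm_evalKernel_le x
    _ ≤ _ := by rw [mul_one]; exact norm_add_le f f'

@[fun_prop]
theorem continuous_evalAt (x : ℝ) : Continuous fun p : L2R × L2R => evalAt x p.1 p.2 := by
  unfold evalAt
  fun_prop

/-- `e^t (φ + φ')` is the derivative of `e^t φ`, so its integral up to `x` is `e^x φ(x)`. -/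
theorem IsTest.evalAt {φ : ℝ → ℝ} (h : IsTest φ) (x : ℝ) :
    evalAt x (h.memLp.toLp φ) (h.deriv.memLp.toLp _) = φ x := by
  rw [EulerKorteweg.evalAt, ← MemLp.toLp_add, inner_toLp_toLp]
  have e : ∀ t, (φ + _root_.deriv φ) t * evalKernelFun x t
      = (Iic x).indicator (fun t => Real.exp (1 * t) * (1 * φ t + _root_.deriv φ t)
        * Real.exp (-x)) t := by
    intro t
    by_cases ht : t ∈ Iic x
    · rw [evalKernelFun, indicator_of_mem ht, indicator_of_mem ht, Pi.add_apply]
      ring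
    · rw [evalKernelFun, indicator_of_notMem ht, indicator_of_notMem ht, mul_zero]
  have ht := h.exp_mul 1
  have hd := h.deriv_exp_mul 1
  simp only [e]
  rw [integral_indicator measurableSet_Iic, integral_mul_const, ← hd,
    integral_Iic_of_hasDerivAt_of_tendsto' (fun t _ => ht.hasDerivAt t) ht.deriv.integrable.integrableOn
      (ht.2.is_zero_at_infty.mono_left atBot_le_cocompact), sub_zero, mul_right_comm, one_mul,
      ← Real.exp_add]
  simp

theorem intervalIntegral_eq_inner (f : L2R) {a b : ℝ} (hab : a ≤ b) :
    ∫ t in a..b, f t = ⟪f, (memLp_indicator_const (μ := (volume : Measure ℝ)) 2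
      (measurableSet_Ioc (a := a) (b := b)) (1 : ℝ) (Or.inr (by simp))).toLp _⟫ := by
  rw [inner_toLp, intervalIntegral.integral_of_le hab, ← integral_indicator measurableSet_Ioc]
  refine integral_congr_ae (.of_forall fun t => ?_)
  by_cases ht : t ∈ Ioc a b
  · simp [ht]
  · simp [ht]

/-- The fundamental theorem of calculus, by density: the integral is an inner product with an
indicator, so both sides are continuous in `(f, f')`. -/
theorem IsWeakDeriv.evalAt_sub {f f' : L2R} (h : IsWeakDeriv f f') (a b : ℝ) :
    evalAt b f f' - evalAt a f f' = ∫ t in a..b, f' t := by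
  wlog hab : a ≤ b generalizing a b
  · rw [intervalIntegral.integral_symm, ← this b a (le_of_not_ge hab)]
    ring
  rw [intervalIntegral_eq_inner f' hab]
  refine IsWeakDeriv.induction (P := fun f f' => EulerKorteweg.evalAt b f f'
    - EulerKorteweg.evalAt a f f' = ⟪f', _⟫) ?_ ?_ h
  · exact isClosed_eq (by fun_prop) (by fun_prop)
  · intro φ hφ
    rw [hφ.evalAt, hφ.evalAt, ← intervalIntegral_eq_inner _ hab,
      ← intervalIntegral.integral_deriv_eq_sub (fun x _ => (hφ.hasDerivAt x).differentiableAt)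
        (hφ.deriv.1.continuous.intervalIntegrable _ _),
      intervalIntegral.integral_of_le hab, intervalIntegral.integral_of_le hab]
    refine integral_congr_ae (ae_restrict_of_ae ?_)
    filter_upwards [hφ.deriv.memLp.coeFn_toLp] with x hx
    rw [hx]

theorem intervalIntegrable_L2 (f : L2R) (a b : ℝ) : IntervalIntegrable f volume a b :=
  (((Lp.memLp f).locallyIntegrable (by norm_num)).integrableOn_isCompact isCompact_uIcc).intervalIntegrable

theorem IsWeakDeriv.continuous_evalAt {f f' : L2R} (h : IsWeakDeriv f f') :
    Continuous fun x => evalAt x f f' := by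
  have e : (fun x => EulerKorteweg.evalAt x f f')
      = fun x => EulerKorteweg.evalAt 0 f f' + ∫ t in (0)..x, f' t := by
    funext x
    rw [← h.evalAt_sub 0 x]
    ring
  rw [e]
  exact continuous_const.add (intervalIntegral.continuous_primitive (intervalIntegrable_L2 f') 0)

/-- Along test functions converging in `H¹`, the values converge at every point to `evalAt`, and a
subsequence converges almost everywhere to `f`. -/
theorem IsWeakDeriv.ae_eq_evalAt {f f' : L2R} (h : IsWeakDeriv f f') :
    ∀ᵐ x, f x = evalAt x f f' := by
  have h1 : WithLp.toLp 2 (f, f') ∈ closure (testPairs : Set (WithLp 2 (L2R × L2R))) := by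
    rw [← Submodule.topologicalClosure_coe, closure_testPairs]
    exact h
  obtain ⟨p, hp, hlim⟩ := mem_closure_iff_seq_limit.1 h1
  choose φ hφ hpφ using hp
  have hlim1 : Tendsto (fun n => ((hφ n).memLp.toLp (φ n), (hφ n).deriv.memLp.toLp _)) atTop
      (𝓝 (f, f')) := by
    have := ((WithLp.prod_continuous_ofLp 2 L2R L2R).tendsto _).comp hlim
    refine this.congr fun n => ?_
    simp only [Function.comp, hpφ]
  have hlim2 : Tendsto (fun n => (hφ n).memLp.toLp (φ n)) atTop (𝓝 f) :=
    (continuous_fst.tendsto _).comp hlim1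
  obtain ⟨ns, hns, hae⟩ := (tendstoInMeasure_of_tendsto_Lp hlim2).exists_seq_tendsto_ae
  have hall : ∀ᵐ x, ∀ n, (hφ n).memLp.toLp (φ n) x = φ n x :=
    ae_all_iff.2 fun n => (hφ n).memLp.coeFn_toLp
  filter_upwards [hae, hall] with x hx hxn
  have hev : Tendsto (fun n => φ n x) atTop (𝓝 (EulerKorteweg.evalAt x f f')) := by
    have := ((EulerKorteweg.continuous_evalAt x).tendsto _).comp hlim1
    refine this.congr fun n => ?_
    simp only [Function.comp, (hφ n).evalAt]
  refine tendsto_nhds_unique hx ((hev.comp hns.tendsto_atTop).congr fun n => ?_)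
  simp only [Function.comp, hxn]

/-! ### Control of the `L²` norm on an interval by finitely many values -/

/-- A Poincaré inequality on a short interval: `φ(x) - φ(a)` is the integral of `φ'`, bounded by
Cauchy-Schwarz. -/
theorem IsTest.integral_sq_le {φ : ℝ → ℝ} (h : IsTest φ) (a : ℝ) {δ : ℝ} (hδ : 0 ≤ δ) :
    ∫ x in a..(a + δ), φ x ^ 2 ≤
      2 * δ * φ a ^ 2 + 2 * δ ^ 2 * ∫ x in a..(a + δ), _root_.deriv φ x ^ 2 := by
  have hc := h.1.continuous
  have hc' := h.deriv.1.continuous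
  have i1 : ∀ a b, IntervalIntegrable (fun x => φ x ^ 2) volume a b := fun a b =>
    (hc.pow 2).intervalIntegrable a b
  have i2 : ∀ a b, IntervalIntegrable (fun x => _root_.deriv φ x ^ 2) volume a b := fun a b =>
    (hc'.pow 2).intervalIntegrable a b
  have i3 : ∀ c a b, IntervalIntegrable (fun x => c * _root_.deriv φ x) volume a b := fun c a b =>
    (hc'.const_mul c).intervalIntegrable a b
  have hle : a ≤ a + δ := by linarith
  set D := ∫ x in a..(a + δ), _root_.deriv φ x ^ 2 with hD
  have hpt : ∀ x ∈ Icc a (a + δ), φ x ^ 2 ≤ 2 * φ a ^ 2 + 2 * (δ * D) := by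
    intro x hx
    have h1 : φ x - φ a = ∫ t in a..x, _root_.deriv φ t :=
      (intervalIntegral.integral_deriv_eq_sub (fun x _ => (h.hasDerivAt x).differentiableAt)
        (hc'.intervalIntegrable _ _)).symm
    set s := ∫ t in a..x, _root_.deriv φ t with hs
    set E := ∫ t in a..x, _root_.deriv φ t ^ 2 with hE
    have hED : E ≤ D := intervalIntegral.integral_mono_interval le_rfl hx.1 hx.2
      (.of_forall fun t => sq_nonneg _) ((hc'.pow 2).intervalIntegrable _ _)
    have hE0 : 0 ≤ E := intervalIntegral.integral_nonneg hx.1 fun t _ => sq_nonneg _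
    have hsq : s ^ 2 ≤ (x - a) * E := by
      rcases eq_or_lt_of_le hx.1 with hxa | hxa
      · rw [hs, ← hxa]
        simp
      -- Cauchy-Schwarz, as the nonnegativity of the variance of `φ'` around its mean `s / (x - a)`.
      · have h2 : 0 ≤ ∫ t in a..x, (_root_.deriv φ t - s / (x - a)) ^ 2 :=
          intervalIntegral.integral_nonneg hx.1 fun t _ => sq_nonneg _
        have e : ∀ t, (_root_.deriv φ t - s / (x - a)) ^ 2 = _root_.deriv φ t ^ 2
            - (2 * (s / (x - a))) * _root_.deriv φ t + (s / (x - a)) ^ 2 := fun t => by ring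
        simp only [e] at h2
        rw [intervalIntegral.integral_add
          ((i2 _ _).sub (i3 _ _ _)) (by simp), intervalIntegral.integral_sub (i2 _ _) (i3 _ _ _),
          intervalIntegral.integral_const_mul, intervalIntegral.integral_const, ← hs, ← hE,
          smul_eq_mul] at h2
        have hpos : 0 < x - a := by linarith
        have e2 : E - 2 * (s / (x - a)) * s + (x - a) * (s / (x - a)) ^ 2 = E - s ^ 2 / (x - a) := by
          field_simp
          ring
        rw [e2, sub_nonneg, div_le_iff₀ hpos] at h2
        linarith
    have h3 : (x - a) * E ≤ δ * D := mul_le_mul (by linarith [hx.2]) hED hE0 hδ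
    rw [show φ x = φ a + s by linarith]
    nlinarith [sq_nonneg (φ a - s)]
  calc ∫ x in a..(a + δ), φ x ^ 2 ≤ ∫ x in a..(a + δ), (2 * φ a ^ 2 + 2 * (δ * D)) :=
        intervalIntegral.integral_mono_on hle ((hc.pow 2).intervalIntegrable _ _) (by simp) hpt
    _ = _ := by
        rw [intervalIntegral.integral_const, smul_eq_mul]
        ring

theorem IsTest.integral_sq_le_sum {φ : ℝ → ℝ} (h : IsTest φ) (a : ℝ) {δ : ℝ} (hδ : 0 ≤ δ) (n : ℕ) :
    ∫ x in a..(a + n * δ), φ x ^ 2 ≤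
      2 * δ * ∑ i ∈ Finset.range n, φ (a + i * δ) ^ 2 + 2 * δ ^ 2 * ∫ x, _root_.deriv φ x ^ 2 := by
  have hc := h.1.continuous
  have hc' := h.deriv.1.continuous
  have i1 : ∀ a b, IntervalIntegrable (fun x => φ x ^ 2) volume a b := fun a b =>
    (hc.pow 2).intervalIntegrable a b
  have i2 : ∀ a b, IntervalIntegrable (fun x => _root_.deriv φ x ^ 2) volume a b := fun a b =>
    (hc'.pow 2).intervalIntegrable a b
  have key : ∫ x in a..(a + n * δ), φ x ^ 2 ≤ 2 * δ * ∑ i ∈ Finset.range n, φ (a + i * δ) ^ 2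
      + 2 * δ ^ 2 * ∫ x in a..(a + n * δ), _root_.deriv φ x ^ 2 := by
    induction n with
    | zero => simp
    | succ n ih =>
      have h1 := h.integral_sq_le (a + n * δ) hδ
      have e : a + n * δ + δ = a + ((n + 1 : ℕ) : ℝ) * δ := by push_cast; ring
      rw [e] at h1
      rw [Finset.sum_range_succ, ← intervalIntegral.integral_add_adjacent_intervals
        (i1 a (a + n * δ)) (i1 _ _), ← intervalIntegral.integral_add_adjacent_intervals
        (i2 a (a + n * δ)) (i2 _ _)]
      linarith
  refine key.trans ?_
  have : ∫ x in a..(a + n * δ), _root_.deriv φ x ^ 2 ≤ ∫ x, _root_.deriv φ x ^ 2 := by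
    rw [intervalIntegral.integral_of_le (by nlinarith [mul_nonneg (Nat.cast_nonneg (α := ℝ) n) hδ])]
    exact setIntegral_le_integral h.deriv.memLp.integrable_sq (.of_forall fun t => sq_nonneg _)
  gcongr

/-- The `L²` norm on `[-R, R]` is controlled by a small part of the derivative and finitely many
values. -/
theorem exists_inner_mulOp_le {R ε : ℝ} (hR : 0 < R) (hε : 0 < ε) (χ : ℝ →ᵇ ℝ)
    (hχ1 : ∀ x, χ x ≤ 1) (hχR : ∀ x, R ≤ |x| → χ x ≤ 0) :
    ∃ (n : ℕ) (C : ℝ) (x : ℕ → ℝ), 0 ≤ C ∧ ∀ f f' : L2R, IsWeakDeriv f f' →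
      ⟪mulOp χ f, f⟫ ≤ ε * ‖f'‖ ^ 2 + C * ∑ i ∈ Finset.range n, evalAt (x i) f f' ^ 2 := by
  -- With mesh `δ = 2R/n`, this makes `2 δ² = 8R²/n² ≤ 8R²/n < ε`.
  obtain ⟨n, hn⟩ := exists_nat_gt (max 1 (8 * R ^ 2 / ε))
  have hn1 : (1 : ℝ) < n := (le_max_left _ _).trans_lt hn
  have hn2 : 8 * R ^ 2 / ε < n := (le_max_right _ _).trans_lt hn
  set δ : ℝ := 2 * R / n with hδ
  have hδ0 : 0 < δ := by positivity
  have hδε : 2 * δ ^ 2 ≤ ε := by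
    rw [div_lt_iff₀ hε] at hn2
    rw [hδ, div_pow, ← mul_div_assoc, div_le_iff₀ (by positivity)]
    nlinarith
  have hnδ : -R + n * δ = R := by
    rw [hδ]
    field_simp
    ring
  refine ⟨n, 2 * δ, fun i => -R + i * δ, by positivity, fun f f' h => ?_⟩
  refine IsWeakDeriv.induction (P := fun f f' => ⟪mulOp χ f, f⟫
    ≤ ε * ‖f'‖ ^ 2 + 2 * δ * ∑ i ∈ Finset.range n, evalAt (-R + i * δ) f f' ^ 2) ?_ ?_ h
  · refine isClosed_le (by fun_prop) ?_
    refine Continuous.add (by fun_prop) (continuous_const.mul (continuous_finsetSum _ fun i _ => ?_))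
    exact (continuous_evalAt _).pow 2
  · intro φ hφ
    have h1 := hφ.integral_sq_le_sum (-R) hδ0.le n
    rw [hnδ] at h1
    simp only [hφ.evalAt]
    rw [mulOp_toLp, inner_toLp_toLp, norm_toLp_sq]
    have h2 : ∫ x, χ x * φ x * φ x ≤ ∫ x in (-R)..R, φ x ^ 2 := by
      rw [intervalIntegral.integral_of_le (by linarith), ← integral_indicator measurableSet_Ioc]
      refine integral_mono_ae ?_ (hφ.memLp.integrable_sq.indicator measurableSet_Ioc) ?_
      · exact (memLp_bcf_mul χ hφ.memLp).integrable_mul hφ.memLp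
      · refine .of_forall fun x => ?_
        by_cases hx : x ∈ Ioc (-R) R
        · simp only [indicator_of_mem hx]
          nlinarith [hχ1 x, sq_nonneg (φ x)]
        · simp only [indicator_of_notMem hx]
          have : χ x ≤ 0 := hχR x (by
            by_contra! hx'
            exact hx ⟨(abs_lt.1 hx').1, (abs_lt.1 hx').2.le⟩)
          nlinarith [sq_nonneg (φ x)]
    have h3 : 0 ≤ ∫ x, deriv φ x ^ 2 := integral_nonneg fun x => sq_nonneg _
    nlinarith

/-! ### Coercivity from finitely many constraints, and growth from conservation laws -/

section Abstract

variable {X : Type*} [NormedAddCommGroup X] [NormedSpace ℝ X]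

/-- A quadratic form that is coercive up to finitely many functionals, nonnegative and definite on
a closed subspace, is coercive on this subspace. -/
theorem exists_coercive_of_finite_rank [CompleteSpace X] {F : Type*} [NormedAddCommGroup F]
    [NormedSpace ℝ F]
    [FiniteDimensional ℝ F] (B : X →L[ℝ] X →L[ℝ] ℝ) (Λ : X →L[ℝ] F)
    {δ C : ℝ} (hδ : 0 < δ) (hC : 0 ≤ C) (hG : ∀ x, δ * ‖x‖ ^ 2 ≤ B x x + C * ‖Λ x‖ ^ 2)
    (Y : Submodule ℝ X) (hY : IsClosed (Y : Set X)) (hpos : ∀ x ∈ Y, 0 ≤ B x x)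
    (hdef : ∀ x ∈ Y, B x x = 0 → x = 0) : ∃ κ > 0, ∀ x ∈ Y, κ * ‖x‖ ^ 2 ≤ B x x := by
  by_contra! hcon
  have hex : ∀ n : ℕ, ∃ x ∈ Y, ‖x‖ = 1 ∧ B x x < 1 / ((n : ℝ) + 1) := by
    intro n
    obtain ⟨x, hxY, hx⟩ := hcon (1 / ((n : ℝ) + 1)) (by positivity)
    have hx0 : 0 < ‖x‖ := by
      refine norm_pos_iff.2 fun h => ?_
      simp [h] at hx
    refine ⟨‖x‖⁻¹ • x, Y.smul_mem _ hxY, by simp [norm_smul, hx0.ne'], ?_⟩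
    rw [map_smul, map_smul, smul_apply, smul_eq_mul, smul_eq_mul, ← mul_assoc,
      ← mul_inv, inv_mul_lt_iff₀ (by positivity)]
    linarith
  choose x hxY hx1 hxB using hex
  have : ProperSpace F := FiniteDimensional.proper ℝ F
  obtain ⟨l, -, ns, hns, hl⟩ := tendsto_subseq_of_bounded (x := fun n => Λ (x n))
    (Metric.isBounded_closedBall (x := (0 : F)) (r := ‖Λ‖)) fun n => by
      rw [mem_closedBall_zero_iff]
      simpa [hx1] using Λ.le_opNorm (x n)
  set y := x ∘ ns with hy
  have hyB : Tendsto (fun n => B (y n) (y n)) atTop (𝓝 0) := by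
    refine squeeze_zero (fun n => hpos _ (hxY _)) (fun n => (hxB (ns n)).le) ?_
    exact (tendsto_one_div_add_atTop_nhds_zero_nat (𝕜 := ℝ)).comp hns.tendsto_atTop
  -- The parallelogram identity and `B ≥ 0` at `y m + y n` bound `B` at `y m - y n` by `2 B(y m) + 2
  -- B(y n)`. The `Λ`-part is Cauchy because the target is finite dimensional, so the coercivity
  -- estimate `hG` controls `‖y m - y n‖`.
  have hcau : CauchySeq y := by
    rw [Metric.cauchySeq_iff]
    intro ε hε
    have hlc : CauchySeq fun n => Λ (y n) := hl.cauchySeq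
    obtain ⟨η, hη0, hη⟩ : ∃ η > 0, 4 * η + C * η ^ 2 < δ * ε ^ 2 := by
      have hcont : Tendsto (fun η : ℝ => 4 * η + C * η ^ 2) (𝓝[>] 0) (𝓝 0) := by
        have : Continuous fun η : ℝ => 4 * η + C * η ^ 2 := by fun_prop
        simpa using (this.tendsto 0).mono_left nhdsWithin_le_nhds
      obtain ⟨η, h1, h2⟩ := ((hcont.eventually_lt_const (by positivity : 0 < δ * ε ^ 2)).and
        self_mem_nhdsWithin).exists
      exact ⟨η, h2, h1⟩
    obtain ⟨N1, hN1⟩ := Metric.cauchySeq_iff.1 hlc η hη0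
    obtain ⟨N2, hN2⟩ := eventually_atTop.1 (hyB.eventually_lt_const hη0)
    refine ⟨max N1 N2, fun m hm n hn => ?_⟩
    have h1 := hN1 m (le_of_max_le_left hm) n (le_of_max_le_left hn)
    rw [dist_eq_norm, ← map_sub] at h1
    have h2 := hG (y m - y n)
    have h3 := hpos (y m + y n) (Y.add_mem (hxY _) (hxY _))
    have h4 := hN2 m (le_of_max_le_right hm)
    have h5 := hN2 n (le_of_max_le_right hn)
    simp only [map_add, map_sub, add_apply, sub_apply]
      at h2 h3
    rw [← map_sub] at h2
    have h6 : C * ‖Λ (y m - y n)‖ ^ 2 ≤ C * η ^ 2 := by gcongr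
    have h7 : δ * ‖y m - y n‖ ^ 2 < δ * ε ^ 2 := by linarith
    rw [dist_eq_norm]
    exact lt_of_pow_lt_pow_left₀ 2 hε.le (lt_of_mul_lt_mul_left h7 hδ.le)
  obtain ⟨z, hz⟩ := cauchySeq_tendsto_of_complete hcau
  have hzY : z ∈ Y := hY.mem_of_tendsto hz (.of_forall fun n => hxY _)
  have hz1 : ‖z‖ = 1 := tendsto_nhds_unique hz.norm (by simp [hy, hx1])
  have hzB : B z z = 0 :=
    tendsto_nhds_unique ((B.isBoundedBilinearMap.continuous.tendsto (z, z)).comp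
      (hz.prodMk_nhds hz)) hyB
  rw [hdef z hzY hzB, norm_zero] at hz1
  exact zero_ne_one hz1

/-- `x` is `B`-orthogonal to `N`, and `B(N, N) = Q N < 0`. Were `B(x, x)` negative too, `B` would be
negative definite on the plane of `N` and `x`, which meets the hyperplane `E = 0`. The vector `E(x)
N - E(N) x` realizes this unless `E N = 0`, when `N` itself does. -/
theorem nonneg_of_negative_direction (B : X →L[ℝ] X →L[ℝ] ℝ) (hB : ∀ x y, B x y = B y x) {N : X}
    {Q E : X →L[ℝ] ℝ} (hN : ∀ x, B N x = Q x) (hQN : Q N < 0) (hE : ∀ x, E x = 0 → 0 ≤ B x x)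
    {x : X} (hx : Q x = 0) : 0 ≤ B x x := by
  by_contra! hneg
  have h1 := hE (E x • N - E N • x) (by simp [mul_comm])
  have hxN : B x N = 0 := by rw [hB, hN, hx]
  simp only [map_sub, map_smul, sub_apply, smul_apply,
    smul_eq_mul, hN, hxN, hx, mul_zero, sub_zero, zero_sub] at h1
  by_cases hEN : E N = 0
  · have := hE N hEN
    rw [hN] at this
    linarith
  · nlinarith [mul_nonneg (sq_nonneg (E x)) (neg_nonneg.2 hQN.le), sq_pos_of_ne_zero hEN,
      mul_pos (sq_pos_of_ne_zero hEN) (neg_pos.2 hneg)]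

/-- As `B(x, x) = 0`, the form at `z + s x` is affine in `s` with slope `2 B(x, z)`; a nonzero slope
lets it reach `-1`. -/
theorem apply_eq_zero_of_nonneg (B : X →L[ℝ] X →L[ℝ] ℝ) (hB : ∀ x y, B x y = B y x)
    {x z : X} (hx : B x x = 0) (h : ∀ s : ℝ, 0 ≤ B (z + s • x) (z + s • x)) : B x z = 0 := by
  by_contra hne
  have := h (-(B z z + 1) / (2 * B x z))
  simp only [map_add, map_smul, add_apply, smul_apply,
    smul_eq_mul, hx, mul_zero, add_zero, hB z x] at this
  have e : -(B z z + 1) / (2 * B x z) * B x z = -(B z z + 1) / 2 := by field_simp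
  linarith

/-- Coercivity under the constraint `T x = 0`, up to the conserved functional `Q`. -/
theorem exists_norm_sq_le [CompleteSpace X] {F : Type*} [NormedAddCommGroup F]
    [NormedSpace ℝ F]
    [FiniteDimensional ℝ F] (B : X →L[ℝ] X →L[ℝ] ℝ) (hB : ∀ x y, B x y = B y x) (Λ : X →L[ℝ] F)
    {δ C : ℝ} (hδ : 0 < δ) (hC : 0 ≤ C) (hG : ∀ x, δ * ‖x‖ ^ 2 ≤ B x x + C * ‖Λ x‖ ^ 2)
    {e N : X} {Q E T : X →L[ℝ] ℝ} (he : ∀ x, B e x = 0) (hTe : T e ≠ 0) (hN : ∀ x, B N x = Q x)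
    (hQN : Q N < 0) (hE : ∀ x, E x = 0 → 0 ≤ B x x)
    (hker : ∀ x, (∀ z, B x z = 0) → ∃ a : ℝ, x = a • e) :
    ∃ C₁ C₂ : ℝ, 0 ≤ C₁ ∧ 0 ≤ C₂ ∧ ∀ x, T x = 0 → ‖x‖ ^ 2 ≤ C₁ * B x x + C₂ * Q x ^ 2 := by
  have hnn : ∀ x, Q x = 0 → 0 ≤ B x x := fun x hx =>
    nonneg_of_negative_direction B hB hN hQN hE hx
  have hQe : Q e = 0 := by rw [← hN, hB, he]
  obtain ⟨κ, hκ, hcoer⟩ := exists_coercive_of_finite_rank B Λ hδ hC hG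
    (LinearMap.ker (Q : X →ₗ[ℝ] ℝ) ⊓ LinearMap.ker (T : X →ₗ[ℝ] ℝ))
    (Q.isClosed_ker.inter T.isClosed_ker) (fun x hx => hnn x hx.1) (fun x hx hxx => by
      have hQx : Q x = 0 := hx.1
      have hTx : T x = 0 := hx.2
      -- A null vector of a form nonnegative on `ker Q` annihilates `ker Q`; it also annihilates
      -- `N`, since `B(x, N) = Q x = 0`. Hence it lies in the kernel of `B`, where the constraint `T
      -- = 0` excludes all but zero.
      obtain ⟨a, rfl⟩ := hker x fun z => by
        have h1 : B x (z - (Q z / Q N) • N) = 0 := by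
          refine apply_eq_zero_of_nonneg B hB hxx fun s => hnn _ ?_
          simp [hQx, hQN.ne]
        rw [map_sub, map_smul, hB x N, hN, hQx] at h1
        simpa using h1
      rw [map_smul, smul_eq_mul] at hTx
      rw [(mul_eq_zero.1 hTx).resolve_right hTe, zero_smul])
  -- `N` moved along the kernel into `ker T`, which leaves `B(N, ·)` unchanged.
  set N' := N - (T N / T e) • e with hN'
  have hTN' : T N' = 0 := by simp [hN', hTe]
  have hQN' : Q N' = Q N := by simp [hN', hQe]
  have hBN' : ∀ x, B N' x = Q x := fun x => by simp [hN', hN, he]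
  refine ⟨2 / κ, 2 / κ * (-Q N)⁻¹ + 2 * ‖N'‖ ^ 2 / Q N ^ 2, by positivity, ?_, fun x hx => ?_⟩
  · have : 0 < (-Q N)⁻¹ := inv_pos.2 (neg_pos.2 hQN)
    positivity
  -- The `B`-orthogonal splitting `x = y + b N'` puts `y` in the coercive subspace and moves the
  -- negative part into `b² Q N`, a multiple of `Q(x)²`.
  set b := Q x / Q N with hb
  set y := x - b • N' with hy
  have hQy : Q y = 0 := by simp [hy, hQN', hb, hQN.ne]
  have hTy : T y = 0 := by simp [hy, hx, hTN']
  have h1 := hcoer y ⟨hQy, hTy⟩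
  have hxy : x = y + b • N' := by simp [hy]
  have h2 : B x x = B y y + b ^ 2 * Q N := by
    rw [hxy]
    simp only [map_add, map_smul, add_apply, smul_apply,
      smul_eq_mul, hBN', hB y N', hQy, hQN']
    ring
  have h3 : ‖x‖ ^ 2 ≤ 2 * ‖y‖ ^ 2 + 2 * (b ^ 2 * ‖N'‖ ^ 2) := by
    have h4 : ‖x‖ ≤ ‖y‖ + ‖b • N'‖ := by
      conv_lhs => rw [hxy]
      exact norm_add_le _ _
    have h5 : ‖b • N'‖ ^ 2 = b ^ 2 * ‖N'‖ ^ 2 := by rw [norm_smul, mul_pow, Real.norm_eq_abs, sq_abs]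
    rw [← h5]
    nlinarith [sq_nonneg (‖y‖ - ‖b • N'‖), norm_nonneg x, norm_nonneg y]
  have h6 : ‖y‖ ^ 2 ≤ B y y / κ := by
    rw [le_div_iff₀ hκ]
    linarith
  have h7 : b ^ 2 * Q N = -((-Q N)⁻¹ * Q x ^ 2) := by
    rw [hb]
    have := hQN.ne
    field_simp
  have h8 : b ^ 2 = Q x ^ 2 / Q N ^ 2 := by rw [hb, div_pow]
  rw [show B y y = B x x + (-Q N)⁻¹ * Q x ^ 2 by linarith] at h6
  calc ‖x‖ ^ 2 ≤ 2 * ((B x x + (-Q N)⁻¹ * Q x ^ 2) / κ) + 2 * (b ^ 2 * ‖N'‖ ^ 2) := by linarith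
    _ = _ := by
      rw [h8]
      ring

/-- At most linear growth, from the conservation laws. -/
theorem exists_linear_growth [CompleteSpace X] (B : X →L[ℝ] X →L[ℝ] ℝ) {e : X} {Q T S : X →L[ℝ] ℝ}
    {C₁ C₂ : ℝ}
    (hC₁ : 0 ≤ C₁) (hC₂ : 0 ≤ C₂) (hB : ∀ x y, B x y = B y x) (he : ∀ x, B e x = 0)
    (hTe : T e ≠ 0) (hQe : Q e = 0) (hSe : S e = 0)
    (h : ∀ x, T x = 0 → ‖x‖ ^ 2 ≤ C₁ * B x x + C₂ * Q x ^ 2) :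
    ∃ C : ℝ, 0 < C ∧ ∀ W : ℝ → X, Continuous W → (∀ t, B (W t) (W t) = B (W 0) (W 0)) →
      (∀ t, Q (W t) = Q (W 0)) → (∀ t, T (W t) - T (W 0) = S (∫ s in (0)..t, W s)) →
      ∀ t, ‖W t‖ ≤ C * (1 + |t|) * ‖W 0‖ := by
  set M := Real.sqrt (C₁ * ‖B‖ + C₂ * ‖Q‖ ^ 2) with hM
  have hM0 : 0 ≤ M := Real.sqrt_nonneg _
  set D := ‖e‖ / |T e| with hD
  refine ⟨1 + M + D * ‖T‖ + D * (‖S‖ * M), by positivity, fun W hW hBW hQW hTW t => ?_⟩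
  -- Removing the `e`-component changes neither `B(W, W)` nor `Q(W)`, and both are conserved, so the
  -- bound uses the initial datum alone.
  have hproj : ∀ s, ‖W s - (T (W s) / T e) • e‖ ≤ M * ‖W 0‖ := by
    intro s
    have h1 := h (W s - (T (W s) / T e) • e) (by simp [hTe])
    have h2 : B (W s - (T (W s) / T e) • e) (W s - (T (W s) / T e) • e) = B (W 0) (W 0) := by
      rw [← hBW s]
      simp [he, hB (W s) e]
    have h3 : Q (W s - (T (W s) / T e) • e) = Q (W 0) := by
      rw [← hQW s]
      simp [hQe]
    rw [h2, h3] at h1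
    have h4 : B (W 0) (W 0) ≤ ‖B‖ * ‖W 0‖ * ‖W 0‖ := (le_abs_self _).trans (B.le_opNorm₂ _ _)
    have h5 : Q (W 0) ^ 2 ≤ (‖Q‖ * ‖W 0‖) ^ 2 := sq_le_sq' (by
      linarith [(abs_le.1 ((Real.norm_eq_abs _).symm.le.trans (Q.le_opNorm (W 0)))).1])
      ((le_abs_self _).trans (Q.le_opNorm (W 0)))
    refine le_of_sq_le_sq ?_ (by positivity)
    rw [mul_pow, hM, Real.sq_sqrt (by positivity)]
    nlinarith [mul_le_mul_of_nonneg_left h4 hC₁, mul_le_mul_of_nonneg_left h5 hC₂]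
  -- `S e = 0`, so only the bounded component of `W` enters and the integrand is bounded uniformly
  -- in time.
  have hS : |S (∫ s in (0)..t, W s)| ≤ ‖S‖ * M * ‖W 0‖ * |t| := by
    rw [← ContinuousLinearMap.intervalIntegral_comp_comm _ (hW.intervalIntegrable _ _)]
    have := intervalIntegral.norm_integral_le_of_norm_le_const (a := 0) (b := t)
      (f := fun s => S (W s)) (C := ‖S‖ * M * ‖W 0‖) fun s _ => by
        have e1 : S (W s) = S (W s - (T (W s) / T e) • e) := by simp [hSe]
        rw [e1, mul_assoc]
        exact (S.le_opNorm _).trans (mul_le_mul_of_nonneg_left (hproj s) (norm_nonneg _))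
    simpa using this
  have hT : |T (W t)| ≤ ‖T‖ * ‖W 0‖ + ‖S‖ * M * ‖W 0‖ * |t| := by
    have h1 : T (W t) = T (W 0) + S (∫ s in (0)..t, W s) := by linarith [hTW t]
    rw [h1]
    exact (abs_add_le _ _).trans (add_le_add (T.le_opNorm _) hS)
  have hn : ‖(T (W t) / T e) • e‖ ≤ D * (‖T‖ * ‖W 0‖ + ‖S‖ * M * ‖W 0‖ * |t|) := by
    rw [norm_smul, Real.norm_eq_abs, abs_div, div_mul_eq_mul_div, mul_div_assoc, mul_comm, ← hD]
    exact mul_le_mul_of_nonneg_left hT (by positivity)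
  have hfin : ‖W t‖ ≤ M * ‖W 0‖ + D * (‖T‖ * ‖W 0‖ + ‖S‖ * M * ‖W 0‖ * |t|) := by
    have h1 := norm_add_le (W t - (T (W t) / T e) • e) ((T (W t) / T e) • e)
    rw [sub_add_cancel] at h1
    linarith [hproj t]
  refine hfin.trans ?_
  have p1 : 0 ≤ ‖W 0‖ * (1 + |t| + M * |t| + D * ‖T‖ * |t| + D * (‖S‖ * M)) := by positivity
  nlinarith

/-- A bilinear form `B` is conserved by `W` if `∫ W` and the increments of `W` are orthogonal. -/
theorem bilinear_conserved [CompleteSpace X] (B : X →L[ℝ] X →L[ℝ] ℝ) (hB : ∀ x y, B x y = B y x)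
    {W : ℝ → X} (hW : Continuous W) (h : ∀ t₀ t₁, B (∫ s in t₀..t₁, W s) (W t₁ - W t₀) = 0) (t : ℝ) :
    B (W t) (W t) = B (W 0) (W 0) := by
  have hprim : ∀ a x, HasDerivAt (fun x => ∫ s in a..x, W s) (W x) x := fun a x =>
    (hW.integral_hasStrictDerivAt a x).hasDerivAt
  have hd : ∀ δ t, HasDerivAt (fun t => ∫ s in t..(t + δ), W s) (W (t + δ) - W t) t := by
    intro δ t
    have h2 := ((hprim 0 (t + δ)).comp_add_const t δ).sub (hprim 0 t)
    refine h2.congr_of_eventuallyEq (.of_forall fun x => ?_)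
    exact (intervalIntegral.integral_interval_sub_left (hW.intervalIntegrable _ _)
      (hW.intervalIntegrable _ _)).symm
  -- `W` need not be differentiable, but its average over a window of length `δ` is. With `Y` the
  -- window integral, the derivative of `B(Y, Y)` is `2 B(Y, W(t + δ) - W(t)) = 0`.
  have hconst : ∀ δ t, B (∫ s in t..(t + δ), W s) (∫ s in t..(t + δ), W s)
      = B (∫ s in (0)..(0 + δ), W s) (∫ s in (0)..(0 + δ), W s) := by
    intro δ t
    have h3 : ∀ t, HasDerivAt (fun t => B (∫ s in t..(t + δ), W s) (∫ s in t..(t + δ), W s))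
        0 t := by
      intro t
      have h4 := B.hasDerivAt_of_bilinear (fun _ => hd δ t) (fun _ => hd δ t)
      rwa [hB (W (t + δ) - W t), h t (t + δ), add_zero] at h4
    exact is_const_of_deriv_eq_zero (fun t => (h3 t).differentiableAt) (fun t => (h3 t).deriv) t 0
  -- Rescaling by `δ⁻¹` and letting the window shrink recovers `B(W t, W t)`.
  have hlim : ∀ t, Tendsto (fun δ : ℝ => B (δ⁻¹ • ∫ s in t..(t + δ), W s)
      (δ⁻¹ • ∫ s in t..(t + δ), W s)) (𝓝[≠] 0) (𝓝 (B (W t) (W t))) := by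
    intro t
    have h2 := (hprim t t).tendsto_slope_zero
    simp only [intervalIntegral.integral_same, sub_zero] at h2
    exact (B.isBoundedBilinearMap.continuous.tendsto (W t, W t)).comp (h2.prodMk_nhds h2)
  refine tendsto_nhds_unique (hlim t) ((hlim 0).congr fun δ => ?_)
  simp only [map_smul, smul_apply]
  rw [hconst δ t]

end Abstract

/-! ### The Hessian and the generator on `𝓗⁰` -/

/-- `U ↦ r` as a continuous linear map. -/
def rL : HZero →L[ℝ] L2R :=
  (WithLp.fstL 2 ℝ L2R L2R).comp (H1.subtypeL.comp (WithLp.fstL 2 ℝ H1 L2R))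

/-- `U ↦ ∂ₓr` as a continuous linear map. -/
def drL : HZero →L[ℝ] L2R :=
  (WithLp.sndL 2 ℝ L2R L2R).comp (H1.subtypeL.comp (WithLp.fstL 2 ℝ H1 L2R))

/-- `U ↦ u` as a continuous linear map. -/
def uL : HZero →L[ℝ] L2R := WithLp.sndL 2 ℝ H1 L2R

theorem rL_apply (U : HZero) : rL U = U.r := rfl
theorem uL_apply (U : HZero) : uL U = U.u := rfl

theorem HZero.isWeakDeriv (U : HZero) : IsWeakDeriv U.r U.dr := U.fst.2

/-- The element `(r, u)` of `𝓗⁰`. -/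
def HZero.mk (r dr u : L2R) (h : IsWeakDeriv r dr) : HZero := WithLp.toLp 2 (H1.mk r dr h, u)

theorem HZero.ext' {U V : HZero} (hr : U.r = V.r) (hdr : U.dr = V.dr) (hu : U.u = V.u) : U = V := by
  refine WithLp.ofLp_injective 2 (Prod.ext (Subtype.ext (WithLp.ofLp_injective 2 (Prod.ext hr hdr))) hu)

/-- Bounded coefficients of `δ²H`: `(r, u) ↦ (q r - ∂ₓ(k ∂ₓr) + a u, a r + ρ u)`. -/
structure Coeff where
  /-- the potential -/
  q : ℝ →ᵇ ℝ
  /-- the capillarity -/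
  k : ℝ →ᵇ ℝ
  /-- the relative velocity -/
  a : ℝ →ᵇ ℝ
  /-- the density -/
  ρ : ℝ →ᵇ ℝ

namespace Coeff

variable (κ : Coeff)

/-- `q r + a u`. -/
def A₀ : HZero →L[ℝ] L2R := (mulOp κ.q).comp rL + (mulOp κ.a).comp uL

/-- `k ∂ₓr`. -/
def A₁ : HZero →L[ℝ] L2R := (mulOp κ.k).comp drL

/-- `a r + ρ u`. -/
def A₂ : HZero →L[ℝ] L2R := (mulOp κ.a).comp rL + (mulOp κ.ρ).comp uL

theorem A₀_apply (U : HZero) : κ.A₀ U = mulOp κ.q U.r + mulOp κ.a U.u := rfl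
theorem A₁_apply (U : HZero) : κ.A₁ U = mulOp κ.k U.dr := rfl
theorem A₂_apply (U : HZero) : κ.A₂ U = mulOp κ.a U.r + mulOp κ.ρ U.u := rfl

/-- The quadratic form of `δ²H`, polarized. -/
def form : HZero →L[ℝ] HZero →L[ℝ] ℝ :=
  (innerSL ℝ).bilinearComp κ.A₀ rL + (innerSL ℝ).bilinearComp κ.A₁ drL
    + (innerSL ℝ).bilinearComp κ.A₂ uL

theorem form_apply (U V : HZero) :
    κ.form U V = ⟪κ.A₀ U, V.r⟫ + ⟪κ.A₁ U, V.dr⟫ + ⟪κ.A₂ U, V.u⟫ := rfl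

theorem form_comm (U V : HZero) : κ.form U V = κ.form V U := by
  simp only [form_apply, A₀_apply, A₁_apply, A₂_apply, inner_add_left]
  rw [inner_mulOp_comm κ.q, inner_mulOp_comm κ.k, inner_mulOp_comm κ.ρ, inner_mulOp_comm κ.a U.u,
    inner_mulOp_comm κ.a U.r]
  ring

/-- `Z = J ∂ₓ δ²H Y` in the sense of distributions. -/
def IsGen (Y Z : HZero) : Prop := ∀ φ ψ (hφ : IsTest φ) (hψ : IsTest ψ),
  ⟪Z.r, hφ.memLp.toLp φ⟫ + ⟪Z.u, hψ.memLp.toLp ψ⟫ = ⟪κ.A₀ Y, hψ.deriv.memLp.toLp _⟫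
    + ⟪κ.A₁ Y, hψ.deriv.deriv.memLp.toLp _⟫ + ⟪κ.A₂ Y, hφ.deriv.memLp.toLp _⟫

variable {κ} {Y Z : HZero}

theorem toLp_isTest_zero : isTest_zero.memLp.toLp _ = 0 := rfl

theorem toLp_deriv_isTest_zero : isTest_zero.deriv.memLp.toLp _ = 0 := by
  have e : deriv (fun _ : ℝ => (0 : ℝ)) = fun _ => 0 := by
    funext x
    simp
  simp only [e]
  rfl

theorem toLp_deriv_deriv_isTest_zero : isTest_zero.deriv.deriv.memLp.toLp _ = 0 := by
  have e : deriv (fun _ : ℝ => (0 : ℝ)) = fun _ => 0 := by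
    funext x
    simp
  simp only [e]
  rfl

/-- Testing with `ψ = 0` isolates `Z.r = -∂ₓ(A₂ Y)`. Thus `A₂ Y` gains a derivative, although `Y.u`
is only in `L²`. -/
theorem IsGen.isWeakDeriv (h : κ.IsGen Y Z) : IsWeakDeriv (κ.A₂ Y) (-Z.r) := by
  rw [isWeakDeriv_iff]
  intro φ hφ
  have := h φ _ hφ isTest_zero
  rw [toLp_isTest_zero, toLp_deriv_isTest_zero, toLp_deriv_deriv_isTest_zero] at this
  simp only [inner_zero_right, add_zero, zero_add] at this
  rw [inner_neg_left, neg_neg, this]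

theorem IsGen.inner_r (h : κ.IsGen Y Z) {w w' : L2R} (hw : IsWeakDeriv w w') :
    ⟪Z.r, w⟫ = ⟪κ.A₂ Y, w'⟫ := by
  rw [h.isWeakDeriv.inner_eq_neg hw, inner_neg_left, neg_neg]

/-- `Z.u = -∂ₓ(A₀ Y - ∂ₓ A₁ Y)` puts up to two derivatives on the test function, so the identity
extends by density to `H²` and no further regularity of `Y` is needed. -/
theorem IsGen.inner_u (h : κ.IsGen Y Z) {η η' η'' : L2R} (hη : IsWeakDeriv η η')
    (hη' : IsWeakDeriv η' η'') : ⟪Z.u, η⟫ = ⟪κ.A₀ Y, η'⟫ + ⟪κ.A₁ Y, η''⟫ := by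
  refine IsWeakDeriv.induction_second
    (P := fun η η' η'' => ⟪Z.u, η⟫ = ⟪κ.A₀ Y, η'⟫ + ⟪κ.A₁ Y, η''⟫) ?_ ?_ hη hη'
  · exact isClosed_eq (by fun_prop) (by fun_prop)
  · intro ψ hψ
    have := h _ ψ isTest_zero hψ
    rw [toLp_isTest_zero, toLp_deriv_isTest_zero] at this
    simpa only [inner_zero_right, add_zero, zero_add] using this

/-- Skew-symmetry of the generator with respect to the Hessian. -/
theorem IsGen.form_eq_zero (h : κ.IsGen Y Z) : κ.form Y Z = 0 := by
  -- The test function is `A₂ Y`. It is in `H²` because its derivative `-Z.r` is in `H¹`, which is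
  -- where `Z ∈ 𝓗⁰` is used.
  have := h.inner_u h.isWeakDeriv Z.isWeakDeriv.neg
  rw [inner_neg_right, inner_neg_right, real_inner_comm] at this
  rw [form_apply]
  linarith

/-- The quadratic form is conserved by continuous solutions. -/
theorem form_conserved {W : ℝ → HZero} (hW : Continuous W)
    (h : ∀ t₀ t₁, κ.IsGen (∫ s in t₀..t₁, W s) (W t₁ - W t₀)) (t : ℝ) :
    κ.form (W t) (W t) = κ.form (W 0) (W 0) :=
  bilinear_conserved κ.form κ.form_comm hW (fun t₀ t₁ => (h t₀ t₁).form_eq_zero) t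

end Coeff

/-! ### Translations -/

/-- The translation `f ↦ f(· + h)` of `L²`. -/
def shift (h : ℝ) : L2R →ₗᵢ[ℝ] L2R :=
  Lp.compMeasurePreservingₗᵢ ℝ (fun x => x + h) (measurePreserving_add_right volume h)

theorem coeFn_shift (h : ℝ) (f : L2R) : shift h f =ᵐ[volume] fun x => f (x + h) :=
  Lp.coeFn_compMeasurePreserving f (measurePreserving_add_right volume h)

theorem IsTest.comp_sub {φ : ℝ → ℝ} (h : ℝ) (hφ : IsTest φ) : IsTest (fun x => φ (x - h)) := by
  obtain ⟨R, hR, hz⟩ := hφ.exists_support_subset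
  refine isTest_of_eq_zero (R := R + |h|) (hφ.1.comp (contDiff_id.sub contDiff_const)) fun x hx =>
    hz _ ?_
  have := abs_sub_abs_le_abs_sub x h
  linarith

theorem deriv_comp_sub (φ : ℝ → ℝ) (h : ℝ) :
    deriv (fun x => φ (x - h)) = fun x => deriv φ (x - h) :=
  funext fun x => deriv_comp_sub_const _ _ x

theorem inner_shift (h : ℝ) (f : L2R) {φ : ℝ → ℝ} (hφ : IsTest φ) :
    ⟪shift h f, hφ.memLp.toLp φ⟫ = ⟪f, (hφ.comp_sub h).memLp.toLp _⟫ := by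
  rw [inner_toLp, inner_toLp, ← integral_add_right_eq_self (fun x => f x * φ (x - h)) h]
  refine integral_congr_ae ?_
  filter_upwards [coeFn_shift h f] with x hx
  rw [hx, add_sub_cancel_right]

theorem IsWeakDeriv.shift (h : ℝ) {f f' : L2R} (hf : IsWeakDeriv f f') :
    IsWeakDeriv (shift h f) (shift h f') := by
  rw [isWeakDeriv_iff] at hf ⊢
  intro φ hφ
  have := hf _ (hφ.comp_sub h)
  simp only [deriv_comp_sub] at this
  rw [inner_shift h f hφ.deriv, inner_shift h f' hφ, this]

/-- The translation of `𝓗⁰`. -/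
def HZero.shift (h : ℝ) (U : HZero) : HZero :=
  HZero.mk (EulerKorteweg.shift h U.r) (EulerKorteweg.shift h U.dr) (EulerKorteweg.shift h U.u)
    (U.isWeakDeriv.shift h)

theorem HZero.norm_shift (h : ℝ) (U : HZero) : ‖U.shift h‖ = ‖U‖ := by
  have h1 : ‖U.shift h‖ ^ 2 = ‖U‖ ^ 2 := by
    rw [HZero.norm_sq, HZero.norm_sq, ← (EulerKorteweg.shift h).norm_map U.r,
      ← (EulerKorteweg.shift h).norm_map U.dr, ← (EulerKorteweg.shift h).norm_map U.u]
    rfl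
  exact (sq_eq_sq₀ (norm_nonneg _) (norm_nonneg _)).1 h1

theorem _root_.Continuous.L2_shift {f : ℝ → L2R} (hf : Continuous f) (c : ℝ) :
    Continuous fun t => shift (c * t) (f t) := by
  let G : ℝ → C(ℝ, ℝ) := fun t => ⟨fun x => x + c * t, by fun_prop⟩
  have hG : Continuous G := by
    refine ContinuousMap.continuous_of_continuous_uncurry _ ?_
    change Continuous fun p : ℝ × ℝ => p.2 + c * p.1
    fun_prop
  exact hf.compMeasurePreservingLp hG (fun t => measurePreserving_add_right volume (c * t))
    (by norm_num)

theorem _root_.Continuous.HZero_mk {r dr u : ℝ → L2R} (hr : Continuous r) (hdr : Continuous dr)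
    (hu : Continuous u) (h : ∀ t, IsWeakDeriv (r t) (dr t)) :
    Continuous fun t => HZero.mk (r t) (dr t) (u t) (h t) := by
  have h1 : Continuous fun t => H1.mk (r t) (dr t) (h t) :=
    Continuous.subtype_mk ((WithLp.prod_continuous_toLp 2 L2R L2R).comp (hr.prodMk hdr)) _
  exact (WithLp.prod_continuous_toLp 2 H1 L2R).comp (h1.prodMk hu)

theorem _root_.Continuous.HZero_shift {U : ℝ → HZero} (hU : Continuous U) (c : ℝ) :
    Continuous fun t => (U t).shift (c * t) :=
  Continuous.HZero_mk (Continuous.L2_shift (rL.continuous.comp hU) c)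
    (Continuous.L2_shift (drL.continuous.comp hU) c)
    (Continuous.L2_shift (uL.continuous.comp hU) c) _

theorem IsTest.exists_bound {φ : ℝ → ℝ} (h : IsTest φ) : ∃ M, 0 ≤ M ∧ ∀ x, |φ x| ≤ M := by
  obtain ⟨M, hM⟩ := h.2.exists_bound_of_continuous h.1.continuous
  exact ⟨M, (norm_nonneg _).trans (hM 0), hM⟩

/-- The remainder is uniform in `x`; with the compact support this makes translation differentiable
in `L²`. -/
theorem IsTest.exists_taylor_bound {φ : ℝ → ℝ} (h : IsTest φ) :
    ∃ M, 0 ≤ M ∧ ∀ x s, |φ (x - s) - φ x + s * _root_.deriv φ x| ≤ M * s ^ 2 := by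
  obtain ⟨M, hM0, hM⟩ := h.deriv.deriv.exists_bound
  have hlip : ∀ x y, |_root_.deriv φ x - _root_.deriv φ y| ≤ M * |x - y| := fun x y => by
    simpa using convex_univ.norm_image_sub_le_of_norm_hasDerivWithin_le
      (fun z _ => (h.deriv.hasDerivAt z).hasDerivWithinAt) (fun z _ => hM z) (mem_univ y) (mem_univ x)
  refine ⟨M, hM0, fun x s => ?_⟩
  have hd : ∀ τ, HasDerivAt (fun τ => φ (x - τ) - φ x + τ * _root_.deriv φ x)
      (-_root_.deriv φ (x - τ) + _root_.deriv φ x) τ := by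
    intro τ
    have h1 := ((h.hasDerivAt (x - τ)).comp τ ((hasDerivAt_id τ).const_sub x)).sub_const (φ x)
    have h2 := h1.fun_add ((hasDerivAt_id τ).mul_const (_root_.deriv φ x))
    simpa using h2
  have := (convex_uIcc (0 : ℝ) s).norm_image_sub_le_of_norm_hasDerivWithin_le (C := M * |s|)
    (fun τ _ => (hd τ).hasDerivWithinAt) (fun τ hτ => by
      rw [neg_add_eq_sub, Real.norm_eq_abs]
      refine (hlip x (x - τ)).trans (mul_le_mul_of_nonneg_left ?_ hM0)
      rw [sub_sub_cancel]
      simpa using abs_sub_left_of_mem_uIcc hτ) left_mem_uIcc right_mem_uIcc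
  simp only [sub_zero, sub_self, zero_mul, add_zero, Real.norm_eq_abs] at this
  rwa [mul_assoc, ← sq, sq_abs] at this

theorem IsTest.hasDerivAt_toLp_comp_sub_zero {φ : ℝ → ℝ} (h : IsTest φ) :
    HasDerivAt (fun s => (h.comp_sub s).memLp.toLp _) (-h.deriv.memLp.toLp _) (0 : ℝ) := by
  obtain ⟨M, hM0, hM⟩ := h.exists_taylor_bound
  obtain ⟨R, hR, hz⟩ := h.exists_support_subset
  have hz' : ∀ x, R + 1 ≤ |x| → _root_.deriv φ x = 0 := by
    intro x hx
    have : φ =ᶠ[𝓝 x] fun _ => 0 := by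
      filter_upwards [(isOpen_lt continuous_const continuous_abs).mem_nhds
        (show R < |x| by linarith)] with y hy using hz y hy.le
    rw [this.deriv_eq, deriv_const]
  have hmeas := measurableSet_Icc (a := -(R + 1)) (b := R + 1)
  -- For `|s| < 1` the translated support stays inside `[-(R + 1), R + 1]`, so the Taylor error is
  -- at most `M s²` times this indicator.
  set J : L2R := indicatorConstLp 2 hmeas (by simp) (1 : ℝ) with hJ
  rw [hasDerivAt_iff_isLittleO_nhds_zero]
  refine Asymptotics.IsBigO.trans_isLittleO (g := fun s : ℝ => s ^ 2) ?_ ?_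
  · refine Asymptotics.IsBigO.of_bound (M * ‖J‖) ?_
    filter_upwards [Metric.ball_mem_nhds (0 : ℝ) one_pos] with s hs
    rw [mem_ball_zero_iff, Real.norm_eq_abs] at hs
    rw [norm_pow, Real.norm_eq_abs, sq_abs, mul_right_comm]
    refine Lp.norm_le_mul_norm_of_ae_le_mul ?_
    rw [smul_neg, sub_neg_eq_add]
    filter_upwards [(h.comp_sub (0 + s)).memLp.coeFn_toLp, (h.comp_sub 0).memLp.coeFn_toLp,
      h.deriv.memLp.coeFn_toLp, Lp.coeFn_add ((h.comp_sub (0 + s)).memLp.toLp _ -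
        (h.comp_sub 0).memLp.toLp _) (s • h.deriv.memLp.toLp _),
      Lp.coeFn_sub ((h.comp_sub (0 + s)).memLp.toLp _) ((h.comp_sub 0).memLp.toLp _),
      Lp.coeFn_smul s (h.deriv.memLp.toLp _),
      indicatorConstLp_coeFn (p := 2) (hs := hmeas) (hμs := by simp) (c := (1 : ℝ))]
      with x h1 h2 h3 h4 h5 h6 h7
    rw [h4, Pi.add_apply, h5, Pi.sub_apply, h6, Pi.smul_apply, h1, h2, h3, h7, zero_add, sub_zero,
      smul_eq_mul, Real.norm_eq_abs]
    by_cases hx : x ∈ Icc (-(R + 1)) (R + 1)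
    · rw [indicator_of_mem hx]
      simpa using hM x s
    · have hx' : R + 1 ≤ |x| := by
        by_contra! hx'
        exact hx ⟨(abs_lt.1 hx').1.le, (abs_lt.1 hx').2.le⟩
      have hxs : R ≤ |x - s| := by
        have := abs_sub_abs_le_abs_sub x s
        linarith
      rw [hz x (by linarith), hz' x hx', hz _ hxs, indicator_of_notMem hx]
      simp
  · simpa using Asymptotics.isLittleO_pow_id (𝕜 := ℝ) one_lt_two

theorem IsTest.hasDerivAt_toLp_comp_sub {φ : ℝ → ℝ} (h : IsTest φ) (c t : ℝ) :
    HasDerivAt (fun s => (h.comp_sub (c * s)).memLp.toLp _)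
      (-c • (h.deriv.comp_sub (c * t)).memLp.toLp _) t := by
  have h1 := (h.comp_sub (c * t)).hasDerivAt_toLp_comp_sub_zero
  simp only [deriv_comp_sub] at h1
  have h2 : HasDerivAt (fun s : ℝ => c * s - c * t) c t := by
    simpa using ((hasDerivAt_id t).const_mul c).sub_const (c * t)
  have h3 := HasDerivAt.scomp_of_eq t h1 h2 (by simp)
  rw [smul_neg, ← neg_smul] at h3
  refine h3.congr_of_eventuallyEq (.of_forall fun s => ?_)
  simp only [Function.comp]
  congr 1
  funext x
  rw [sub_sub, sub_add_cancel]

/-- The half of the product rule that survives when `U` is only continuous: `Φ s - Φ t` vanishes at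
`s = t`, so no derivative falls on `U`. -/
theorem hasDerivAt_inner_sub {U Φ : ℝ → L2R} {Φ' : L2R} {t : ℝ} (hU : ContinuousAt U t)
    (hΦ : HasDerivAt Φ Φ' t) : HasDerivAt (fun s => ⟪U s, Φ s - Φ t⟫) ⟪U t, Φ'⟫ t := by
  rw [hasDerivAt_iff_tendsto_slope_zero] at hΦ ⊢
  have h1 : Tendsto (fun s => U (t + s)) (𝓝[≠] 0) (𝓝 (U t)) := by
    have : Tendsto (fun s => t + s) (𝓝[≠] 0) (𝓝 t) := by
      have : Continuous fun s => t + s := by fun_prop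
      simpa using (this.tendsto 0).mono_left nhdsWithin_le_nhds
    exact hU.tendsto.comp this
  refine (h1.inner hΦ).congr fun s => ?_
  rw [inner_smul_right, sub_self, inner_zero_right, sub_zero, smul_eq_mul]

/-! ### The equation in the moving frame -/

theorem potential_comp_sub (K g ρ : ℝ → ℝ) (h x : ℝ) :
    potential K g (fun y => ρ (y - h)) (x + h) = potential K g ρ x := by
  have e : iteratedDeriv 2 (fun y => ρ (y - h)) (x + h) = iteratedDeriv 2 ρ x := by
    rw [iteratedDeriv_succ, iteratedDeriv_one, iteratedDeriv_succ, iteratedDeriv_one, deriv_comp_sub,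
      deriv_comp_sub]
    simp only [add_sub_cancel_right]
  simp only [potential, e, deriv_comp_sub, add_sub_cancel_right]

/-- `κ` collects the coefficients of the Hessian in the frame moving at speed `c`. -/
structure Coeff.IsOf (κ : Coeff) (K g : ℝ → ℝ) (c : ℝ) (ρ v : ℝ → ℝ) : Prop where
  q : ∀ x, κ.q x = potential K g ρ x
  k : ∀ x, κ.k x = K (ρ x)
  a : ∀ x, κ.a x = v x - c
  ρ : ∀ x, κ.ρ x = ρ x

/-- Translation of the integration variable makes the coefficients stationary. They contain `v - c`
instead of `v`, which leaves a transport term of factor `c`; the motion of the test functions will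
cancel it. -/
theorem Coeff.IsOf.hessianH_shift {κ : Coeff} {K g : ℝ → ℝ} {c : ℝ} {ρ v : ℝ → ℝ}
    (hκ : κ.IsOf K g c ρ v) (h : ℝ) (U : HZero) {φ ψ : ℝ → ℝ} (hφ : IsTest φ) (hψ : IsTest ψ) :
    -hessianH K g (fun x => ρ (x - h)) (fun x => v (x - h)) U
        (fun x => -deriv (fun x => ψ (x - h)) x) (fun x => -deriv (fun x => φ (x - h)) x)
      = ⟪κ.A₀ (U.shift h), hψ.deriv.memLp.toLp _⟫
        + ⟪κ.A₁ (U.shift h), hψ.deriv.deriv.memLp.toLp _⟫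
        + ⟪κ.A₂ (U.shift h), hφ.deriv.memLp.toLp _⟫
        + c * (⟪(U.shift h).u, hψ.deriv.memLp.toLp _⟫ + ⟪(U.shift h).r, hφ.deriv.memLp.toLp _⟫) := by
  set r := (U.shift h).r with hr
  set s := (U.shift h).dr with hs
  set u := (U.shift h).u with hu
  set ψ₁ := hψ.deriv.memLp.toLp _ with hψ₁
  set ψ₂ := hψ.deriv.deriv.memLp.toLp _ with hψ₂
  set φ₁ := hφ.deriv.memLp.toLp _ with hφ₁
  have i1 := integrable_bcf_mul_mul κ.q r ψ₁
  have i2 := integrable_bcf_mul_mul κ.a u ψ₁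
  have i3 := integrable_bcf_mul_mul κ.k s ψ₂
  have i4 := integrable_bcf_mul_mul κ.a r φ₁
  have i5 := integrable_bcf_mul_mul κ.ρ u φ₁
  have i6 := integrable_mul_L2 u ψ₁
  have i7 := integrable_mul_L2 r φ₁
  have i12 := i1.fun_add i2
  have i123 := i12.fun_add i3
  have i45 := i4.fun_add i5
  have i15 := i123.fun_add i45
  have i67 := i6.fun_add i7
  rw [Coeff.A₀_apply, Coeff.A₁_apply, Coeff.A₂_apply, ← hr, ← hs, ← hu, inner_add_left,
    inner_add_left, inner_mulOp, inner_mulOp, inner_mulOp, inner_mulOp, inner_mulOp,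
    inner_eq_integral, inner_eq_integral, ← integral_add i1 i2, ← integral_add i12 i3,
    ← integral_add i4 i5, ← integral_add i123 i45, ← integral_add i6 i7,
    ← integral_const_mul, ← integral_add i15 (i67.const_mul c), hessianH,
    ← integral_add_right_eq_self _ h, ← integral_neg]
  refine integral_congr_ae ?_
  filter_upwards [coeFn_shift h U.r, coeFn_shift h U.dr, coeFn_shift h U.u,
    hψ.deriv.memLp.coeFn_toLp, hψ.deriv.deriv.memLp.coeFn_toLp, hφ.deriv.memLp.coeFn_toLp]
    with x h1 h2 h3 h4 h5 h6
  have e1 : r x = U.r (x + h) := h1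
  have e2 : s x = U.dr (x + h) := h2
  have e3 : u x = U.u (x + h) := h3
  rw [e1, e2, e3, hψ₁, hψ₂, hφ₁, h4, h5, h6, hκ.q, hκ.k, hκ.a, hκ.ρ, potential_comp_sub]
  have e4 : deriv (fun x => -deriv (fun x => ψ (x - h)) x) (x + h) = -deriv (deriv ψ) x := by
    rw [deriv_comp_sub, deriv.fun_neg, deriv_comp_sub]
    simp only [add_sub_cancel_right]
  rw [e4, deriv_comp_sub, deriv_comp_sub]
  simp only [add_sub_cancel_right]
  ring

/-- The translation is moved onto the test functions. The pairing splits into one with the functions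
frozen at time `t`, differentiated by the equation, and increments covered by
`hasDerivAt_inner_sub`. -/
theorem Coeff.IsOf.hasDerivAt_pairing {κ : Coeff} {K g : ℝ → ℝ} {c : ℝ} {ρ v : ℝ → ℝ}
    (hκ : κ.IsOf K g c ρ v) {U : ℝ → HZero} (hU : IsLinearizedSolution K g c ρ v U)
    {φ ψ : ℝ → ℝ} (hφ : IsTest φ) (hψ : IsTest ψ) (t : ℝ) :
    HasDerivAt (fun s => ⟪((U s).shift (c * s)).r, hφ.memLp.toLp φ⟫
        + ⟪((U s).shift (c * s)).u, hψ.memLp.toLp ψ⟫)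
      (⟪κ.A₀ ((U t).shift (c * t)), hψ.deriv.memLp.toLp _⟫
        + ⟪κ.A₁ ((U t).shift (c * t)), hψ.deriv.deriv.memLp.toLp _⟫
        + ⟪κ.A₂ ((U t).shift (c * t)), hφ.deriv.memLp.toLp _⟫) t := by
  have h1 := hU.2 _ _ (hφ.comp_sub (c * t)) (hψ.comp_sub (c * t)) t
  rw [hκ.hessianH_shift (c * t) (U t) hφ hψ] at h1
  have h2 := hasDerivAt_inner_sub ((rL.continuous.comp hU.1).continuousAt (x := t))
    (hφ.hasDerivAt_toLp_comp_sub c t)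
  have h3 := hasDerivAt_inner_sub ((uL.continuous.comp hU.1).continuousAt (x := t))
    (hψ.hasDerivAt_toLp_comp_sub c t)
  have h4 := (h1.add h2).add h3
  refine (h4.congr_of_eventuallyEq (.of_forall fun s => ?_)).congr_deriv ?_
  · simp only [Pi.add_apply, inner_sub_right]
    rw [show ((U s).shift (c * s)).r = shift (c * s) (U s).r from rfl,
      show ((U s).shift (c * s)).u = shift (c * s) (U s).u from rfl, inner_shift _ _ hφ,
      inner_shift _ _ hψ,
      pairing, integral_add ((hφ.comp_sub _).integrable_mul _) ((hψ.comp_sub _).integrable_mul _),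
      ← inner_toLp _ (hφ.comp_sub (c * t)).memLp, ← inner_toLp _ (hψ.comp_sub (c * t)).memLp]
    simp only [Function.comp, rL_apply, uL_apply]
    ring
  · simp only [Function.comp, rL_apply, uL_apply, inner_smul_right]
    rw [show ((U t).shift (c * t)).r = shift (c * t) (U t).r from rfl,
      show ((U t).shift (c * t)).u = shift (c * t) (U t).u from rfl, inner_shift _ _ hφ.deriv,
      inner_shift _ _ hψ.deriv]
    ring

/-- A solution in the moving frame satisfies the integrated stationary equation. -/
theorem Coeff.IsOf.isGen {κ : Coeff} {K g : ℝ → ℝ} {c : ℝ} {ρ v : ℝ → ℝ}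
    (hκ : κ.IsOf K g c ρ v) {U : ℝ → HZero} (hU : IsLinearizedSolution K g c ρ v U) (t₀ t₁ : ℝ) :
    κ.IsGen (∫ s in t₀..t₁, (U s).shift (c * s))
      ((U t₁).shift (c * t₁) - (U t₀).shift (c * t₀)) := by
  intro φ ψ hφ hψ
  have hW : Continuous fun t => (U t).shift (c * t) := Continuous.HZero_shift hU.1 c
  let L : HZero →L[ℝ] ℝ := (innerSL ℝ (hψ.deriv.memLp.toLp _)).comp κ.A₀
    + (innerSL ℝ (hψ.deriv.deriv.memLp.toLp _)).comp κ.A₁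
    + (innerSL ℝ (hφ.deriv.memLp.toLp _)).comp κ.A₂
  have hL : ∀ Y, L Y = ⟪κ.A₀ Y, hψ.deriv.memLp.toLp _⟫
      + ⟪κ.A₁ Y, hψ.deriv.deriv.memLp.toLp _⟫ + ⟪κ.A₂ Y, hφ.deriv.memLp.toLp _⟫ := by
    intro Y
    rw [real_inner_comm, real_inner_comm (hψ.deriv.deriv.memLp.toLp _),
      real_inner_comm (hφ.deriv.memLp.toLp _)]
    rfl
  have hd : ∀ t, HasDerivAt (fun s => ⟪((U s).shift (c * s)).r, hφ.memLp.toLp φ⟫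
        + ⟪((U s).shift (c * s)).u, hψ.memLp.toLp ψ⟫) (L ((U t).shift (c * t))) t := fun t => by
    rw [hL]
    exact hκ.hasDerivAt_pairing hU hφ hψ t
  rw [← hL, ← ContinuousLinearMap.intervalIntegral_comp_comm _ (hW.intervalIntegrable _ _),
    intervalIntegral.integral_eq_sub_of_hasDerivAt (fun t _ => hd t)
      ((L.continuous.comp hW).intervalIntegrable _ _)]
  rw [← rL_apply, ← uL_apply, map_sub, map_sub, inner_sub_left, inner_sub_left]
  simp only [rL_apply, uL_apply]
  ring

/-! ### Sturm-Liouville theory for the Hessian -/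

/-- Evaluation of the first component at `x`. -/
def evalL (x : ℝ) : HZero →L[ℝ] ℝ :=
  (innerSL ℝ ((memLp_evalKernelFun x).toLp _)).comp (rL + drL)

theorem evalL_apply (x : ℝ) (U : HZero) : evalL x U = evalAt x U.r U.dr := by
  rw [evalAt, real_inner_comm]
  rfl

/-- Uniqueness for linear systems `R' = b P`, `P' = m R`. -/
theorem linear_system_unique {R P b m : ℝ → ℝ} {M : ℝ} (hR : ∀ x, HasDerivAt R (b x * P x) x)
    (hP : ∀ x, HasDerivAt P (m x * R x) x) (hb : ∀ x, |b x| ≤ M) (hm : ∀ x, |m x| ≤ M) {x₁ : ℝ}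
    (hR₁ : R x₁ = 0) (hP₁ : P x₁ = 0) (x : ℝ) : R x = 0 ∧ P x = 0 := by
  have hM : 0 ≤ M := (abs_nonneg _).trans (hb 0)
  have key : (fun x => (R x, P x)) = fun _ => ((0 : ℝ), (0 : ℝ)) := by
    refine ODE_solution_unique_univ (v := fun x p => (b x * p.2, m x * p.1)) (s := fun _ => univ)
      (K := M.toNNReal) (t₀ := x₁) (fun x => ?_) (fun x => ⟨(hR x).prodMk (hP x), mem_univ _⟩)
      (fun x => ⟨?_, mem_univ _⟩) ?_
    · rw [lipschitzOnWith_univ]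
      refine LipschitzWith.of_dist_le_mul fun p p' => ?_
      simp only [Prod.dist_eq, Real.dist_eq, ← mul_sub, abs_mul, Real.coe_toNNReal M hM]
      refine max_le ?_ ?_
      · exact mul_le_mul (hb x) (le_max_right _ _) (abs_nonneg _) hM
      · exact mul_le_mul (hm x) (le_max_left _ _) (abs_nonneg _) hM
    · exact (hasDerivAt_const x ((0 : ℝ), (0 : ℝ))).congr_deriv (by simp; rfl)
    · simp only [hR₁, hP₁]
  have := congrFun key x
  exact ⟨congrArg Prod.fst this, congrArg Prod.snd this⟩

/-- The Sturm-Liouville data: `m` is the effective potential `q - a² / ρ`, and `y` is a solution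
of `(k y')' = m y` that decays at `∞` and vanishes only at `x₀`. -/
structure SturmData (κ : Coeff) (m : ℝ →ᵇ ℝ) (y y' : ℝ → ℝ) (x₀ : ℝ) : Prop where
  k_pos : ∃ k₀ > 0, ∀ x, k₀ ≤ κ.k x
  ρ_pos : ∃ ρ₀ > 0, ∀ x, ρ₀ ≤ κ.ρ x
  m_eq : ∀ x, (κ.q x - m x) * κ.ρ x = κ.a x ^ 2
  m_pos : ∃ m₀ > 0, ∃ R > 0, ∀ x, R ≤ |x| → m₀ ≤ m x
  hasDerivAt : ∀ x, HasDerivAt y (y' x) x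
  hasDerivAt' : ∀ x, HasDerivAt (fun x => κ.k x * y' x) (m x * y x) x
  continuous_deriv : Continuous y'
  tendsto : Tendsto y atTop (𝓝 0)
  tendsto' : Tendsto y' atTop (𝓝 0)
  zero : y x₀ = 0
  deriv_ne : y' x₀ ≠ 0
  ne_zero : ∀ x, x ≠ x₀ → y x ≠ 0

namespace SturmData

variable {κ : Coeff} {m : ℝ →ᵇ ℝ} {y y' : ℝ → ℝ} {x₀ : ℝ}

/-- Jacobi's identity: where `y ≠ 0`, `m φ² + k φ'² = k (φ' - (y'/y) φ)² + (k y' φ² / y)'`. The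
boundary terms vanish at `±B`, outside the support of `φ`, and in the limit at `x₀`, where `φ`
vanishes and the zero of `y` is simple. -/
theorem test_nonneg (h : SturmData κ m y y' x₀) {φ : ℝ → ℝ} (hφ : IsTest φ) (h0 : φ x₀ = 0) :
    0 ≤ ∫ x, (m x * φ x * φ x + κ.k x * deriv φ x * deriv φ x) := by
  obtain ⟨k₀, hk₀, hk⟩ := h.k_pos
  set w : ℝ → ℝ := fun x => m x * φ x * φ x + κ.k x * deriv φ x * deriv φ x with hw
  have hφc := hφ.1.continuous
  have hφc' := hφ.deriv.1.continuous
  have hwc : Continuous w := ((m.continuous.mul hφc).mul hφc).add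
    ((κ.k.continuous.mul hφc').mul hφc')
  obtain ⟨b, hb0, hb⟩ := hφ.exists_support_subset
  set B := b + |x₀| + 1 with hB
  have hBx : |x₀| < B := by linarith
  have hφB : φ B = 0 := hb _ (by rw [abs_of_pos (by positivity)]; linarith [abs_nonneg x₀])
  have hφB' : φ (-B) = 0 := hb _ (by
    rw [abs_neg, abs_of_pos (by positivity)]; linarith [abs_nonneg x₀])
  set p : ℝ → ℝ := fun x => κ.k x * y' x / y x with hp
  -- The integrated identity: `G` is nondecreasing on each side of `x₀`.
  set G : ℝ → ℝ := fun x => (∫ t in x₀..x, w t) - p x * φ x ^ 2 with hG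
  have hGd : ∀ x, x ≠ x₀ → HasDerivAt G (κ.k x * (deriv φ x - y' x / y x * φ x) ^ 2) x := by
    intro x hx
    have hy := h.ne_zero x hx
    have h1 := (hwc.integral_hasStrictDerivAt x₀ x).hasDerivAt
    have h2 := (h.hasDerivAt' x).fun_div (h.hasDerivAt x) hy
    have h3 := (hφ.hasDerivAt x).fun_pow 2
    refine (h1.fun_sub (h2.fun_mul h3)).congr_deriv ?_
    simp only [hw]
    field_simp
    ring
  have hpos : ∀ x, 0 ≤ κ.k x * (deriv φ x - y' x / y x * φ x) ^ 2 := fun x =>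
    mul_nonneg (hk₀.le.trans (hk x)) (sq_nonneg _)
  -- Near `x₀`, `φ² / y` is the slope of `φ` times `φ`, divided by the slope of `y`; it tends to
  -- zero since `y' x₀ ≠ 0`.
  have hlim : Tendsto G (𝓝[≠] x₀) (𝓝 0) := by
    have l1 : Tendsto (fun x => ∫ t in x₀..x, w t) (𝓝[≠] x₀) (𝓝 0) := by
      have : Continuous fun x => ∫ t in x₀..x, w t :=
        intervalIntegral.continuous_primitive (fun a b => hwc.intervalIntegrable a b) x₀
      simpa using (this.tendsto x₀).mono_left nhdsWithin_le_nhds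
    have s1 := (hφ.hasDerivAt x₀).tendsto_slope
    have s2 := (h.hasDerivAt x₀).tendsto_slope
    have s3 : Tendsto φ (𝓝[≠] x₀) (𝓝 0) := by
      simpa [h0] using (hφc.tendsto x₀).mono_left nhdsWithin_le_nhds
    have s4 : Tendsto (fun x => κ.k x * y' x) (𝓝[≠] x₀) (𝓝 (κ.k x₀ * y' x₀)) :=
      ((κ.k.continuous.mul h.continuous_deriv).tendsto x₀).mono_left nhdsWithin_le_nhds
    have l2 := (s4.mul ((s1.mul s3).div s2 h.deriv_ne))
    rw [mul_zero, zero_div, mul_zero] at l2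
    have l3 := l1.sub l2
    rw [sub_zero] at l3
    refine l3.congr' ?_
    filter_upwards [self_mem_nhdsWithin] with x hx
    have hx' : x - x₀ ≠ 0 := sub_ne_zero.2 hx
    have hy := h.ne_zero x hx
    simp only [hG, hp, Pi.div_apply, slope_def_field, h0, h.zero, sub_zero]
    field_simp
  have hGB : G B = ∫ t in x₀..B, w t := by simp [hG, hφB]
  have hGB' : G (-B) = ∫ t in x₀..(-B), w t := by simp [hG, hφB']
  have hright : 0 ≤ G B := by
    have hmono : MonotoneOn G (Ioi x₀) := monotoneOn_of_deriv_nonneg (convex_Ioi _)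
      (fun x hx => (hGd x (ne_of_gt hx)).continuousAt.continuousWithinAt)
      (fun x hx => (hGd x (ne_of_gt (interior_subset hx))).differentiableAt.differentiableWithinAt)
      (fun x hx => by rw [(hGd x (ne_of_gt (interior_subset hx))).deriv]; exact hpos x)
    refine le_of_tendsto (hlim.mono_left (nhdsWithin_mono x₀
      (fun x hx => ne_of_gt hx : Ioi x₀ ⊆ {x₀}ᶜ))) ?_
    have hlt : x₀ < B := (le_abs_self _).trans_lt hBx
    filter_upwards [Ioo_mem_nhdsGT hlt] with x hx using hmono hx.1 hlt hx.2.le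
  have hleft : G (-B) ≤ 0 := by
    have hmono : MonotoneOn G (Iio x₀) := monotoneOn_of_deriv_nonneg (convex_Iio _)
      (fun x hx => (hGd x (ne_of_lt hx)).continuousAt.continuousWithinAt)
      (fun x hx => (hGd x ((mem_Iio.1 (interior_subset hx)).ne)).differentiableAt.differentiableWithinAt)
      (fun x hx => by rw [(hGd x ((mem_Iio.1 (interior_subset hx)).ne)).deriv]; exact hpos x)
    refine ge_of_tendsto (hlim.mono_left (nhdsWithin_mono x₀
      (fun x hx => ne_of_lt hx : Iio x₀ ⊆ {x₀}ᶜ))) ?_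
    have hlt : -B < x₀ := by linarith [neg_abs_le x₀]
    filter_upwards [Ioo_mem_nhdsLT hlt] with x hx using hmono hlt hx.2 hx.1.le
  have hsplit : ∫ x, w x = ∫ x in (-B)..B, w x := by
    rw [intervalIntegral.integral_of_le (by linarith [abs_nonneg x₀]),
      setIntegral_eq_integral_of_forall_compl_eq_zero]
    intro x hx
    have hxB : b < |x| := by
      rw [mem_Ioc, not_and_or, not_lt, not_le] at hx
      rcases hx with hx | hx
      · exact lt_abs.2 (Or.inr (by linarith [abs_nonneg x₀]))
      · exact lt_abs.2 (Or.inl (by linarith [abs_nonneg x₀]))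
    have hd : deriv φ x = 0 := by
      have : φ =ᶠ[𝓝 x] fun _ => 0 := by
        filter_upwards [(isOpen_lt continuous_const continuous_abs).mem_nhds hxB] with z hz
          using hb z (le_of_lt hz)
      rw [this.deriv_eq, deriv_const]
    simp [hw, hb x hxB.le, hd]
  rw [hsplit, ← intervalIntegral.integral_add_adjacent_intervals (hwc.intervalIntegrable (-B) x₀)
    (hwc.intervalIntegrable x₀ B), intervalIntegral.integral_symm, ← hGB, ← hGB']
  linarith

/-- Density is known only without the constraint. Subtracting `f(x₀) χ` with `χ(x₀) = 1` projects
continuously onto functions vanishing at `x₀`, so the inequality is proved for the projection of any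
`f`. -/
theorem sturm_nonneg (h : SturmData κ m y y' x₀) {f f' : L2R} (hf : IsWeakDeriv f f')
    (h0 : evalAt x₀ f f' = 0) : 0 ≤ ⟪mulOp m f, f⟫ + ⟪mulOp κ.k f', f'⟫ := by
  obtain ⟨χ, hχ, hχ1⟩ : ∃ χ, IsTest χ ∧ χ x₀ = 1 := by
    let b : ContDiffBump x₀ := ⟨1, 2, by norm_num, by norm_num⟩
    exact ⟨b, ⟨b.contDiff, b.hasCompactSupport⟩,
      b.one_of_mem_closedBall (Metric.mem_closedBall_self (by norm_num))⟩
  set N : L2R → L2R → ℝ := fun f f' => ⟪mulOp m f, f⟫ + ⟪mulOp κ.k f', f'⟫ with hN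
  have key : 0 ≤ N (f - evalAt x₀ f f' • hχ.memLp.toLp χ)
      (f' - evalAt x₀ f f' • hχ.deriv.memLp.toLp _) := by
    refine IsWeakDeriv.induction (P := fun f f' => 0 ≤ N (f - evalAt x₀ f f' • hχ.memLp.toLp χ)
      (f' - evalAt x₀ f f' • hχ.deriv.memLp.toLp _)) ?_ ?_ hf
    · exact isClosed_le continuous_const (by simp only [hN]; fun_prop)
    · intro φ hφ
      have ht := hφ.add (hχ.const_mul (-φ x₀))
      have hd := hφ.deriv_add (hχ.const_mul (-φ x₀))
      rw [hχ.deriv_const_mul] at hd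
      have e1 : hφ.memLp.toLp φ - φ x₀ • hχ.memLp.toLp χ = ht.memLp.toLp _ := by
        rw [sub_eq_add_neg, ← neg_smul]
        rfl
      have e2 : hφ.deriv.memLp.toLp _ - φ x₀ • hχ.deriv.memLp.toLp _ = ht.deriv.memLp.toLp _ := by
        simp only [hd]
        rw [sub_eq_add_neg, ← neg_smul]
        rfl
      have := h.test_nonneg ht (by simp [hχ1])
      rw [integral_add] at this
      · rw [hφ.evalAt, e1, e2]
        simp only [hN]
        rwa [mulOp_toLp, mulOp_toLp, inner_toLp_toLp, inner_toLp_toLp]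
      · exact (memLp_bcf_mul m ht.memLp).integrable_mul ht.memLp
      · exact (memLp_bcf_mul κ.k ht.deriv.memLp).integrable_mul ht.deriv.memLp
  simpa [h0] using key

end SturmData

theorem Coeff.form_self (κ : Coeff) (U : HZero) : κ.form U U
    = ∫ x, (κ.q x * U.r x * U.r x + κ.a x * U.u x * U.r x + κ.k x * U.dr x * U.dr x
      + (κ.a x * U.r x * U.u x + κ.ρ x * U.u x * U.u x)) := by
  have i1 := integrable_bcf_mul_mul κ.q U.r U.r
  have i2 := integrable_bcf_mul_mul κ.a U.u U.r
  have i3 := integrable_bcf_mul_mul κ.k U.dr U.dr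
  have i4 := integrable_bcf_mul_mul κ.a U.r U.u
  have i5 := integrable_bcf_mul_mul κ.ρ U.u U.u
  have i12 := i1.fun_add i2
  have i123 := i12.fun_add i3
  have i45 := i4.fun_add i5
  rw [integral_add i123 i45, integral_add i12 i3, integral_add i1 i2, integral_add i4 i5,
    Coeff.form_apply, Coeff.A₀_apply, Coeff.A₁_apply, Coeff.A₂_apply, inner_add_left,
    inner_add_left, inner_mulOp, inner_mulOp, inner_mulOp, inner_mulOp, inner_mulOp]

theorem Coeff.integrable_form_self (κ : Coeff) (U : HZero) :
    Integrable fun x => κ.q x * U.r x * U.r x + κ.a x * U.u x * U.r x + κ.k x * U.dr x * U.dr x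
      + (κ.a x * U.r x * U.u x + κ.ρ x * U.u x * U.u x) :=
  (((integrable_bcf_mul_mul κ.q U.r U.r).fun_add (integrable_bcf_mul_mul κ.a U.u U.r)).fun_add
    (integrable_bcf_mul_mul κ.k U.dr U.dr)).fun_add ((integrable_bcf_mul_mul κ.a U.r U.u).fun_add
    (integrable_bcf_mul_mul κ.ρ U.u U.u))

theorem norm_sq_eq_integral (f : L2R) : ‖f‖ ^ 2 = ∫ x, f x * f x := by
  rw [← real_inner_self_eq_norm_sq, inner_eq_integral]

namespace SturmData

variable {κ : Coeff} {m : ℝ →ᵇ ℝ} {y y' : ℝ → ℝ} {x₀ : ℝ}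

/-- Minimization over `u` at fixed `r`: `m` is the Schur complement of `ρ`. -/
theorem complete_square (h : SturmData κ m y y' x₀) (x r u : ℝ) :
    κ.q x * r * r + κ.a x * u * r + (κ.a x * r * u + κ.ρ x * u * u)
      = m x * r * r + κ.ρ x * (u + κ.a x / κ.ρ x * r) ^ 2 := by
  obtain ⟨ρ₀, hρ₀, hρ⟩ := h.ρ_pos
  have hρx : κ.ρ x ≠ 0 := (hρ₀.trans_le (hρ x)).ne'
  have e : κ.q x = m x + κ.a x ^ 2 / κ.ρ x := by
    rw [← h.m_eq x]
    field_simp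
    ring
  rw [e]
  field_simp
  ring

/-- There is a single linear constraint, so the form has at most one negative direction. -/
theorem form_nonneg (h : SturmData κ m y y' x₀) (U : HZero) (h0 : evalL x₀ U = 0) :
    0 ≤ κ.form U U := by
  obtain ⟨ρ₀, hρ₀, hρ⟩ := h.ρ_pos
  rw [evalL_apply] at h0
  refine (h.sturm_nonneg U.isWeakDeriv h0).trans ?_
  have i1 := integrable_bcf_mul_mul m U.r U.r
  have i2 := integrable_bcf_mul_mul κ.k U.dr U.dr
  rw [inner_mulOp, inner_mulOp, ← integral_add i1 i2, Coeff.form_self]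
  refine integral_mono (i1.fun_add i2) (κ.integrable_form_self U) fun x => ?_
  have h1 := h.complete_square x (U.r x) (U.u x)
  have h2 : 0 ≤ κ.ρ x * (U.u x + κ.a x / κ.ρ x * U.r x) ^ 2 :=
    mul_nonneg (hρ₀.le.trans (hρ x)) (sq_nonneg _)
  dsimp only
  linarith

/-- Gårding's inequality, with a finite rank error. -/
theorem exists_garding (h : SturmData κ m y y' x₀) :
    ∃ (n : ℕ) (Λ : HZero →L[ℝ] (Fin n → ℝ)) (δ C : ℝ), 0 < δ ∧ 0 ≤ C ∧
      ∀ U, δ * ‖U‖ ^ 2 ≤ κ.form U U + C * ‖Λ U‖ ^ 2 := by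
  obtain ⟨k₀, hk₀, hk⟩ := h.k_pos
  obtain ⟨ρ₀, hρ₀, hρ⟩ := h.ρ_pos
  obtain ⟨m₀, hm₀, R, hR, hm⟩ := h.m_pos
  let χ : ℝ →ᵇ ℝ := BoundedContinuousFunction.ofNormedAddCommGroup
    (fun x => max 0 (min 1 (R + 1 - |x|))) (by fun_prop) 1 fun x => by
      rw [Real.norm_eq_abs, abs_of_nonneg (le_max_left _ _)]
      exact max_le zero_le_one (min_le_left _ _)
  have hχ : ∀ x, χ x = max 0 (min 1 (R + 1 - |x|)) := fun x => rfl
  have hχ0 : ∀ x, 0 ≤ χ x := fun x => le_max_left _ _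
  -- Adding `C χ` lifts `m` above `m₀` on `|x| < R`, where `χ = 1` and `m ≥ -‖m‖`.
  set C := m₀ + ‖m‖ with hC
  have hC0 : 0 < C := by positivity
  have hmχ : ∀ x, m₀ ≤ m x + C * χ x := by
    intro x
    by_cases hx : R ≤ |x|
    · nlinarith [hm x hx, mul_nonneg hC0.le (hχ0 x)]
    · have : χ x = 1 := by
        rw [hχ, min_eq_left (by linarith), max_eq_right zero_le_one]
      have h2 : -‖m‖ ≤ m x := (abs_le.1 (m.norm_coe_le_norm x)).1
      rw [this]
      linarith
  -- The choice `ε = k₀ / (2C)` makes the derivative part of the localized error cost half of `k₀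
  -- ‖∂ₓr‖²`.
  obtain ⟨n, C', xs, hC', hbound⟩ := exists_inner_mulOp_le (R := R + 1) (ε := k₀ / (2 * C))
    (by linarith) (by positivity) χ (fun x => max_le zero_le_one (min_le_left _ _))
    (fun x hx => by rw [hχ]; exact max_le le_rfl ((min_le_right _ _).trans (by linarith)))
  set A := ‖κ.a‖ / ρ₀ with hA
  -- The three bounds pay for `u + (a/ρ) r`, for `r` including the cost of recovering `u` from that
  -- combination, and for `∂ₓr` with the remaining half of `k₀`.
  set δ := min (ρ₀ / 2) (min (m₀ / (1 + 2 * A ^ 2)) (k₀ / 2)) with hδ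
  have hδ0 : 0 < δ := by positivity
  have hδ1 : δ ≤ ρ₀ / 2 := min_le_left _ _
  have hδ2 : δ * (1 + 2 * A ^ 2) ≤ m₀ := by
    rw [← le_div_iff₀ (by positivity)]
    exact (min_le_right _ _).trans (min_le_left _ _)
  have hδ3 : δ ≤ k₀ / 2 := (min_le_right _ _).trans (min_le_right _ _)
  refine ⟨n, ContinuousLinearMap.pi fun i => evalL (xs i), δ, C * (C' * n), hδ0, by positivity,
    fun U => ?_⟩
  have i1 := integrable_mul_L2 U.r U.r
  have i2 := integrable_mul_L2 U.u U.u
  have i3 := integrable_mul_L2 U.dr U.dr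
  have i4 := integrable_bcf_mul_mul χ U.r U.r
  have hmain : δ * (‖U.r‖ ^ 2 + ‖U.u‖ ^ 2) + k₀ * ‖U.dr‖ ^ 2
      ≤ κ.form U U + C * ⟪mulOp χ U.r, U.r⟫ := by
    rw [norm_sq_eq_integral, norm_sq_eq_integral, norm_sq_eq_integral, inner_mulOp, Coeff.form_self,
      ← integral_add i1 i2, ← integral_const_mul, ← integral_const_mul, ← integral_const_mul,
      ← integral_add ((i1.fun_add i2).const_mul δ) (i3.const_mul k₀),
      ← integral_add (κ.integrable_form_self U) (i4.const_mul C)]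
    refine integral_mono (((i1.fun_add i2).const_mul δ).fun_add (i3.const_mul k₀))
      ((κ.integrable_form_self U).fun_add (i4.const_mul C)) fun x => ?_
    dsimp only
    set r := U.r x
    set u := U.u x
    set s := U.dr x
    set z := κ.a x / κ.ρ x with hz
    have h1 := h.complete_square x r u
    rw [← hz] at h1
    have hzA : z ^ 2 ≤ A ^ 2 := by
      have hA0 : 0 ≤ A := div_nonneg (norm_nonneg _) hρ₀.le
      rw [sq_le_sq, hz, abs_of_nonneg hA0, abs_div, abs_of_pos (hρ₀.trans_le (hρ x))]
      exact div_le_div₀ (norm_nonneg _) (κ.a.norm_coe_le_norm x) hρ₀ (hρ x)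
    have hu : u ^ 2 ≤ 2 * (u + z * r) ^ 2 + 2 * (A ^ 2 * r ^ 2) := by
      nlinarith [sq_nonneg (u + 2 * z * r), mul_le_mul_of_nonneg_right hzA (sq_nonneg r)]
    have e1 : δ * u ^ 2 ≤ δ * (2 * (u + z * r) ^ 2 + 2 * (A ^ 2 * r ^ 2)) := by gcongr
    have e2 : δ * (1 + 2 * A ^ 2) * r ^ 2 ≤ (m x + C * χ x) * r ^ 2 := by
      gcongr
      exact hδ2.trans (hmχ x)
    have e3 : 2 * δ * (u + z * r) ^ 2 ≤ κ.ρ x * (u + z * r) ^ 2 := by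
      gcongr
      linarith [hρ x]
    have e4 : k₀ * s ^ 2 ≤ κ.k x * s ^ 2 := by
      gcongr
      exact hk x
    nlinarith
  have hb := hbound U.r U.dr U.isWeakDeriv
  set Λ : HZero →L[ℝ] (Fin n → ℝ) := ContinuousLinearMap.pi fun i => evalL (xs i) with hΛ
  have hsum : ∑ i ∈ Finset.range n, evalAt (xs i) U.r U.dr ^ 2 ≤ n * ‖Λ U‖ ^ 2 := by
    rw [Finset.sum_range fun i => evalAt (xs i) U.r U.dr ^ 2]
    refine (Finset.sum_le_card_nsmul _ _ (‖Λ U‖ ^ 2) fun i _ => ?_).trans (by simp)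
    have : evalAt (xs i) U.r U.dr = Λ U i := (evalL_apply _ _).symm
    rw [this, ← sq_abs]
    gcongr
    exact norm_le_pi_norm (Λ U) i
  have hb' : C * ⟪mulOp χ U.r, U.r⟫ ≤ k₀ / 2 * ‖U.dr‖ ^ 2 + C * (C' * (n * ‖Λ U‖ ^ 2)) := by
    have e : C * (k₀ / (2 * C) * ‖U.dr‖ ^ 2) = k₀ / 2 * ‖U.dr‖ ^ 2 := by field_simp
    rw [← e, ← mul_add]
    refine mul_le_mul_of_nonneg_left (hb.trans ?_) hC0.le
    gcongr
  rw [HZero.norm_sq]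
  have e5 : δ * ‖U.dr‖ ^ 2 ≤ k₀ / 2 * ‖U.dr‖ ^ 2 := by gcongr
  nlinarith

end SturmData

/-- The hypotheses are the weak form of `L N = (w, η)`: the capillary term is moved off `V` by
integration by parts. -/
theorem Coeff.form_eq_of_isWeakDeriv {κ : Coeff} {N : HZero} {w η : L2R}
    (h : IsWeakDeriv (κ.A₁ N) (κ.A₀ N - w)) (hη : κ.A₂ N = η) (V : HZero) :
    κ.form N V = ⟪w, V.r⟫ + ⟪η, V.u⟫ := by
  rw [form_apply, h.inner_eq_neg V.isWeakDeriv, hη, inner_sub_left]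
  ring

theorem Coeff.isWeakDeriv_of_form_eq_zero {κ : Coeff} {U : HZero} (h : ∀ V, κ.form U V = 0) :
    IsWeakDeriv (κ.A₁ U) (κ.A₀ U) := by
  rw [isWeakDeriv_iff]
  intro φ hφ
  have : ⟪κ.A₀ U, hφ.memLp.toLp φ⟫ + ⟪κ.A₁ U, hφ.deriv.memLp.toLp _⟫ + ⟪κ.A₂ U, 0⟫ = 0 :=
    h (HZero.mk _ _ 0 hφ.isWeakDeriv)
  rw [inner_zero_right] at this
  linarith

theorem Coeff.A₂_eq_zero_of_form_eq_zero {κ : Coeff} {U : HZero} (h : ∀ V, κ.form U V = 0) :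
    κ.A₂ U = 0 := by
  have h0 : IsWeakDeriv (0 : L2R) 0 := H1.zero_mem
  have : ⟪κ.A₀ U, 0⟫ + ⟪κ.A₁ U, 0⟫ + ⟪κ.A₂ U, κ.A₂ U⟫ = 0 := h (HZero.mk 0 0 (κ.A₂ U) h0)
  rw [inner_zero_right, inner_zero_right, zero_add, zero_add] at this
  exact inner_self_eq_zero.1 this

namespace SturmData

variable {κ : Coeff} {m : ℝ →ᵇ ℝ} {y y' : ℝ → ℝ} {x₀ : ℝ}

/-- The kernel of the Hessian is spanned by `e = (y, ·)`. -/
theorem exists_eq_smul (h : SturmData κ m y y' x₀) {e U : HZero} (her : ∀ᵐ x, e.r x = y x)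
    (hedr : ∀ᵐ x, e.dr x = y' x) (heA : κ.A₂ e = 0) (hU : ∀ V, κ.form U V = 0) :
    ∃ α : ℝ, U = α • e := by
  obtain ⟨k₀, hk₀, hk⟩ := h.k_pos
  obtain ⟨ρ₀, hρ₀, hρ⟩ := h.ρ_pos
  have hkx : ∀ x, κ.k x ≠ 0 := fun x => (hk₀.trans_le (hk x)).ne'
  have hρx : ∀ x, κ.ρ x ≠ 0 := fun x => (hρ₀.trans_le (hρ x)).ne'
  have hw := Coeff.isWeakDeriv_of_form_eq_zero hU
  have hA := Coeff.A₂_eq_zero_of_form_eq_zero hU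
  have hAx : ∀ V : HZero, κ.A₂ V = 0 → ∀ᵐ x, κ.a x * V.r x + κ.ρ x * V.u x = 0 := by
    intro V hV
    filter_upwards [coeFn_mulOp κ.a V.r, coeFn_mulOp κ.ρ V.u,
      Lp.coeFn_add (mulOp κ.a V.r) (mulOp κ.ρ V.u), Lp.coeFn_zero ℝ 2 (volume : Measure ℝ)]
      with x h1 h2 h3 h4
    rw [← h1, ← h2, ← Pi.add_apply, ← h3, ← Coeff.A₂_apply, hV, h4]
    rfl
  -- Continuous representatives of `r` and of `k r'`. They turn the weak equation into the classical
  -- system `R' = P / k`, `P' = m R`.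
  set R : ℝ → ℝ := fun x => evalAt x U.r U.dr with hR
  set P : ℝ → ℝ := fun x => evalAt x (κ.A₁ U) (κ.A₀ U) with hP
  have hRc : Continuous R := U.isWeakDeriv.continuous_evalAt
  have hPc : Continuous P := hw.continuous_evalAt
  have hRae : ∀ᵐ x, U.r x = R x := U.isWeakDeriv.ae_eq_evalAt
  have hdr : ∀ᵐ x, U.dr x = (κ.k x)⁻¹ * P x := by
    filter_upwards [hw.ae_eq_evalAt, coeFn_mulOp κ.k U.dr] with x h1 h2
    rw [show P x = κ.A₁ U x from h1.symm, show κ.A₁ U x = κ.k x * U.dr x from h2,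
      inv_mul_cancel_left₀ (hkx x)]
  have hPd : ∀ᵐ x, κ.A₀ U x = m x * R x := by
    filter_upwards [coeFn_mulOp κ.q U.r, coeFn_mulOp κ.a U.u,
      Lp.coeFn_add (mulOp κ.q U.r) (mulOp κ.a U.u), hRae, hAx U hA] with x h1 h2 h3 h4 h5
    have h6 : κ.A₀ U x = κ.q x * U.r x + κ.a x * U.u x := by
      rw [← h1, ← h2, ← Pi.add_apply, ← h3]
      rfl
    have h7 := h.m_eq x
    rw [h6, ← h4]
    refine mul_left_cancel₀ (hρx x) ?_
    linear_combination U.r x * h7 + κ.a x * h5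
  have hkinv : Continuous fun x => (κ.k x)⁻¹ := κ.k.continuous.inv₀ hkx
  have hRd' : ∀ x, HasDerivAt R ((κ.k x)⁻¹ * P x) x := by
    intro x
    have e : R = fun x => R 0 + ∫ t in (0)..x, (κ.k t)⁻¹ * P t := by
      funext x
      rw [← intervalIntegral.integral_congr_ae (hdr.mono fun x hx _ => hx),
        ← U.isWeakDeriv.evalAt_sub]
      simp [hR]
    rw [e]
    exact ((hkinv.mul hPc).integral_hasStrictDerivAt 0 x).hasDerivAt.const_add _
  have hPd' : ∀ x, HasDerivAt P (m x * R x) x := by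
    intro x
    have e : P = fun x => P 0 + ∫ t in (0)..x, m t * R t := by
      funext x
      rw [← intervalIntegral.integral_congr_ae (hPd.mono fun x hx _ => hx), ← hw.evalAt_sub]
      simp [hP]
    rw [e]
    exact ((m.continuous.mul hRc).integral_hasStrictDerivAt 0 x).hasDerivAt.const_add _
  -- The Wronskian with `y` is constant, and it tends to zero at `+∞` because `R`, `P` are bounded
  -- while `y` and `y'` decay.
  have hwr : ∀ x, P x * y x - R x * (κ.k x * y' x) = 0 := by
    have hd : ∀ x, HasDerivAt (fun x => P x * y x - R x * (κ.k x * y' x)) 0 x := by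
      intro x
      refine (((hPd' x).fun_mul (h.hasDerivAt x)).fun_sub
        ((hRd' x).fun_mul (h.hasDerivAt' x))).congr_deriv ?_
      have := hkx x
      field_simp
      ring
    have hc : ∀ x, P x * y x - R x * (κ.k x * y' x) = P 0 * y 0 - R 0 * (κ.k 0 * y' 0) := fun x =>
      is_const_of_deriv_eq_zero (fun x => (hd x).differentiableAt) (fun x => (hd x).deriv) x 0
    have hlim : Tendsto (fun x => P x * y x - R x * (κ.k x * y' x)) atTop (𝓝 0) := by
      have l1 : Tendsto (fun x => P x * y x) atTop (𝓝 0) := by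
        refine bdd_le_mul_tendsto_zero' (‖κ.A₁ U‖ + ‖κ.A₀ U‖) (.of_forall fun x => ?_) h.tendsto
        exact abs_evalAt_le _ _ _
      have l2 : Tendsto (fun x => R x * κ.k x * y' x) atTop (𝓝 0) := by
        refine bdd_le_mul_tendsto_zero' ((‖U.r‖ + ‖U.dr‖) * ‖κ.k‖) (.of_forall fun x => ?_)
          h.tendsto'
        rw [abs_mul]
        exact mul_le_mul (abs_evalAt_le _ _ _) (κ.k.norm_coe_le_norm x) (abs_nonneg _) (by positivity)
      simpa [mul_assoc] using l1.sub l2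
    intro x
    rw [hc x]
    exact tendsto_nhds_unique (tendsto_const_nhds.congr fun x => (hc x).symm) hlim
  set x₁ := x₀ + 1
  have hy₁ : y x₁ ≠ 0 := h.ne_zero x₁ (by simp [x₁])
  -- This matches the first component at `x₁`, where `y` is nonzero; the vanishing Wronskian then
  -- matches the second, and uniqueness does the rest.
  set α := R x₁ / y x₁ with hα
  have hsol := linear_system_unique (R := fun x => R x - α * y x)
    (P := fun x => P x - α * (κ.k x * y' x)) (b := fun x => (κ.k x)⁻¹) (m := m)
    (M := max k₀⁻¹ ‖m‖) (x₁ := x₁)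
    (fun x => by
      refine ((hRd' x).fun_sub ((h.hasDerivAt x).const_mul α)).congr_deriv ?_
      have := hkx x
      field_simp)
    (fun x => ((hPd' x).fun_sub ((h.hasDerivAt' x).const_mul α)).congr_deriv (by ring))
    (fun x => by
      rw [abs_of_pos (inv_pos.2 (hk₀.trans_le (hk x)))]
      exact (inv_anti₀ hk₀ (hk x)).trans (le_max_left _ _))
    (fun x => (m.norm_coe_le_norm x).trans (le_max_right _ _))
    (by rw [hα]; field_simp; simp)
    (by
      have := hwr x₁
      rw [hα]
      field_simp
      linarith)
  have hr : ∀ᵐ x, U.r x = α * e.r x := by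
    filter_upwards [hRae, her] with x h1 h2
    rw [h1, h2]
    linarith [(hsol x).1]
  refine ⟨α, HZero.ext' ?_ ?_ ?_⟩
  · refine Lp.ext ?_
    filter_upwards [hr, Lp.coeFn_smul α e.r] with x h1 h2
    exact h1.trans h2.symm
  · refine Lp.ext ?_
    filter_upwards [hdr, hedr, Lp.coeFn_smul α e.dr] with x h1 h2 h3
    refine Eq.trans ?_ h3.symm
    rw [Pi.smul_apply, smul_eq_mul, h1, h2, show P x = α * (κ.k x * y' x) by linarith [(hsol x).2]]
    have := hkx x
    field_simp
  · refine Lp.ext ?_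
    filter_upwards [hr, hAx U hA, hAx e heA, Lp.coeFn_smul α e.u] with x h1 h2 h3 h4
    refine Eq.trans ?_ h4.symm
    rw [Pi.smul_apply, smul_eq_mul]
    refine mul_left_cancel₀ (hρx x) ?_
    rw [h1] at h2
    linear_combination h2 - α * h3

/-- Linear growth of the solutions in the moving frame. -/
theorem exists_growth (h : SturmData κ m y y' x₀) {e N : HZero} {w η : L2R}
    (her : ∀ᵐ x, e.r x = y x) (hedr : ∀ᵐ x, e.dr x = y' x) (heA : κ.A₂ e = 0)
    (heW : IsWeakDeriv (κ.A₁ e) (κ.A₀ e)) (hw : IsWeakDeriv w e.u) (hη : IsWeakDeriv η e.r)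
    (hN : IsWeakDeriv (κ.A₁ N) (κ.A₀ N - w)) (hNη : κ.A₂ N = η)
    (hneg : ⟪w, N.r⟫ + ⟪η, N.u⟫ < 0) :
    ∃ C : ℝ, 0 < C ∧ ∀ W : ℝ → HZero, Continuous W →
      (∀ t₀ t₁, κ.IsGen (∫ s in t₀..t₁, W s) (W t₁ - W t₀)) →
      ∀ t, ‖W t‖ ≤ C * (1 + |t|) * ‖W 0‖ := by
  -- `Q` is the linearized momentum, `T` measures the component along `e`, and `S` is the rate of
  -- change of `T`.
  let Q : HZero →L[ℝ] ℝ := (innerSL ℝ w).comp rL + (innerSL ℝ η).comp uL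
  let T : HZero →L[ℝ] ℝ := (innerSL ℝ e.r).comp rL
  let S : HZero →L[ℝ] ℝ := (innerSL ℝ e.dr).comp κ.A₂
  have hQ : ∀ V, Q V = ⟪w, V.r⟫ + ⟪η, V.u⟫ := fun V => rfl
  have hT : ∀ V, T V = ⟪e.r, V.r⟫ := fun V => rfl
  have hS : ∀ V, S V = ⟪e.dr, κ.A₂ V⟫ := fun V => rfl
  have he : ∀ V, κ.form e V = 0 := fun V => by
    rw [Coeff.form_eq_of_isWeakDeriv (w := 0) (by rwa [sub_zero]) heA, inner_zero_left,
      inner_zero_left, add_zero]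
  have hNQ : ∀ V, κ.form N V = Q V := fun V => by
    rw [Coeff.form_eq_of_isWeakDeriv hN hNη, hQ]
  have hTe : T e ≠ 0 := by
    rw [hT, ne_eq, inner_self_eq_zero]
    intro h0
    have hy : y =ᵐ[volume] fun _ => 0 := by
      filter_upwards [her, Lp.coeFn_zero ℝ 2 (volume : Measure ℝ)] with x h1 h2
      rw [← h1, h0, h2]
      rfl
    have hyc : Continuous y := continuous_iff_continuousAt.2 fun x => (h.hasDerivAt x).continuousAt
    have := (hyc.ae_eq_iff_eq volume continuous_const).1 hy
    exact h.ne_zero (x₀ + 1) (by simp) (congrFun this _)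
  have hQe : Q e = 0 := by rw [← hNQ, Coeff.form_comm, he]
  have hSe : S e = 0 := by rw [hS, heA, inner_zero_right]
  obtain ⟨n, Λ, δ, C, hδ, hC, hG⟩ := h.exists_garding
  obtain ⟨C₁, C₂, hC₁, hC₂, hcoer⟩ := exists_norm_sq_le κ.form κ.form_comm Λ hδ hC hG he hTe hNQ
    hneg (fun U hU => h.form_nonneg U hU) (fun U hU => h.exists_eq_smul her hedr heA hU)
  obtain ⟨C₃, hC₃, hgrow⟩ := exists_linear_growth κ.form (S := S) hC₁ hC₂ κ.form_comm he hTe hQe hSe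
    hcoer
  refine ⟨C₃, hC₃, fun W hW hgen => hgrow W hW (Coeff.form_conserved hW hgen) (fun t => ?_)
    fun t => ?_⟩
  -- The derivatives of `w` and `η` are the components of `e`, so the increment of `Q` is the form
  -- paired with `e`, which is zero.
  · rw [← sub_eq_zero, ← map_sub, hQ, real_inner_comm, real_inner_comm (W t - W 0).u,
      (hgen 0 t).inner_r hw, (hgen 0 t).inner_u hη e.isWeakDeriv]
    have := κ.form_comm (∫ s in (0)..t, W s) e
    rw [he, Coeff.form_apply] at this
    linarith
  · rw [← map_sub, hT, hS, real_inner_comm, (hgen 0 t).inner_r e.isWeakDeriv, real_inner_comm]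

end SturmData

/-! ### Exponentially decaying functions -/

/-- Exponential decay at `±∞`. -/
def ExpDecay (f : ℝ → ℝ) : Prop := ∃ C α : ℝ, 0 < α ∧ ∀ x, |f x| ≤ C * Real.exp (-α * |x|)

theorem tendsto_exp_neg_mul_abs_atTop {α : ℝ} (hα : 0 < α) :
    Tendsto (fun x : ℝ => Real.exp (-α * |x|)) atTop (𝓝 0) :=
  Real.tendsto_exp_atBot.comp (tendsto_abs_atTop_atTop.const_mul_atTop_of_neg (by linarith))

theorem tendsto_exp_neg_mul_abs_atBot {α : ℝ} (hα : 0 < α) :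
    Tendsto (fun x : ℝ => Real.exp (-α * |x|)) atBot (𝓝 0) :=
  Real.tendsto_exp_atBot.comp (tendsto_abs_atBot_atTop.const_mul_atTop_of_neg (by linarith))

theorem ExpDecay.tendsto_atTop {f : ℝ → ℝ} (h : ExpDecay f) : Tendsto f atTop (𝓝 0) := by
  obtain ⟨C, α, hα, hf⟩ := h
  refine squeeze_zero_norm hf ?_
  simpa using (tendsto_exp_neg_mul_abs_atTop hα).const_mul C

theorem ExpDecay.tendsto_atBot {f : ℝ → ℝ} (h : ExpDecay f) : Tendsto f atBot (𝓝 0) := by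
  obtain ⟨C, α, hα, hf⟩ := h
  refine squeeze_zero_norm hf ?_
  simpa using (tendsto_exp_neg_mul_abs_atBot hα).const_mul C

theorem integrable_exp_neg_mul_abs {α : ℝ} (hα : 0 < α) :
    Integrable fun x : ℝ => Real.exp (-α * |x|) := by
  rw [← integrableOn_univ, ← Iic_union_Ioi (a := (0 : ℝ)), integrableOn_union]
  constructor
  · refine (integrableOn_exp_mul_Iic hα 0).congr_fun (fun x hx => ?_) measurableSet_Iic
    dsimp only
    rw [abs_of_nonpos hx]
    ring_nf
  · refine (integrableOn_exp_mul_Ioi (neg_lt_zero.2 hα) 0).congr_fun (fun x hx => ?_)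
      measurableSet_Ioi
    dsimp only
    rw [abs_of_pos hx]

theorem ExpDecay.integrable {f : ℝ → ℝ} (h : ExpDecay f) (hc : Continuous f) : Integrable f := by
  obtain ⟨C, α, hα, hf⟩ := h
  exact ((integrable_exp_neg_mul_abs hα).const_mul C).mono' hc.aestronglyMeasurable
    (.of_forall hf)

theorem ExpDecay.bdd_mul {f g : ℝ → ℝ} {M : ℝ} (hg : ∀ x, |g x| ≤ M) (h : ExpDecay f) :
    ExpDecay fun x => g x * f x := by
  obtain ⟨C, α, hα, hf⟩ := h
  refine ⟨M * C, α, hα, fun x => ?_⟩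
  rw [abs_mul, mul_assoc]
  exact mul_le_mul (hg x) (hf x) (abs_nonneg _) ((abs_nonneg _).trans (hg x))

theorem ExpDecay.exists_bound {f : ℝ → ℝ} (h : ExpDecay f) : ∃ M, ∀ x, |f x| ≤ M := by
  obtain ⟨C, α, hα, hf⟩ := h
  have hC : 0 ≤ C := by simpa using (abs_nonneg _).trans (hf 0)
  refine ⟨C, fun x => (hf x).trans (mul_le_of_le_one_right hC (Real.exp_le_one_iff.2 ?_))⟩
  nlinarith [abs_nonneg x]

theorem ExpDecay.memLp {f : ℝ → ℝ} (h : ExpDecay f) (hc : Continuous f) :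
    MemLp f 2 (volume : Measure ℝ) := by
  obtain ⟨M, hM⟩ := h.exists_bound
  rw [memLp_two_iff_integrable_sq hc.aestronglyMeasurable]
  simpa only [sq] using (h.bdd_mul hM).integrable (hc.mul hc)

theorem exists_bound_of_tendsto {f : ℝ → ℝ} (hc : Continuous f) {a b : ℝ}
    (ha : Tendsto f atTop (𝓝 a)) (hb : Tendsto f atBot (𝓝 b)) : ∃ M, ∀ x, |f x| ≤ M := by
  obtain ⟨R, hR⟩ := eventually_atTop.1 (ha.abs.eventually_lt_const (lt_add_one _))
  obtain ⟨S, hS⟩ := eventually_atBot.1 (hb.abs.eventually_lt_const (lt_add_one _))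
  obtain ⟨M, hM⟩ := (isCompact_Icc (a := S) (b := R)).exists_bound_of_continuousOn hc.continuousOn
  refine ⟨max M (max (|a| + 1) (|b| + 1)), fun x => ?_⟩
  rcases le_total R x with h | h
  · exact (hR x h).le.trans ((le_max_left _ _).trans (le_max_right _ _))
  rcases le_total x S with h' | h'
  · exact (hS x h').le.trans ((le_max_right _ _).trans (le_max_right _ _))
  · exact (hM x ⟨h', h⟩).trans (le_max_left _ _)

/-- The upper bound for `1 / f`, which also has limits at both ends. -/
theorem exists_lower_bound_of_tendsto {f : ℝ → ℝ} (hc : Continuous f) {a : ℝ} (ha0 : 0 < a)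
    (ha : Tendsto f atTop (𝓝 a)) (hb : Tendsto f atBot (𝓝 a)) (hpos : ∀ x, 0 < f x) :
    ∃ m > 0, ∀ x, m ≤ f x := by
  obtain ⟨M, hM⟩ := exists_bound_of_tendsto (hc.inv₀ fun x => (hpos x).ne') (ha.inv₀ ha0.ne')
    (hb.inv₀ ha0.ne')
  have hM0 : 0 < M := (inv_pos.2 (hpos 0)).trans_le ((le_abs_self _).trans (hM 0))
  refine ⟨M⁻¹, inv_pos.2 hM0, fun x => ?_⟩
  rw [inv_le_comm₀ hM0 (hpos x)]
  exact (le_abs_self _).trans (hM x)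

/-- A continuous function with limits at `±∞` as a bounded continuous function. -/
def bcfOfTendsto (f : ℝ → ℝ) (hc : Continuous f) {a b : ℝ}
    (ha : Tendsto f atTop (𝓝 a)) (hb : Tendsto f atBot (𝓝 b)) : ℝ →ᵇ ℝ :=
  BoundedContinuousFunction.ofNormedAddCommGroup f hc (exists_bound_of_tendsto hc ha hb).choose
    (exists_bound_of_tendsto hc ha hb).choose_spec

theorem const_of_deriv_zero_of_tendsto {f : ℝ → ℝ} {a : ℝ} (hd : ∀ x, HasDerivAt f 0 x)
    (ha : Tendsto f atTop (𝓝 a)) (x : ℝ) : f x = a := by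
  have hc : ∀ y, f y = f x := fun y =>
    is_const_of_deriv_eq_zero (fun x => (hd x).differentiableAt) (fun x => (hd x).deriv) y x
  exact tendsto_nhds_unique (tendsto_const_nhds.congr fun y => (hc y).symm) ha

/-! ### Smooth functions on the half-line -/

section HalfLine

variable {F : ℝ → ℝ}

theorem _root_.ContDiffOn.hasDerivAt_Ioi (hF : ContDiffOn ℝ ∞ F (Ioi 0)) {z : ℝ} (hz : 0 < z) :
    HasDerivAt F (deriv F z) z :=
  ((hF.differentiableOn (by simp)).differentiableAt (Ioi_mem_nhds hz)).hasDerivAt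

theorem _root_.ContDiffOn.deriv_Ioi (hF : ContDiffOn ℝ ∞ F (Ioi 0)) :
    ContDiffOn ℝ ∞ (deriv F) (Ioi 0) :=
  hF.deriv_of_isOpen isOpen_Ioi (by simp)

theorem iteratedDeriv_two' (F : ℝ → ℝ) : iteratedDeriv 2 F = deriv (deriv F) := by
  rw [iteratedDeriv_succ, iteratedDeriv_one]

theorem _root_.ContDiffOn.continuous_comp_pos (hF : ContDiffOn ℝ ∞ F (Ioi 0)) {ρ : ℝ → ℝ}
    (hρ : Continuous ρ) (hpos : ∀ x, 0 < ρ x) : Continuous fun x => F (ρ x) :=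
  hF.continuousOn.comp_continuous hρ hpos

theorem _root_.ContDiffOn.tendsto_comp_pos (hF : ContDiffOn ℝ ∞ F (Ioi 0)) {ρ : ℝ → ℝ}
    {l : Filter ℝ} {a : ℝ} (ha : 0 < a) (hρ : Tendsto ρ l (𝓝 a)) : Tendsto (fun x => F (ρ x)) l (𝓝 (F a)) :=
  (hF.continuousOn.continuousAt (Ioi_mem_nhds ha)).tendsto.comp hρ

end HalfLine

/-! ### Profile equations of a soliton -/

theorem _root_.ContDiff.hasDerivAt_infty {f : ℝ → ℝ} (h : ContDiff ℝ ∞ f) (x : ℝ) :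
    HasDerivAt f (deriv f x) x :=
  (h.differentiable (by simp) x).hasDerivAt

theorem _root_.ContDiff.deriv_infty {f : ℝ → ℝ} (h : ContDiff ℝ ∞ f) : ContDiff ℝ ∞ (deriv f) :=
  (contDiff_infty_iff_deriv.1 h).2

namespace IsSoliton

variable {K g : ℝ → ℝ} {ρp vp c : ℝ} {ρ v : ℝ → ℝ}

theorem expDecay_deriv (h : IsSoliton K g ρp vp c ρ v) : ExpDecay (deriv ρ) := by
  obtain ⟨C, α, hα, hb⟩ := h.decay 1 le_rfl
  exact ⟨C, α, hα, fun x => by simpa using (hb x).1⟩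

theorem expDecay_deriv_v (h : IsSoliton K g ρp vp c ρ v) : ExpDecay (deriv v) := by
  obtain ⟨C, α, hα, hb⟩ := h.decay 1 le_rfl
  exact ⟨C, α, hα, fun x => by simpa using (hb x).2⟩

theorem expDecay_deriv_deriv (h : IsSoliton K g ρp vp c ρ v) : ExpDecay (deriv (deriv ρ)) := by
  obtain ⟨C, α, hα, hb⟩ := h.decay 2 one_le_two
  exact ⟨C, α, hα, fun x => by rw [← iteratedDeriv_two']; exact (hb x).1⟩

/-- Conservation of mass in the moving frame. -/
theorem mass (h : IsSoliton K g ρp vp c ρ v) (x : ℝ) : ρ x * (v x - c) = ρp * (vp - c) := by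
  refine const_of_deriv_zero_of_tendsto (f := fun x => ρ x * (v x - c)) (fun x => ?_)
    (h.tendsto_ρ_top.mul (h.tendsto_v_top.sub_const c)) x
  have hρ := h.smooth_ρ.hasDerivAt_infty x
  have hv := h.smooth_v.hasDerivAt_infty x
  have h1 := (h.travelingWave 0 x).1
  simp only [mul_zero, sub_zero] at h1
  have h2 : HasDerivAt (fun s => ρ (x - c * s)) (-c * deriv ρ x) 0 := by
    have h3 : HasDerivAt (fun s : ℝ => x - c * s) (-c) 0 := by
      simpa using ((hasDerivAt_id (0 : ℝ)).const_mul c).const_sub x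
    exact (HasDerivAt.comp_of_eq (0 : ℝ) hρ h3 (by simp)).congr_deriv (mul_comm _ _)
  rw [h2.deriv, (hρ.fun_mul hv).deriv] at h1
  refine (hρ.fun_mul (hv.sub_const c)).congr_deriv ?_
  linarith

theorem hasDerivAt_flux (h : IsSoliton K g ρp vp c ρ v) (hK : ContDiffOn ℝ ∞ K (Ioi 0)) (x : ℝ) :
    HasDerivAt (fun x => K (ρ x) * deriv (deriv ρ) x + 1 / 2 * deriv K (ρ x) * deriv ρ x ^ 2)
      (deriv K (ρ x) * deriv ρ x * deriv (deriv ρ) x + K (ρ x) * deriv (deriv (deriv ρ)) x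
        + 1 / 2 * (iteratedDeriv 2 K (ρ x) * deriv ρ x * deriv ρ x ^ 2
          + deriv K (ρ x) * (2 * deriv ρ x * deriv (deriv ρ) x))) x := by
  have d0 := h.smooth_ρ.hasDerivAt_infty x
  have d1 := h.smooth_ρ.deriv_infty.hasDerivAt_infty x
  have d2 := h.smooth_ρ.deriv_infty.deriv_infty.hasDerivAt_infty x
  have k0 := (ContDiffOn.hasDerivAt_Ioi hK (h.pos x)).comp x d0
  have k1 := (ContDiffOn.hasDerivAt_Ioi (hK.deriv_Ioi) (h.pos x)).comp x d0
  rw [← iteratedDeriv_two'] at k1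
  refine ((k0.fun_mul d2).fun_add ((k1.const_mul (1 / 2)).fun_mul (d1.fun_pow 2))).congr_deriv ?_
  simp only [Function.comp]
  push_cast
  ring

/-- The derivative of the momentum equation in the moving frame. -/
theorem flux_deriv (h : IsSoliton K g ρp vp c ρ v) (hK : ContDiffOn ℝ ∞ K (Ioi 0)) (x : ℝ) :
    (v x - c) * deriv v x + deriv g (ρ x) * deriv ρ x =
      deriv K (ρ x) * deriv ρ x * deriv (deriv ρ) x + K (ρ x) * deriv (deriv (deriv ρ)) x
        + 1 / 2 * (iteratedDeriv 2 K (ρ x) * deriv ρ x * deriv ρ x ^ 2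
          + deriv K (ρ x) * (2 * deriv ρ x * deriv (deriv ρ) x)) := by
  have hv := h.smooth_v.hasDerivAt_infty x
  have h1 := (h.travelingWave 0 x).2
  simp only [mul_zero, sub_zero, iteratedDeriv_two' ρ] at h1
  have h2 : HasDerivAt (fun s => v (x - c * s)) (-c * deriv v x) 0 := by
    have h3 : HasDerivAt (fun s : ℝ => x - c * s) (-c) 0 := by
      simpa using ((hasDerivAt_id (0 : ℝ)).const_mul c).const_sub x
    exact (HasDerivAt.comp_of_eq (0 : ℝ) hv h3 (by simp)).congr_deriv (mul_comm _ _)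
  rw [h2.deriv, (h.hasDerivAt_flux hK x).deriv] at h1
  rw [← h1]
  ring

/-- The integrated momentum equation in the moving frame. -/
theorem flux_eq (h : IsSoliton K g ρp vp c ρ v) (hK : ContDiffOn ℝ ∞ K (Ioi 0))
    (hg : ContDiffOn ℝ ∞ g (Ioi 0)) (hρp : 0 < ρp) (x : ℝ) :
    K (ρ x) * deriv (deriv ρ) x + 1 / 2 * deriv K (ρ x) * deriv ρ x ^ 2
      = (v x - c) ^ 2 / 2 + g (ρ x) - ((vp - c) ^ 2 / 2 + g ρp) := by
  have hlim : Tendsto (fun x => K (ρ x) * deriv (deriv ρ) x + 1 / 2 * deriv K (ρ x) * deriv ρ x ^ 2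
      - ((v x - c) ^ 2 / 2 + g (ρ x))) atTop
      (𝓝 (K ρp * 0 + 1 / 2 * deriv K ρp * 0 ^ 2 - ((vp - c) ^ 2 / 2 + g ρp))) :=
    (((ContDiffOn.tendsto_comp_pos hK hρp h.tendsto_ρ_top).mul
      h.expDecay_deriv_deriv.tendsto_atTop).add
      (((ContDiffOn.tendsto_comp_pos (hK.deriv_Ioi) hρp h.tendsto_ρ_top).const_mul
        (1 / 2)).mul (h.expDecay_deriv.tendsto_atTop.pow 2))).sub
      ((((h.tendsto_v_top.sub_const c).pow 2).div_const 2).add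
        (ContDiffOn.tendsto_comp_pos hg hρp h.tendsto_ρ_top))
  have := const_of_deriv_zero_of_tendsto (fun x => ?_) hlim x
  · simp only [mul_zero, ne_eq, OfNat.ofNat_ne_zero, not_false_eq_true, zero_pow, add_zero,
      zero_sub] at this
    linarith
  · have hv := h.smooth_v.hasDerivAt_infty x
    have hgd := (ContDiffOn.hasDerivAt_Ioi hg (h.pos x)).comp x (h.smooth_ρ.hasDerivAt_infty x)
    refine ((h.hasDerivAt_flux hK x).fun_sub
      ((((hv.sub_const c).fun_pow 2).div_const 2).fun_add hgd)).congr_deriv ?_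
    rw [← h.flux_deriv hK x]
    push_cast
    ring

end IsSoliton

/-! ### Hyperbolicity of the endstate and Sturm-Liouville data of a soliton -/

namespace IsSoliton

variable {K g : ℝ → ℝ} {ρp vp c : ℝ} {ρ v : ℝ → ℝ}

theorem deriv_nonneg_of_monotoneOn {f : ℝ → ℝ} {s : Set ℝ} {x : ℝ} (h : MonotoneOn f s)
    (hs : s ∈ 𝓝 x) : 0 ≤ deriv f x := by
  rw [← derivWithin_of_mem_nhds hs]
  exact h.derivWithin_nonneg

theorem deriv_nonpos_of_antitoneOn {f : ℝ → ℝ} {s : Set ℝ} {x : ℝ} (h : AntitoneOn f s)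
    (hs : s ∈ 𝓝 x) : deriv f x ≤ 0 := by
  rw [← derivWithin_of_mem_nhds hs]
  exact h.derivWithin_nonpos

/-- The sign of `ρ'` on both sides of the extremum. -/
theorem exists_sign (h : IsSoliton K g ρp vp c ρ v) : ∃ x₀ σ : ℝ, σ ^ 2 = 1 ∧
    (∀ x < x₀, σ * deriv ρ x ≤ 0) ∧ (∀ x > x₀, 0 ≤ σ * deriv ρ x) ∧
    (∀ x > x₀, σ * (ρ x - ρp) < 0) := by
  obtain ⟨x₀, ⟨h1, h2⟩ | ⟨h1, h2⟩⟩ := h.monotony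
  · refine ⟨x₀, 1, by norm_num, fun x hx => ?_, fun x hx => ?_, fun x hx => ?_⟩
    · simpa using deriv_nonpos_of_antitoneOn h1.antitoneOn (Iic_mem_nhds hx)
    · simpa using deriv_nonneg_of_monotoneOn h2.monotoneOn (Ici_mem_nhds hx)
    · have hx' : x₀ ≤ x + 1 := by linarith
      have e1 : ρ x < ρ (x + 1) := h2 (le_of_lt hx) hx' (by linarith)
      have e2 : ρ (x + 1) ≤ ρp := ge_of_tendsto h.tendsto_ρ_top
        ((eventually_ge_atTop (x + 1)).mono fun z hz => h2.monotoneOn hx' (hx'.trans hz) hz)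
      linarith
  · refine ⟨x₀, -1, by norm_num, fun x hx => ?_, fun x hx => ?_, fun x hx => ?_⟩
    · simpa using deriv_nonneg_of_monotoneOn h1.monotoneOn (Iic_mem_nhds hx)
    · simpa using deriv_nonpos_of_antitoneOn h2.antitoneOn (Ici_mem_nhds hx)
    · have hx' : x₀ ≤ x + 1 := by linarith
      have e1 : ρ (x + 1) < ρ x := h2 (le_of_lt hx) hx' (by linarith)
      have e2 : ρp ≤ ρ (x + 1) := le_of_tendsto h.tendsto_ρ_top
        ((eventually_ge_atTop (x + 1)).mono fun z hz => h2.antitoneOn hx' (hx'.trans hz) hz)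
      linarith

/-- The endstate is hyperbolic: otherwise the profile could not decay exponentially. -/
theorem hyperbolic (h : IsSoliton K g ρp vp c ρ v) (hK : ContDiffOn ℝ ∞ K (Ioi 0))
    (hKpos : ∀ y, 0 < y → 0 < K y) (hg : ContDiffOn ℝ ∞ g (Ioi 0)) (hρp : 0 < ρp)
    (hdec : ExpDecay fun x => ρ x - ρp) : 0 < deriv g ρp - (vp - c) ^ 2 / ρp := by
  by_contra! hm
  set μ := deriv g ρp - (vp - c) ^ 2 / ρp with hμ
  obtain ⟨C, α, hα, hC⟩ := hdec
  obtain ⟨k₀, hk₀, hk⟩ := exists_lower_bound_of_tendsto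
    (hK.continuous_comp_pos h.smooth_ρ.continuous h.pos) (hKpos _ hρp)
    (hK.tendsto_comp_pos hρp h.tendsto_ρ_top) (hK.tendsto_comp_pos hρp h.tendsto_ρ_bot)
    (fun x => hKpos _ (h.pos x))
  obtain ⟨x₀, σ, hσ, -, hs2, hs3⟩ := h.exists_sign
  set j := ρp * (vp - c) with hj
  -- The right-hand side of the profile equation after eliminating `v` by the mass law. It vanishes
  -- at `ρp` with slope `μ`.
  set f : ℝ → ℝ := fun z => (j / z) ^ 2 / 2 + g z - ((vp - c) ^ 2 / 2 + g ρp) with hf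
  have hfd : HasDerivAt f μ ρp := by
    have e1 : HasDerivAt (fun z => j / z) (-(j / ρp ^ 2)) ρp := by
      simpa [div_eq_mul_inv, neg_mul] using (hasDerivAt_inv hρp.ne').const_mul j
    refine ((((e1.fun_pow 2).div_const 2).fun_add (hg.hasDerivAt_Ioi hρp)).sub_const _).congr_deriv ?_
    rw [hμ, hj]
    field_simp
    push_cast
    ring
  have hfρ : f ρp = 0 := by
    simp only [hf, hj]
    rw [mul_div_cancel_left₀ _ hρp.ne', sub_self]
  have hflux : ∀ x, K (ρ x) * deriv (deriv ρ) x + 1 / 2 * deriv K (ρ x) * deriv ρ x ^ 2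
      = f (ρ x) := by
    intro x
    rw [h.flux_eq hK hg hρp x, hf, hj, ← h.mass x]
    simp only
    rw [mul_div_cancel_left₀ _ (h.pos x).ne']
  set η : ℝ → ℝ := fun x => ρ x - ρp with hη
  have hηd : ∀ x, HasDerivAt η (deriv ρ x) x := fun x =>
    (h.smooth_ρ.hasDerivAt_infty x).sub_const ρp
  -- A rate strictly below `α`. If `μ ≤ 0`, the profile will be shown to decay no faster than `e^{-β
  -- x}`.
  set β := α / 2 with hβ
  set ε := k₀ * β ^ 2 with hε
  have hε0 : 0 < ε := by positivity
  have hsmall : ∀ᶠ x in atTop, |f (ρ x) - μ * η x| ≤ ε * |η x| := by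
    have h1 := (hasDerivAt_iff_isLittleO.1 hfd).def hε0
    filter_upwards [h.tendsto_ρ_top.eventually h1] with x hx
    simpa [hfρ, mul_comm] using hx
  obtain ⟨R₁, hR₁⟩ := eventually_atTop.1 hsmall
  set R := max R₁ (x₀ + 1) with hR
  have hRx : ∀ x, R ≤ x → x₀ < x := fun x hx => by linarith [le_max_right R₁ (x₀ + 1)]
  have hη0 : ∀ x, R ≤ x → η x ≠ 0 := fun x hx h0 => by
    have := hs3 x (hRx x hx)
    change σ * η x < 0 at this
    simp [h0] at this
  have hηη : ∀ x, R ≤ x → η x * deriv ρ x ≤ 0 := fun x hx => by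
    have h1 := hs3 x (hRx x hx)
    have h2 := hs2 x (hRx x hx)
    change σ * η x < 0 at h1
    have e : η x * deriv ρ x = (σ * η x) * (σ * deriv ρ x) := by
      rw [mul_mul_mul_comm, ← sq, hσ, one_mul]
    rw [e]
    exact mul_nonpos_of_nonpos_of_nonneg h1.le h2
  -- Linearization at `ρp` together with `μ ≤ 0`: the restoring force is at most `ε η²` after
  -- multiplication by `η`.
  have hfη : ∀ x, R ≤ x → (f (ρ x) - ε * η x) * η x ≤ 0 := fun x hx => by
    have h1 := hR₁ x ((le_max_left _ _).trans hx)
    have h2 : (f (ρ x) - μ * η x) * η x ≤ ε * |η x| * |η x| :=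
      (le_abs_self _).trans ((abs_mul _ _).le.trans
        (mul_le_mul_of_nonneg_right h1 (abs_nonneg _)))
    rw [mul_assoc, abs_mul_abs_self] at h2
    nlinarith [mul_nonneg (neg_nonneg.2 hm) (mul_self_nonneg (η x))]
  -- Kinetic energy minus `ε η² / 2`. It is nondecreasing beyond `R`, since `η` and `ρ'` have
  -- opposite signs there, and tends to zero; hence `G ≤ 0`, which with `K ≥ k₀` means `|ρ'| ≤ β
  -- |η|`.
  set G : ℝ → ℝ := fun x => 1 / 2 * K (ρ x) * deriv ρ x ^ 2 - ε / 2 * η x ^ 2 with hG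
  have hGd : ∀ x, HasDerivAt G ((f (ρ x) - ε * η x) * deriv ρ x) x := by
    intro x
    have d1 := h.smooth_ρ.deriv_infty.hasDerivAt_infty x
    have k0 := (hK.hasDerivAt_Ioi (h.pos x)).comp x (h.smooth_ρ.hasDerivAt_infty x)
    refine (((k0.const_mul (1 / 2)).fun_mul (d1.fun_pow 2)).fun_sub
      (((hηd x).fun_pow 2).const_mul (ε / 2))).congr_deriv ?_
    rw [← hflux x]
    simp only [Function.comp]
    push_cast
    ring
  have hGmono : MonotoneOn G (Ici R) := by
    refine monotoneOn_of_deriv_nonneg (convex_Ici R)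
      (fun x _ => (hGd x).continuousAt.continuousWithinAt)
      (fun x _ => (hGd x).differentiableAt.differentiableWithinAt) fun x hx => ?_
    have hx' : R ≤ x := interior_subset hx
    rw [(hGd x).deriv]
    have h1 := hfη x hx'
    have h2 := hηη x hx'
    have h3 : 0 < η x ^ 2 := sq_pos_of_ne_zero (hη0 x hx')
    refine nonneg_of_mul_nonneg_left (b := η x ^ 2) ?_ h3
    have e : (f (ρ x) - ε * η x) * deriv ρ x * η x ^ 2
      = ((f (ρ x) - ε * η x) * η x) * (η x * deriv ρ x) := by ring
    rw [e]
    exact mul_nonneg_of_nonpos_of_nonpos h1 h2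
  have hηlim : Tendsto η atTop (𝓝 0) := by simpa [hη] using h.tendsto_ρ_top.sub_const ρp
  have hGlim : Tendsto G atTop (𝓝 0) := by
    simpa using (((hK.tendsto_comp_pos hρp h.tendsto_ρ_top).const_mul (1 / 2)).mul
      (h.expDecay_deriv.tendsto_atTop.pow 2)).sub ((hηlim.pow 2).const_mul (ε / 2))
  have hG0 : ∀ x, R ≤ x → G x ≤ 0 := fun x hx => ge_of_tendsto hGlim
    ((eventually_ge_atTop x).mono fun z hz => hGmono hx (hx.trans hz) hz)
  have hslope : ∀ x, R ≤ x → |deriv ρ x| ≤ β * |η x| := fun x hx => by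
    have h1 := hG0 x hx
    simp only [hG, hε] at h1
    have h2 : k₀ * deriv ρ x ^ 2 ≤ K (ρ x) * deriv ρ x ^ 2 := by
      gcongr
      exact hk x
    have h3 : deriv ρ x ^ 2 ≤ (β * η x) ^ 2 := by
      refine le_of_mul_le_mul_left ?_ hk₀
      nlinarith
    have h4 := sq_le_sq.1 h3
    rwa [abs_mul, abs_of_pos (by positivity : 0 < β)] at h4
  -- The slope bound makes `η² e^{2βx}` nondecreasing, while the assumed decay bounds it by `C²
  -- e^{-αx}` for `x ≥ 0`. It would then be nonpositive at `R`, although `η ≠ 0` there.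
  set Z : ℝ → ℝ := fun x => η x ^ 2 * Real.exp (2 * β * x) with hZ
  have hZd : ∀ x, HasDerivAt Z ((2 * (η x * deriv ρ x) + 2 * β * η x ^ 2)
      * Real.exp (2 * β * x)) x := by
    intro x
    refine (((hηd x).fun_pow 2).fun_mul (hasDerivAt_exp_const_mul (2 * β) x)).congr_deriv ?_
    push_cast
    ring
  have hZmono : MonotoneOn Z (Ici R) := by
    refine monotoneOn_of_deriv_nonneg (convex_Ici R)
      (fun x _ => (hZd x).continuousAt.continuousWithinAt)
      (fun x _ => (hZd x).differentiableAt.differentiableWithinAt) fun x hx => ?_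
    have hx' : R ≤ x := interior_subset hx
    rw [(hZd x).deriv]
    refine mul_nonneg ?_ (Real.exp_pos _).le
    have h1 : |η x * deriv ρ x| ≤ β * η x ^ 2 := by
      rw [abs_mul, ← sq_abs (η x)]
      nlinarith [hslope x hx', abs_nonneg (η x)]
    linarith [(abs_le.1 h1).1]
  have hZlim : Tendsto Z atTop (𝓝 0) := by
    have h1 : Tendsto (fun x : ℝ => C ^ 2 * Real.exp (-α * x)) atTop (𝓝 0) := by
      simpa using (Real.tendsto_exp_atBot.comp
        (tendsto_id.const_mul_atTop_of_neg (neg_lt_zero.2 hα))).const_mul (C ^ 2)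
    refine squeeze_zero' (.of_forall fun x => by positivity) ?_ h1
    filter_upwards [eventually_ge_atTop 0] with x hx
    have h2 := hC x
    rw [abs_of_nonneg hx] at h2
    have h3 : η x ^ 2 ≤ (C * Real.exp (-α * x)) ^ 2 := by
      rw [← sq_abs (η x)]
      exact pow_le_pow_left₀ (abs_nonneg _) h2 2
    calc Z x ≤ (C * Real.exp (-α * x)) ^ 2 * Real.exp (2 * β * x) := by
          simp only [hZ]
          gcongr
      _ = C ^ 2 * Real.exp (-α * x) := by
          rw [mul_pow, mul_assoc, sq (Real.exp _), ← Real.exp_add, ← Real.exp_add, hβ]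
          ring_nf
  have hZR : Z R ≤ 0 := ge_of_tendsto hZlim
    ((eventually_ge_atTop R).mono fun z hz => hZmono self_mem_Ici hz hz)
  have hZR' : 0 < Z R := mul_pos (sq_pos_of_ne_zero (hη0 R le_rfl)) (Real.exp_pos _)
  linarith

/-- The differentiated mass law, which is the second component of `L ∂ₓV = 0`. -/
theorem deriv_v (h : IsSoliton K g ρp vp c ρ v) (x : ℝ) :
    (v x - c) * deriv ρ x + ρ x * deriv v x = 0 := by
  have h1 : HasDerivAt (fun x => ρ x * (v x - c)) (deriv ρ x * (v x - c) + ρ x * deriv v x) x :=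
    (h.smooth_ρ.hasDerivAt_infty x).fun_mul ((h.smooth_v.hasDerivAt_infty x).sub_const c)
  have h2 : (fun x => ρ x * (v x - c)) = fun _ => ρp * (vp - c) := funext h.mass
  rw [h2] at h1
  have := h1.unique (hasDerivAt_const x _)
  linarith

/-- The first component of `δ²H[V] ∂ₓV = 0`. -/
theorem hasDerivAt_capillarity (h : IsSoliton K g ρp vp c ρ v) (hK : ContDiffOn ℝ ∞ K (Ioi 0))
    (x : ℝ) : HasDerivAt (fun x => K (ρ x) * deriv (deriv ρ) x)
      (potential K g ρ x * deriv ρ x + (v x - c) * deriv v x) x := by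
  have k0 := (hK.hasDerivAt_Ioi (h.pos x)).comp x (h.smooth_ρ.hasDerivAt_infty x)
  refine (k0.fun_mul (h.smooth_ρ.deriv_infty.deriv_infty.hasDerivAt_infty x)).congr_deriv ?_
  have := h.flux_deriv hK x
  simp only [potential, iteratedDeriv_two' ρ, Function.comp]
  linear_combination -this

theorem continuous_potential (h : IsSoliton K g ρp vp c ρ v) (hK : ContDiffOn ℝ ∞ K (Ioi 0))
    (hg : ContDiffOn ℝ ∞ g (Ioi 0)) : Continuous (potential K g ρ) := by
  have c0 := h.smooth_ρ.continuous
  have c1 := h.smooth_ρ.deriv_infty.continuous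
  have c2 := h.smooth_ρ.deriv_infty.deriv_infty.continuous
  have k1 := hK.deriv_Ioi.continuous_comp_pos c0 h.pos
  have k2 := hK.deriv_Ioi.deriv_Ioi.continuous_comp_pos c0 h.pos
  have g1 := hg.deriv_Ioi.continuous_comp_pos c0 h.pos
  have e : potential K g ρ = fun x => -deriv K (ρ x) * deriv (deriv ρ) x
      - 1 / 2 * deriv (deriv K) (ρ x) * deriv ρ x ^ 2 + deriv g (ρ x) := funext fun x => by
    simp only [potential, iteratedDeriv_two']
  rw [e]
  exact ((k1.neg.mul c2).sub ((continuous_const.mul k2).mul (c1.pow 2))).add g1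

theorem tendsto_potential (h : IsSoliton K g ρp vp c ρ v) (hK : ContDiffOn ℝ ∞ K (Ioi 0))
    (hg : ContDiffOn ℝ ∞ g (Ioi 0)) (hρp : 0 < ρp) :
    Tendsto (potential K g ρ) atTop (𝓝 (deriv g ρp)) ∧
      Tendsto (potential K g ρ) atBot (𝓝 (deriv g ρp)) := by
  have key : ∀ l : Filter ℝ, Tendsto ρ l (𝓝 ρp) → Tendsto (deriv ρ) l (𝓝 0) →
      Tendsto (deriv (deriv ρ)) l (𝓝 0) → Tendsto (potential K g ρ) l (𝓝 (deriv g ρp)) := by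
    intro l l0 l1 l2
    have k1 := hK.deriv_Ioi.tendsto_comp_pos hρp l0
    have k2 := hK.deriv_Ioi.deriv_Ioi.tendsto_comp_pos hρp l0
    have g1 := hg.deriv_Ioi.tendsto_comp_pos hρp l0
    have := ((k1.neg.mul l2).sub ((k2.const_mul (1 / 2)).mul (l1.pow 2))).add g1
    simp only [mul_zero, ne_eq, OfNat.ofNat_ne_zero, not_false_eq_true, zero_pow, sub_zero,
      zero_add] at this
    refine this.congr fun x => ?_
    simp only [potential, iteratedDeriv_two']
  exact ⟨key _ h.tendsto_ρ_top h.expDecay_deriv.tendsto_atTop h.expDecay_deriv_deriv.tendsto_atTop,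
    key _ h.tendsto_ρ_bot h.expDecay_deriv.tendsto_atBot h.expDecay_deriv_deriv.tendsto_atBot⟩

/-- The coefficients of the linearized equation around a soliton, in the moving frame. -/
def coeff (h : IsSoliton K g ρp vp c ρ v) (hK : ContDiffOn ℝ ∞ K (Ioi 0))
    (hg : ContDiffOn ℝ ∞ g (Ioi 0)) (hρp : 0 < ρp) : Coeff where
  q := bcfOfTendsto (potential K g ρ) (h.continuous_potential hK hg)
    (h.tendsto_potential hK hg hρp).1 (h.tendsto_potential hK hg hρp).2
  k := bcfOfTendsto (fun x => K (ρ x)) (hK.continuous_comp_pos h.smooth_ρ.continuous h.pos)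
    (hK.tendsto_comp_pos hρp h.tendsto_ρ_top) (hK.tendsto_comp_pos hρp h.tendsto_ρ_bot)
  a := bcfOfTendsto (fun x => v x - c) (h.smooth_v.continuous.sub continuous_const)
    (h.tendsto_v_top.sub_const c) (h.tendsto_v_bot.sub_const c)
  ρ := bcfOfTendsto ρ h.smooth_ρ.continuous h.tendsto_ρ_top h.tendsto_ρ_bot

theorem coeff_isOf (h : IsSoliton K g ρp vp c ρ v) (hK : ContDiffOn ℝ ∞ K (Ioi 0))
    (hg : ContDiffOn ℝ ∞ g (Ioi 0)) (hρp : 0 < ρp) : (h.coeff hK hg hρp).IsOf K g c ρ v :=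
  ⟨fun _ => rfl, fun _ => rfl, fun _ => rfl, fun _ => rfl⟩

/-- `ρ'` satisfies the hypotheses of Sturm-Liouville theory. -/
theorem exists_sturmData (h : IsSoliton K g ρp vp c ρ v) (hK : ContDiffOn ℝ ∞ K (Ioi 0))
    (hKpos : ∀ y, 0 < y → 0 < K y) (hg : ContDiffOn ℝ ∞ g (Ioi 0)) (hρp : 0 < ρp)
    (hdec : ExpDecay fun x => ρ x - ρp) :
    ∃ m x₀, SturmData (h.coeff hK hg hρp) m (deriv ρ) (deriv (deriv ρ)) x₀ := by
  have hlim : ∀ l : Filter ℝ, Tendsto (potential K g ρ) l (𝓝 (deriv g ρp)) → Tendsto ρ l (𝓝 ρp) →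
      Tendsto v l (𝓝 vp) → Tendsto (fun x => potential K g ρ x - (v x - c) ^ 2 / ρ x) l
        (𝓝 (deriv g ρp - (vp - c) ^ 2 / ρp)) := fun l l1 l2 l3 =>
    l1.sub (((l3.sub_const c).pow 2).div l2 hρp.ne')
  have htop := hlim _ (h.tendsto_potential hK hg hρp).1 h.tendsto_ρ_top h.tendsto_v_top
  have hbot := hlim _ (h.tendsto_potential hK hg hρp).2 h.tendsto_ρ_bot h.tendsto_v_bot
  have hcont : Continuous fun x => potential K g ρ x - (v x - c) ^ 2 / ρ x :=
    (h.continuous_potential hK hg).sub (((h.smooth_v.continuous.sub continuous_const).pow 2).div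
      h.smooth_ρ.continuous fun x => (h.pos x).ne')
  set m : ℝ →ᵇ ℝ := bcfOfTendsto _ hcont htop hbot with hm
  have hmx : ∀ x, m x = potential K g ρ x - (v x - c) ^ 2 / ρ x := fun x => rfl
  have hμ := h.hyperbolic hK hKpos hg hρp hdec
  have hy : ∀ x, HasDerivAt (deriv ρ) (deriv (deriv ρ) x) x :=
    h.smooth_ρ.deriv_infty.hasDerivAt_infty
  have hky : ∀ x, HasDerivAt (fun x => K (ρ x) * deriv (deriv ρ) x) (m x * deriv ρ x) x := by
    intro x
    refine (h.hasDerivAt_capillarity hK x).congr_deriv ?_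
    have h1 := h.deriv_v x
    have h2 := (h.pos x).ne'
    rw [hmx]
    field_simp
    linear_combination (v x - c) * h1
  obtain ⟨k₀, hk₀, hk⟩ := exists_lower_bound_of_tendsto
    (hK.continuous_comp_pos h.smooth_ρ.continuous h.pos) (hKpos _ hρp)
    (hK.tendsto_comp_pos hρp h.tendsto_ρ_top) (hK.tendsto_comp_pos hρp h.tendsto_ρ_bot)
    (fun x => hKpos _ (h.pos x))
  obtain ⟨x₀, σ, hσ, hs1, hs2, hs3⟩ := h.exists_sign
  have hσ0 : σ ≠ 0 := fun h0 => by simp [h0] at hσ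
  -- `ρ'` and `K ρ''` solve a linear first-order system; if both vanished at a point, `ρ` would be
  -- constant.
  have hnot : ∀ x₁, deriv ρ x₁ = 0 → deriv (deriv ρ) x₁ ≠ 0 := by
    intro x₁ h1 h2
    have hz := linear_system_unique (R := deriv ρ) (P := fun x => K (ρ x) * deriv (deriv ρ) x)
      (b := fun x => (K (ρ x))⁻¹) (m := m) (M := max k₀⁻¹ ‖m‖) (x₁ := x₁)
      (fun x => (hy x).congr_deriv (inv_mul_cancel_left₀ (hKpos _ (h.pos x)).ne' _).symm) hky
      (fun x => by
        rw [abs_of_pos (inv_pos.2 (hk₀.trans_le (hk x)))]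
        exact (inv_anti₀ hk₀ (hk x)).trans (le_max_left _ _))
      (fun x => (m.norm_coe_le_norm x).trans (le_max_right _ _)) h1 (by rw [h2, mul_zero])
    have hconst := const_of_deriv_zero_of_tendsto (f := ρ) (fun x => by
      have := h.smooth_ρ.hasDerivAt_infty x
      rwa [(hz x).1] at this) h.tendsto_ρ_top (x₀ + 1)
    have := hs3 (x₀ + 1) (by linarith)
    rw [hconst, sub_self, mul_zero] at this
    exact lt_irrefl _ this
  have hc1 : Continuous fun x => σ * deriv ρ x :=
    continuous_const.mul h.smooth_ρ.deriv_infty.continuous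
  have hzero : deriv ρ x₀ = 0 := by
    have e1 : σ * deriv ρ x₀ ≤ 0 := le_of_tendsto
      ((hc1.tendsto x₀).mono_left (nhdsWithin_le_nhds (s := Iio x₀)))
      (eventually_nhdsWithin_of_forall hs1)
    have e2 : 0 ≤ σ * deriv ρ x₀ := ge_of_tendsto
      ((hc1.tendsto x₀).mono_left (nhdsWithin_le_nhds (s := Ioi x₀)))
      (eventually_nhdsWithin_of_forall hs2)
    exact (mul_eq_zero.1 (le_antisymm e1 e2)).resolve_left hσ0
  -- Strict monotonicity alone allows isolated zeros of `ρ'`. At such a zero `ρ'`, of constant sign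
  -- nearby, has an extremum, so `ρ''` vanishes too, which is excluded.
  have hne : ∀ x, x ≠ x₀ → deriv ρ x ≠ 0 := by
    intro x hx h0
    refine hnot x h0 ?_
    have hd := (hy x).const_mul σ
    have hext : IsLocalExtr (fun x => σ * deriv ρ x) x := by
      rcases lt_or_gt_of_ne hx with hx | hx
      · right
        filter_upwards [Iio_mem_nhds hx] with z hz
        simpa [h0] using hs1 z hz
      · left
        filter_upwards [Ioi_mem_nhds hx] with z hz
        simpa [h0] using hs2 z hz
    exact (mul_eq_zero.1 (hext.hasDerivAt_eq_zero hd)).resolve_left hσ0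
  refine ⟨m, x₀, ⟨k₀, hk₀, hk⟩, ?_, ?_, ?_, hy, hky, ?_, h.expDecay_deriv.tendsto_atTop,
    h.expDecay_deriv_deriv.tendsto_atTop, hzero, hnot x₀ hzero, hne⟩
  · exact exists_lower_bound_of_tendsto h.smooth_ρ.continuous hρp h.tendsto_ρ_top h.tendsto_ρ_bot h.pos
  · intro x
    change (potential K g ρ x - m x) * ρ x = (v x - c) ^ 2
    rw [hmx, sub_sub_cancel, div_mul_cancel₀ _ (h.pos x).ne']
  · obtain ⟨R₁, h1⟩ := eventually_atTop.1 (htop.eventually_const_lt (half_lt_self hμ))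
    obtain ⟨R₂, h2⟩ := eventually_atBot.1 (hbot.eventually_const_lt (half_lt_self hμ))
    refine ⟨_, half_pos hμ, max 1 (max R₁ (-R₂)), by positivity, fun x hx => ?_⟩
    have hx1 : R₁ ≤ |x| := ((le_max_left _ _).trans (le_max_right _ _)).trans hx
    have hx2 : -R₂ ≤ |x| := ((le_max_right _ _).trans (le_max_right _ _)).trans hx
    rcases le_total 0 x with h0 | h0
    · rw [abs_of_nonneg h0] at hx1
      exact (h1 x hx1).le
    · rw [abs_of_nonpos h0] at hx2
      exact (h2 x (by linarith)).le
  · exact h.smooth_ρ.deriv_infty.deriv_infty.continuous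

end IsSoliton

/-! ### Functions of `(s, x)` decaying exponentially with all their derivatives -/

/-- The directional derivative of `F` in the direction `w`. -/
def dirDeriv (w : ℝ × ℝ) (F : ℝ × ℝ → ℝ) (p : ℝ × ℝ) : ℝ := fderiv ℝ F p w

/-- Smooth functions of `(s, x)`, `s ∈ I`, all of whose derivatives decay exponentially in `x`,
locally uniformly in `s`. -/
structure SmoothDecay (I : Set ℝ) (F : ℝ × ℝ → ℝ) : Prop where
  isOpen : IsOpen I
  smooth : ContDiffOn ℝ ∞ F (I ×ˢ univ)
  decay : ∀ s₀ ∈ I, ∀ n : ℕ, ∃ C α δ : ℝ, 0 < α ∧ 0 < δ ∧ ∀ s ∈ I, |s - s₀| < δ → ∀ x : ℝ,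
    ‖iteratedFDeriv ℝ n F (s, x)‖ ≤ C * Real.exp (-α * |x|)

namespace SmoothDecay

variable {I : Set ℝ} {F G : ℝ × ℝ → ℝ} {s : ℝ}

theorem mem_nhds (h : SmoothDecay I F) (hs : s ∈ I) (x : ℝ) : I ×ˢ univ ∈ 𝓝 (s, x) :=
  (h.isOpen.prod isOpen_univ).mem_nhds ⟨hs, mem_univ x⟩

theorem contDiffAt (h : SmoothDecay I F) (hs : s ∈ I) (x : ℝ) : ContDiffAt ℝ ∞ F (s, x) :=
  h.smooth.contDiffAt (h.mem_nhds hs x)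

theorem hasFDerivAt (h : SmoothDecay I F) (hs : s ∈ I) (x : ℝ) :
    HasFDerivAt F (fderiv ℝ F (s, x)) (s, x) :=
  ((h.contDiffAt hs x).differentiableAt (by simp)).hasFDerivAt

theorem hasDerivAt_fst (h : SmoothDecay I F) (hs : s ∈ I) (x : ℝ) :
    HasDerivAt (fun s => F (s, x)) (dirDeriv (1, 0) F (s, x)) s :=
  (h.hasFDerivAt hs x).comp_hasDerivAt s ((hasDerivAt_id s).prodMk (hasDerivAt_const s x))

theorem hasDerivAt_snd (h : SmoothDecay I F) (hs : s ∈ I) (x : ℝ) :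
    HasDerivAt (fun x => F (s, x)) (dirDeriv (0, 1) F (s, x)) x :=
  (h.hasFDerivAt hs x).comp_hasDerivAt x ((hasDerivAt_const x s).prodMk (hasDerivAt_id x))

theorem continuous_snd (h : SmoothDecay I F) (hs : s ∈ I) : Continuous fun x => F (s, x) :=
  continuous_iff_continuousAt.2 fun x => (h.hasDerivAt_snd hs x).continuousAt

theorem dirDeriv (h : SmoothDecay I F) (w : ℝ × ℝ) : SmoothDecay I (dirDeriv w F) where
  isOpen := h.isOpen
  smooth := (h.smooth.fderiv_of_isOpen (h.isOpen.prod isOpen_univ) (by simp)).clm_apply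
    contDiffOn_const
  decay s₀ hs₀ n := by
    obtain ⟨C, α, δ, hα, hδ, hb⟩ := h.decay s₀ hs₀ (n + 1)
    refine ⟨‖ContinuousLinearMap.apply ℝ ℝ w‖ * C, α, δ, hα, hδ, fun s hs hsδ x => ?_⟩
    have h1 : ContDiffAt ℝ ∞ (fderiv ℝ F) (s, x) := (h.contDiffAt hs x).fderiv_right (by simp)
    refine ((ContinuousLinearMap.apply ℝ ℝ w).norm_iteratedFDeriv_comp_left h1
      (by exact_mod_cast le_top)).trans ?_
    rw [norm_iteratedFDeriv_fderiv, mul_assoc]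
    exact mul_le_mul_of_nonneg_left (hb s hs hsδ x) (norm_nonneg _)

theorem dirDeriv_comm (h : SmoothDecay I F) (w w' : ℝ × ℝ) (hs : s ∈ I) (x : ℝ) :
    EulerKorteweg.dirDeriv w (EulerKorteweg.dirDeriv w' F) (s, x)
      = EulerKorteweg.dirDeriv w' (EulerKorteweg.dirDeriv w F) (s, x) := by
  have h1 : DifferentiableAt ℝ (fderiv ℝ F) (s, x) :=
    ((h.contDiffAt hs x).fderiv_right (m := ∞) (by simp)).differentiableAt (by simp)
  have key : ∀ w w' : ℝ × ℝ, EulerKorteweg.dirDeriv w (EulerKorteweg.dirDeriv w' F) (s, x)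
      = fderiv ℝ (fderiv ℝ F) (s, x) w w' := by
    intro w w'
    change fderiv ℝ (fun p => fderiv ℝ F p w') (s, x) w = _
    rw [fderiv_clm_apply h1 (differentiableAt_const w')]
    simp
  rw [key, key]
  exact (h.contDiffAt hs x).isSymmSndFDerivAt (by
    rw [minSmoothness_of_isRCLikeNormedField]
    exact ENat.LEInfty.out) w w'

theorem exists_le (h : SmoothDecay I F) {s₀ : ℝ} (hs₀ : s₀ ∈ I) : ∃ C α δ : ℝ, 0 < α ∧ 0 < δ ∧
    ∀ s ∈ I, |s - s₀| < δ → ∀ x : ℝ, |F (s, x)| ≤ C * Real.exp (-α * |x|) := by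
  simpa only [norm_iteratedFDeriv_zero, Real.norm_eq_abs] using h.decay s₀ hs₀ 0

theorem expDecay (h : SmoothDecay I F) (hs : s ∈ I) : ExpDecay fun x => F (s, x) := by
  obtain ⟨C, α, δ, hα, hδ, hb⟩ := h.exists_le hs
  exact ⟨C, α, hα, hb s hs (by simpa using hδ)⟩

theorem memLp (h : SmoothDecay I F) (hs : s ∈ I) :
    MemLp (fun x => F (s, x)) 2 (volume : Measure ℝ) :=
  (h.expDecay hs).memLp (h.continuous_snd hs)

/-- Differentiation under the integral sign of the `L²` inner product. -/
theorem hasDerivAt_integral_mul (hF : SmoothDecay I F) (hG : SmoothDecay I G) (hs : s ∈ I) :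
    HasDerivAt (fun s => ∫ x, F (s, x) * G (s, x))
      (∫ x, (EulerKorteweg.dirDeriv (1, 0) F (s, x) * G (s, x)
        + F (s, x) * EulerKorteweg.dirDeriv (1, 0) G (s, x))) s := by
  obtain ⟨C₀, α₀, δ₀, hα₀, hδ₀, hF0⟩ := hF.exists_le hs
  obtain ⟨C₁, α₁, δ₁, hα₁, hδ₁, hF1⟩ := (hF.dirDeriv (1, 0)).exists_le hs
  obtain ⟨D₀, β₀, ε₀, hβ₀, hε₀, hG0⟩ := hG.exists_le hs
  obtain ⟨D₁, β₁, ε₁, hβ₁, hε₁, hG1⟩ := (hG.dirDeriv (1, 0)).exists_le hs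
  have hS : ∀ᶠ s' in 𝓝 s, s' ∈ I ∧ |s' - s| < δ₀ ∧ |s' - s| < δ₁ ∧ |s' - s| < ε₀ ∧ |s' - s| < ε₁ := by
    have hlt : ∀ δ : ℝ, 0 < δ → ∀ᶠ s' in 𝓝 s, |s' - s| < δ := fun δ hδ => by
      filter_upwards [Metric.ball_mem_nhds s hδ] with s' h
      rwa [Metric.mem_ball, Real.dist_eq] at h
    filter_upwards [hF.isOpen.mem_nhds hs, hlt _ hδ₀, hlt _ hδ₁, hlt _ hε₀, hlt _ hε₁] with s' h1 h2
      h3 h4 h5 using ⟨h1, h2, h3, h4, h5⟩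
  refine (hasDerivAt_integral_of_dominated_loc_of_deriv_le
    (F := fun s x => F (s, x) * G (s, x))
    (F' := fun s x => EulerKorteweg.dirDeriv (1, 0) F (s, x) * G (s, x)
      + F (s, x) * EulerKorteweg.dirDeriv (1, 0) G (s, x))
    (bound := fun x => |C₁| * |D₀| * Real.exp (-β₀ * |x|) + |C₀| * |D₁| * Real.exp (-β₁ * |x|))
    hS ?_ ?_ ?_ ?_ ?_ ?_).2
  · filter_upwards [hF.isOpen.mem_nhds hs] with s' hs'
    exact ((hF.continuous_snd hs').mul (hG.continuous_snd hs')).aestronglyMeasurable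
  · exact (hF.memLp hs).integrable_mul (hG.memLp hs)
  · exact ((((hF.dirDeriv _).continuous_snd hs).mul (hG.continuous_snd hs)).add
      ((hF.continuous_snd hs).mul ((hG.dirDeriv _).continuous_snd hs))).aestronglyMeasurable
  · refine .of_forall fun x s' ⟨h1, h2, h3, h4, h5⟩ => (norm_add_le _ _).trans ?_
    -- One factor is merely bounded and the decay of the other is kept, which gives an integrable
    -- majorant independent of the speed.
    have key : ∀ {a b A α B β : ℝ}, 0 < α → |a| ≤ A * Real.exp (-α * |x|) →
        |b| ≤ B * Real.exp (-β * |x|) → ‖a * b‖ ≤ |A| * |B| * Real.exp (-β * |x|) := by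
      intro a b A α B β hα ha hb
      have ha' : |a| ≤ |A| := by
        refine ha.trans ((mul_le_mul_of_nonneg_right (le_abs_self A) (Real.exp_pos _).le).trans ?_)
        refine mul_le_of_le_one_right (abs_nonneg _) (Real.exp_le_one_iff.2 ?_)
        nlinarith [abs_nonneg x]
      have hb' : |b| ≤ |B| * Real.exp (-β * |x|) :=
        hb.trans (mul_le_mul_of_nonneg_right (le_abs_self B) (Real.exp_pos _).le)
      rw [Real.norm_eq_abs, abs_mul, mul_assoc]
      exact mul_le_mul ha' hb' (abs_nonneg _) (abs_nonneg _)
    exact add_le_add (key hα₁ (hF1 s' h1 h3 x) (hG0 s' h1 h4 x))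
      (key hα₀ (hF0 s' h1 h2 x) (hG1 s' h1 h5 x))
  · exact ((integrable_exp_neg_mul_abs hβ₀).const_mul _).add
      ((integrable_exp_neg_mul_abs hβ₁).const_mul _)
  · exact .of_forall fun x s' h => (hF.hasDerivAt_fst h.1 x).fun_mul (hG.hasDerivAt_fst h.1 x)

end SmoothDecay

/-! ### Branches of solitons -/

namespace IsSolitonBranch

variable {K g : ℝ → ℝ} {ρp vp : ℝ} {I : Set ℝ} {ρ v : ℝ → ℝ → ℝ}

theorem smoothDecay_comp (h : IsSolitonBranch K g ρp vp I ρ v) (L : ℝ × ℝ →L[ℝ] ℝ) :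
    SmoothDecay I fun p => L (ρ p.1 p.2 - ρp, v p.1 p.2 - vp) := by
  have hs : ContDiffOn ℝ ∞ (fun p : ℝ × ℝ => (ρ p.1 p.2 - ρp, v p.1 p.2 - vp)) (I ×ˢ univ) :=
    h.smooth.sub (contDiffOn_const (c := (ρp, vp)))
  refine ⟨h.isOpen, L.contDiff.comp_contDiffOn hs, fun s₀ hs₀ n => ?_⟩
  obtain ⟨C, α, δ, hα, hδ, hb⟩ := h.decay s₀ hs₀ n
  refine ⟨‖L‖ * C, α, δ, hα, hδ, fun s hsI hsδ x => ?_⟩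
  refine (L.norm_iteratedFDeriv_comp_left (hs.contDiffAt
    ((h.isOpen.prod isOpen_univ).mem_nhds ⟨hsI, mem_univ x⟩)) (by exact_mod_cast le_top)).trans ?_
  rw [mul_assoc]
  exact mul_le_mul_of_nonneg_left (hb s hsI hsδ x) (norm_nonneg _)

theorem smoothDecay_ρ (h : IsSolitonBranch K g ρp vp I ρ v) :
    SmoothDecay I fun p => ρ p.1 p.2 - ρp :=
  h.smoothDecay_comp (ContinuousLinearMap.fst ℝ ℝ ℝ)

theorem smoothDecay_v (h : IsSolitonBranch K g ρp vp I ρ v) :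
    SmoothDecay I fun p => v p.1 p.2 - vp :=
  h.smoothDecay_comp (ContinuousLinearMap.snd ℝ ℝ ℝ)

end IsSolitonBranch

/-! ### Smooth profiles as elements of `𝓗⁰` -/

namespace Coeff

variable {r r' u f : ℝ → ℝ} (κ : Coeff) (hr : MemLp r 2 (volume : Measure ℝ))
  (hr' : MemLp r' 2 (volume : Measure ℝ)) (hu : MemLp u 2 (volume : Measure ℝ))
  (h : IsWeakDeriv (hr.toLp r) (hr'.toLp r')) (hf : MemLp f 2 (volume : Measure ℝ))

theorem A₂_mk_toLp (hx : ∀ x, κ.a x * r x + κ.ρ x * u x = f x) :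
    κ.A₂ (HZero.mk _ _ (hu.toLp u) h) = hf.toLp f := by
  change mulOp κ.a (hr.toLp _) + mulOp κ.ρ (hu.toLp _) = _
  rw [mulOp_toLp, mulOp_toLp, ← MemLp.toLp_add]
  exact (MemLp.toLp_eq_toLp_iff _ _).2 (.of_forall hx)

theorem isWeakDeriv_mk_toLp (cr : Continuous r) (cu : Continuous u) (cf : Continuous f)
    (hx : ∀ x, HasDerivAt (fun x => κ.k x * r' x) (κ.q x * r x + κ.a x * u x - f x) x) :
    IsWeakDeriv (κ.A₁ (HZero.mk _ _ (hu.toLp u) h))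
      (κ.A₀ (HZero.mk _ _ (hu.toLp u) h) - hf.toLp f) := by
  change IsWeakDeriv (mulOp κ.k (hr'.toLp _))
    (mulOp κ.q (hr.toLp _) + mulOp κ.a (hu.toLp _) - hf.toLp _)
  rw [mulOp_toLp, mulOp_toLp, mulOp_toLp, ← MemLp.toLp_add, ← MemLp.toLp_sub]
  exact isWeakDeriv_toLp _ _ hx
    (((κ.q.continuous.mul cr).add (κ.a.continuous.mul cu)).sub cf)

end Coeff

namespace IsSolitonBranch

variable {K g : ℝ → ℝ} {ρp vp : ℝ} {I : Set ℝ} {ρ v : ℝ → ℝ → ℝ} {c : ℝ}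

/-- `∂ₛρ`. -/
def ds_ρ (ρp : ℝ) (ρ : ℝ → ℝ → ℝ) : ℝ × ℝ → ℝ := dirDeriv (1, 0) fun p => ρ p.1 p.2 - ρp

/-- `∂ₛv`. -/
def ds_v (vp : ℝ) (v : ℝ → ℝ → ℝ) : ℝ × ℝ → ℝ := dirDeriv (1, 0) fun p => v p.1 p.2 - vp

theorem smoothDecay_ds_ρ (h : IsSolitonBranch K g ρp vp I ρ v) : SmoothDecay I (ds_ρ ρp ρ) :=
  h.smoothDecay_ρ.dirDeriv _

theorem smoothDecay_ds_v (h : IsSolitonBranch K g ρp vp I ρ v) : SmoothDecay I (ds_v vp v) :=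
  h.smoothDecay_v.dirDeriv _

theorem deriv_ρ (h : IsSolitonBranch K g ρp vp I ρ v) {s : ℝ} (hs : s ∈ I) (x : ℝ) :
    deriv (ρ s) x = dirDeriv (0, 1) (fun p => ρ p.1 p.2 - ρp) (s, x) :=
  (((h.soliton s hs).smooth_ρ.hasDerivAt_infty x).sub_const ρp).unique
    (h.smoothDecay_ρ.hasDerivAt_snd hs x)

theorem deriv_deriv_ρ (h : IsSolitonBranch K g ρp vp I ρ v) {s : ℝ} (hs : s ∈ I) (x : ℝ) :
    deriv (deriv (ρ s)) x
      = dirDeriv (0, 1) (dirDeriv (0, 1) fun p => ρ p.1 p.2 - ρp) (s, x) := by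
  rw [show deriv (ρ s) = fun x => dirDeriv (0, 1) (fun p => ρ p.1 p.2 - ρp) (s, x) from
    funext (h.deriv_ρ hs)]
  exact ((h.smoothDecay_ρ.dirDeriv (0, 1)).hasDerivAt_snd hs x).deriv

theorem hasDerivAt_ρ (h : IsSolitonBranch K g ρp vp I ρ v) (hc : c ∈ I) (x : ℝ) :
    HasDerivAt (fun s => ρ s x) (ds_ρ ρp ρ (c, x)) c := by
  simpa [ds_ρ] using (h.smoothDecay_ρ.hasDerivAt_fst hc x).add_const ρp

theorem hasDerivAt_v (h : IsSolitonBranch K g ρp vp I ρ v) (hc : c ∈ I) (x : ℝ) :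
    HasDerivAt (fun s => v s x) (ds_v vp v (c, x)) c := by
  simpa [ds_v] using (h.smoothDecay_v.hasDerivAt_fst hc x).add_const vp

theorem hasDerivAt_deriv_ρ (h : IsSolitonBranch K g ρp vp I ρ v) (hc : c ∈ I) (x : ℝ) :
    HasDerivAt (fun s => deriv (ρ s) x) (dirDeriv (0, 1) (ds_ρ ρp ρ) (c, x)) c := by
  refine (((h.smoothDecay_ρ.dirDeriv (0, 1)).hasDerivAt_fst hc x).congr_deriv
    (h.smoothDecay_ρ.dirDeriv_comm _ _ hc x)).congr_of_eventuallyEq ?_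
  filter_upwards [h.isOpen.mem_nhds hc] with s hs using h.deriv_ρ hs x

theorem hasDerivAt_deriv_deriv_ρ (h : IsSolitonBranch K g ρp vp I ρ v) (hc : c ∈ I) (x : ℝ) :
    HasDerivAt (fun s => deriv (deriv (ρ s)) x)
      (dirDeriv (0, 1) (dirDeriv (0, 1) (ds_ρ ρp ρ)) (c, x)) c := by
  have hx := h.smoothDecay_ρ.dirDeriv (0, 1)
  refine ((((hx.dirDeriv (0, 1)).hasDerivAt_fst hc x).congr_deriv
    (hx.dirDeriv_comm _ _ hc x))).congr_deriv ?_ |>.congr_of_eventuallyEq ?_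
  · refine ((hx.dirDeriv (1, 0)).hasDerivAt_snd hc x).unique
      (((h.smoothDecay_ds_ρ.dirDeriv (0, 1)).hasDerivAt_snd hc x).congr_of_eventuallyEq
        (.of_forall fun y => h.smoothDecay_ρ.dirDeriv_comm _ _ hc y))
  · filter_upwards [h.isOpen.mem_nhds hc] with s hs using h.deriv_deriv_ρ hs x

/-- The second component of `δ²H[V] ∂ₛV`. -/
theorem mass_ds (h : IsSolitonBranch K g ρp vp I ρ v) (hc : c ∈ I) (x : ℝ) :
    (v c x - c) * ds_ρ ρp ρ (c, x) + ρ c x * ds_v vp v (c, x) = ρ c x - ρp := by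
  -- The flux constant `ρp (vp - s)` depends on the speed. Its derivative, with that of the explicit
  -- `-s` in `v - s`, produces the source `ρ - ρp`.
  have h1 : HasDerivAt (fun s => ρp * (vp - s)) (ρp * -1) c :=
    ((hasDerivAt_id c).const_sub vp).const_mul ρp
  have h2 := (h.hasDerivAt_ρ hc x).fun_mul ((h.hasDerivAt_v hc x).fun_sub (hasDerivAt_id c))
  have h3 := h2.unique (h1.congr_of_eventuallyEq (by
    filter_upwards [h.isOpen.mem_nhds hc] with s hs using (h.soliton s hs).mass x))
  simp only [id] at h3
  linarith

/-- The first component of `δ²H[V] ∂ₛV`. -/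
theorem hasDerivAt_capillarity_ds (h : IsSolitonBranch K g ρp vp I ρ v)
    (hK : ContDiffOn ℝ ∞ K (Ioi 0)) (hg : ContDiffOn ℝ ∞ g (Ioi 0)) (hρp : 0 < ρp) (hc : c ∈ I)
    (x : ℝ) : HasDerivAt (fun x => K (ρ c x) * dirDeriv (0, 1) (ds_ρ ρp ρ) (c, x))
      (potential K g (ρ c) x * ds_ρ ρp ρ (c, x) + (v c x - c) * ds_v vp v (c, x)
        - (v c x - vp)) x := by
  have hpos := (h.soliton c hc).pos x
  have d0 := h.hasDerivAt_ρ hc x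
  have dv := h.hasDerivAt_v hc x
  have k0 := (hK.hasDerivAt_Ioi hpos).comp c d0
  have k1 := (hK.deriv_Ioi.hasDerivAt_Ioi hpos).comp c d0
  have g0 := (hg.hasDerivAt_Ioi hpos).comp c d0
  have hl := (k0.fun_mul (h.hasDerivAt_deriv_deriv_ρ hc x)).fun_add
    ((k1.const_mul (1 / 2)).fun_mul ((h.hasDerivAt_deriv_ρ hc x).fun_pow 2))
  -- The explicit dependence on `s` of the two kinetic terms contributes `-(v - c) + (vp - c)`,
  -- which is the source `-(v - vp)`.
  have hr := ((((dv.fun_sub (hasDerivAt_id c)).fun_pow 2).div_const 2).fun_add g0).fun_sub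
    (((((hasDerivAt_id c).const_sub vp).fun_pow 2).div_const 2).add_const (g ρp))
  have heq := hl.unique (hr.congr_of_eventuallyEq (by
    filter_upwards [h.isOpen.mem_nhds hc] with s hs using (h.soliton s hs).flux_eq hK hg hρp x))
  have kx := (hK.hasDerivAt_Ioi hpos).comp x ((h.soliton c hc).smooth_ρ.hasDerivAt_infty x)
  refine (kx.fun_mul ((h.smoothDecay_ds_ρ.dirDeriv (0, 1)).hasDerivAt_snd hc x)).congr_deriv ?_
  simp only [Function.comp, id] at heq ⊢
  push_cast at heq
  simp only [potential, iteratedDeriv_two']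
  linear_combination heq

theorem hasDerivAt_momentum (h : IsSolitonBranch K g ρp vp I ρ v) (hc : c ∈ I) :
    HasDerivAt (fun s => momentum ρp vp (ρ s) (v s))
      (∫ x, (ds_ρ ρp ρ (c, x) * (v c x - vp) + (ρ c x - ρp) * ds_v vp v (c, x))) c :=
  h.smoothDecay_ρ.hasDerivAt_integral_mul h.smoothDecay_v hc

/-- The abstract growth result is applied with `e = ∂ₓV`, `N = ∂ₛV` and `(w, η) = (v - vp, ρ - ρp)`.
The required negativity is the stability condition, since `⟨(w, η), N⟩` is the derivative of the
momentum. -/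
theorem exists_growth (h : IsSolitonBranch K g ρp vp I ρ v) (hK : ContDiffOn ℝ ∞ K (Ioi 0))
    (hKpos : ∀ y, 0 < y → 0 < K y) (hg : ContDiffOn ℝ ∞ g (Ioi 0)) (hρp : 0 < ρp) (hc : c ∈ I)
    (hstab : deriv (fun s => momentum ρp vp (ρ s) (v s)) c < 0) :
    ∃ C, 0 < C ∧ ∀ W : ℝ → HZero, Continuous W → (∀ t₀ t₁,
      ((h.soliton c hc).coeff hK hg hρp).IsGen (∫ s in t₀..t₁, W s) (W t₁ - W t₀)) →
        ∀ t, ‖W t‖ ≤ C * (1 + |t|) * ‖W 0‖ := by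
  have hs := h.soliton c hc
  obtain ⟨m, x₀, hS⟩ := hs.exists_sturmData hK hKpos hg hρp (h.smoothDecay_ρ.expDecay hc)
  obtain ⟨hq, hk, ha, hρ⟩ := hs.coeff_isOf hK hg hρp
  generalize hs.coeff hK hg hρp = κ at hS hq hk ha hρ ⊢
  have cρ := hs.smooth_ρ.deriv_infty.continuous
  have cv := hs.smooth_v.deriv_infty.continuous
  have mρ := hs.expDecay_deriv.memLp cρ
  have mρ' := hs.expDecay_deriv_deriv.memLp hs.smooth_ρ.deriv_infty.deriv_infty.continuous
  have mv := hs.expDecay_deriv_v.memLp cv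
  have mη := h.smoothDecay_ρ.memLp hc
  have mw := h.smoothDecay_v.memLp hc
  have mr := h.smoothDecay_ds_ρ.memLp hc
  have mr' := (h.smoothDecay_ds_ρ.dirDeriv (0, 1)).memLp hc
  have mu := h.smoothDecay_ds_v.memLp hc
  have m0 : MemLp (fun _ : ℝ => (0 : ℝ)) 2 volume := MemLp.zero'
  have he := isWeakDeriv_toLp mρ mρ' (hs.smooth_ρ.deriv_infty.hasDerivAt_infty)
    hs.smooth_ρ.deriv_infty.deriv_infty.continuous
  have hN := isWeakDeriv_toLp mr mr' (h.smoothDecay_ds_ρ.hasDerivAt_snd hc)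
    ((h.smoothDecay_ds_ρ.dirDeriv (0, 1)).continuous_snd hc)
  have hm0 : m0.toLp _ = 0 := MemLp.toLp_zero _
  refine hS.exists_growth (e := HZero.mk _ _ (mv.toLp _) he) (N := HZero.mk _ _ (mu.toLp _) hN)
    (w := mw.toLp _) (η := mη.toLp _) mρ.coeFn_toLp mρ'.coeFn_toLp ?_ ?_
    (isWeakDeriv_toLp mw mv (fun x => (hs.smooth_v.hasDerivAt_infty x).sub_const vp) cv)
    (isWeakDeriv_toLp mη mρ (fun x => (hs.smooth_ρ.hasDerivAt_infty x).sub_const ρp) cρ) ?_ ?_ ?_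
  · rw [← hm0]
    refine κ.A₂_mk_toLp mρ mρ' mv he m0 fun x => ?_
    rw [ha, hρ]
    exact hs.deriv_v x
  · rw [← sub_zero (κ.A₀ _), ← hm0]
    refine κ.isWeakDeriv_mk_toLp mρ mρ' mv he m0 cρ cv continuous_const fun x => ?_
    simp only [hk, hq, ha, sub_zero]
    exact hs.hasDerivAt_capillarity hK x
  · refine κ.isWeakDeriv_mk_toLp mr mr' mu hN mw (h.smoothDecay_ds_ρ.continuous_snd hc)
      (h.smoothDecay_ds_v.continuous_snd hc) (h.smoothDecay_v.continuous_snd hc) fun x => ?_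
    simp only [hk, hq, ha]
    exact h.hasDerivAt_capillarity_ds hK hg hρp hc x
  · refine κ.A₂_mk_toLp mr mr' mu hN mη fun x => ?_
    rw [ha, hρ]
    exact h.mass_ds hc x
  · change ⟪mw.toLp _, mr.toLp _⟫ + ⟪mη.toLp _, mu.toLp _⟫ < 0
    rw [(h.hasDerivAt_momentum hc).deriv] at hstab
    rw [inner_toLp_toLp, inner_toLp_toLp]
    refine lt_of_eq_of_lt ?_ hstab
    refine (integral_add (mw.integrable_mul mr) (mη.integrable_mul mu)).symm.trans
      (integral_congr_ae (.of_forall fun x => ?_))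
    change (v c x - vp) * ds_ρ ρp ρ (c, x) + (ρ c x - ρp) * ds_v vp v (c, x)
      = ds_ρ ρp ρ (c, x) * (v c x - vp) + (ρ c x - ρp) * ds_v vp v (c, x)
    ring

end IsSolitonBranch

end EulerKorteweg

end

theorem mainTheorem5
    (K g : ℝ → ℝ) (hK : ContDiffOn ℝ ∞ K (Set.Ioi 0)) (hKpos : ∀ y : ℝ, 0 < y → 0 < K y)
    (hg : ContDiffOn ℝ ∞ g (Set.Ioi 0))
    (ρp vp : ℝ) (hρp : 0 < ρp) (I : Set ℝ) (ρ v : ℝ → ℝ → ℝ)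
    (hbranch : EulerKorteweg.IsSolitonBranch K g ρp vp I ρ v)
    (c : ℝ) (hc : c ∈ I)
    (hstab : deriv (fun s => EulerKorteweg.momentum ρp vp (ρ s) (v s)) c < 0) :
    ∃ C : ℝ, 0 < C ∧ ∀ (U₀ : EulerKorteweg.HZero) (U : ℝ → EulerKorteweg.HZero),
      EulerKorteweg.IsLinearizedSolution K g c (ρ c) (v c) U → U 0 = U₀ →
        ∀ t : ℝ, ‖U t‖ ≤ C * (1 + |t|) * ‖U₀‖ := by
  obtain ⟨C, hC, hgrowth⟩ := hbranch.exists_growth hK hKpos hg hρp hc hstab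
  refine ⟨C, hC, ?_⟩
  rintro _ U hU rfl t
  -- In the moving frame `W(t) = U(t, · + ct)`, and translation preserves the norm of `𝓗⁰`.
  have h := hgrowth (fun t => (U t).shift (c * t)) (hU.1.HZero_shift c)
    ((EulerKorteweg.IsSoliton.coeff_isOf _ hK hg hρp).isGen hU) t
  simpa only [EulerKorteweg.HZero.norm_shift] using h
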